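/- **Setting.** Let $\mathcal C$ be a category with a subcategory of *covers* such that: $\mathcal C$ has a terminal object $*$ and every map $X\to *$ is a cover; pullbacks of covers along arbitrary maps exist and are covers; if $g$ and $fg$ are covers then $f$ is a cover; every cover is the coequalizer of its kernel pair. For a simplicial object $X$ of $\mathcal C$ and a simplicial set $S$ put $\hom(S,X)=\lim_{\Delta^k\to S}X_k$ (if it exists). For $f:X\to Y$ and $S\subseteq\Delta^k$ consider the map from $X_k$ to the limit $\hom(S,X)\times_{\hom(S,Y)}Y_k$; it is denoted $\lambda^k_i(f):X_k\to\Lambda^k_i(f)$ for the horn $S=\Lambda^k_i$ and $\mu_k(f):X_k\to M_k(f)$ for $S=\partial\Delta^k$; for $Y=*$ write $\lambda^k_i(X)$, $\mu_k(X)$. Let $n\in\mathbb N\cup\{\infty\}$. * A *Lie $n$-groupoid* is a simplicial object $X$ such that for all $k>0$, $0\le i\le k$, the limit $\Lambda^k_i(X)$ exists and $\lambda^k_i(X)$ is a cover, and an isomorphism if $k>n$. * A map $f:X\to Y$ of Lie $\infty$-groupoids is an *$n$-stack* if for all $k>0$, $0\le i\le k$, the limit $\Lambda^k_i(f)$ exists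 and $\lambda^k_i(f)$ is a cover, and an isomorphism if $k>n$. It is an *$n$-hypercover* if for all $k\ge0$ the limit $M_k(f)$ exists and $\mu_k(f)$ is a cover, and an isomorphism if $k\ge n$. * An *orbit space* of $X$ is a cover $X_0\to\pi_0(X)$ that is a coequalizer of $d_0,d_1:X_1\rightrightarrows X_0$. * *Regular embeddings* form the smallest subcategory of $\mathcal C$ that is closed under pullback along covers and contains all graphs $X\to X\times Y$ of maps $X\to Y$. A Lie $n$-groupoid $X$ is *regular* if its anchor $\mu_1(X):X_1\to M_1(X)\cong X_0\times X_0$ is a regular embedding. *Godemont's Theorem holds in $\mathcal C$* if every regular Lie $m$-groupoid $X$ ($m\in\mathbb N\cup\{\infty\}$) has an orbit space. *Orbit spaces of regular Lie groupoids are effective* if moreover, for each such $X$ and orbit space $X_0\to\pi_0(X)$, the map $(d_1,d_0)$ identifies $X_1$ with $X_0\times_{\pi_0(X)}X_0$ (that is, $\pi_0(X)$ is the quotient by exactly the equivalence relation $X_1$, as in Godemont's theorem for manifolds). * A *twisted Cartesian product* is a map $p:E\to U$ for which there are a simplicial object $Y$ and isomorphisms $\varphi_k:E_k\cong U_k\times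 Y_k$ over $U_k$, compatible with all degeneracies and with the faces $d_i$, $i<k$. For $n\in\mathbb N$, a *local $n$-bundle* is a twisted Cartesian product that is an $n$-stack. * For $n\in\mathbb N$ and $f:X\to Y$, the *higher morphism space* $P^{\ge n}(f)$ is the simplicial object whose $\ell$-simplices are the $x\in X_{n+\ell}$ whose image in $\hom(\partial\Delta^{n-1}\star\Delta^\ell,X)\times_{\hom(\partial\Delta^{n-1}\star\Delta^\ell,Y)}Y_{n+\ell}$ is degenerate on a point of $\hom(\partial\Delta^{n-1}\star\Delta^0,X)\times_{\hom(\partial\Delta^{n-1}\star\Delta^0,Y)}Y_n=\Lambda^n_n(f)$, along $1\star(\Delta^\ell\to\Delta^0)$. Thus $P^{\ge n}(f)_0=X_n$; for $n=0$ it is $X\times_YY_0$ with $Y_0$ constant. * For $n\in\mathbb N$, the *$n$-strictification* of an $\infty$-stack $f:X\to Y$ is a simplicial object $\tau_n(X,f)=T$ with maps $X\to T\xrightarrow{\tau_n(f)}Y$ composing to $f$, such that $T_k=X_k$ for $k<n$; $X_n\to T_n$ is an orbit space of $P^{\ge n}(f)$; $T_{n+1}=\Lambda^{n+1}_1(\tau_n(f))$;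 and $T=\operatorname{csk}_{n+1}\operatorname{tr}_{n+1}T\times_{\operatorname{Csk}_{n+1}Y}Y$. **Theorem (Descent for $n$-bundles).** Suppose that Godemont's Theorem holds in $\mathcal C$. Let $n\in\mathbb N$, let $p:E\to U$ be a local $n$-bundle and $f:U\to X$ an $(n+1)$-hypercover. Then $fp:E\to X$ is an $(n+1)$-stack, and $P^{\ge n}(fp)$ exists in $\mathcal C$, is a Lie $1$-groupoid, its anchor map is a regular embedding, and its orbit space $\pi_0(P^{\ge n}(fp))$ exists. If orbit spaces of regular Lie groupoids in $\mathcal C$ are effective, then the $n$-strictification $\tau_n(fp):\tau_n(E,fp)\to X$ exists. -/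

import Mathlib

open CategoryTheory

universe v u

namespace HigherStack

open CategoryTheory.Limits Opposite

variable {C : Type u} [Category.{v} C]

/-! ### Categories with covers and regular embeddings -/

/-- The axioms on the subcategory `W` of covers of the ambient category `C`. -/
structure IsCategoryWithCovers (W : MorphismProperty C) : Prop where
  /-- covers form a subcategory (which contains all objects by `exists_terminal`) -/
  isMultiplicative : W.IsMultiplicative
  /-- there is a terminal object, and every map to it is a cover -/
  exists_terminal : ∃ pt : C, Nonempty (IsTerminal pt) ∧ ∀ (X : C) (f : X ⟶ pt), W f
  /-- pullbacks of covers along arbitrary maps exist -/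
  hasPullback : ∀ {X Y Z : C} (f : X ⟶ Z) (g : Y ⟶ Z), W f → HasPullback f g
  /-- pullbacks of covers along arbitrary maps are covers -/
  of_isPullback : ∀ {P X Y Z : C} {p₁ : P ⟶ X} {p₂ : P ⟶ Y} {f : X ⟶ Z} {g : Y ⟶ Z},
    IsPullback p₁ p₂ f g → W f → W p₂
  /-- right cancellation -/
  of_comp : ∀ {X Y Z : C} (g : X ⟶ Y) (f : Y ⟶ Z), W (g ≫ f) → W g → W f
  /-- covers are effective epimorphisms: they are the coequalizer of their kernel pair -/
  effective : ∀ {R X Y : C} (f : X ⟶ Y) (a b : R ⟶ X) (h : IsKernelPair f a b), W f →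
    Nonempty (IsColimit (Cofork.ofπ f h.w))

/-- Regular embeddings: the smallest subcategory that is closed under pullback along covers and
contains all graphs.  In `graph`, the object `P` is a product of `X` and `Y` with projections
`fst` and `snd`, and `g` is the graph `(𝟙, g ≫ snd)` of the map `g ≫ snd : X ⟶ Y`. -/
inductive RegularEmbedding (W : MorphismProperty C) : ∀ {X Y : C}, (X ⟶ Y) → Prop where
  | id (X : C) : RegularEmbedding W (𝟙 X)
  | comp {X Y Z : C} (f : X ⟶ Y) (g : Y ⟶ Z) (hf : RegularEmbedding W f)
      (hg : RegularEmbedding W g) : RegularEmbedding W (f ≫ g)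
  | graph {X Y P : C} (fst : P ⟶ X) (snd : P ⟶ Y) (hP : Nonempty (IsLimit (BinaryFan.mk fst snd)))
      (g : X ⟶ P) (hg : g ≫ fst = 𝟙 X) : RegularEmbedding W g
  | pullback {X Y X' Y' : C} {c' : X' ⟶ X} {i' : X' ⟶ Y'} {i : X ⟶ Y} {c : Y' ⟶ Y}
      (h : IsPullback c' i' i c) (hc : W c) (hi : RegularEmbedding W i) : RegularEmbedding W i'

open Simplicial

/-! ### The limits `hom(S, X)` and their relative versions -/

/-- For a simplicial object `X` of `C` and an object `A`, the simplicial set `Hom(A, X_•)`,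
contravariantly functorial in `A`. -/
def homSSet (X : SimplicialObject C) : Cᵒᵖ ⥤ SSet.{v} :=
  coyoneda ⋙ (Functor.whiskeringLeft SimplexCategoryᵒᵖ C (Type v)).obj X

/-- The map `Hom(A, X_•) ⟶ Hom(A, Y_•)` induced by `f : X ⟶ Y`. -/
def homSSetMap {X Y : SimplicialObject C} (f : X ⟶ Y) : homSSet X ⟶ homSSet Y :=
  Functor.whiskerLeft coyoneda ((Functor.whiskeringLeft SimplexCategoryᵒᵖ C (Type v)).map f)

/-- An `A`-valued point of `X_k`, as a map of simplicial sets `Δ^k ⟶ Hom(A, X_•)`. -/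
def simplexMap (X : SimplicialObject C) {A : C} (k : ℕ) (x : A ⟶ X _⦋k⦌) :
    (Δ[k] : SSet.{v}) ⟶ (homSSet X).obj (op A) :=
  SSet.yonedaEquiv.symm x

/-- The functor of points `A ↦ Hom(S, Hom(A, X_•))` of the limit
`hom(S, X) = lim_{Δ^k → S} X_k`: a cone with apex `A` over the diagram of all simplices of `S`
is the same thing as a map `S ⟶ Hom(A, X_•)`.  The limit exists in `C` exactly when this presheaf
is representable. -/
def homPoints (S : SSet.{v}) (X : SimplicialObject C) : Cᵒᵖ ⥤ Type v :=
  homSSet X ⋙ coyoneda.obj (op S)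

/-- An `A`-valued point of `hom(S, X) ×_{hom(S, Y)} hom(T, Y)`, for `i : S ⟶ T` and `f : X ⟶ Y`. -/
@[ext]
structure RelPoint {S T : SSet.{v}} (i : S ⟶ T) {X Y : SimplicialObject C} (f : X ⟶ Y) (A : C) where
  /-- the component in `hom(S, X)` -/
  left : S ⟶ (homSSet X).obj (op A)
  /-- the component in `hom(T, Y)` -/
  right : T ⟶ (homSSet Y).obj (op A)
  w : left ≫ (homSSetMap f).app (op A) = i ≫ right

/-- The functor of points of the limit `hom(S, X) ×_{hom(S, Y)} hom(T, Y)`. -/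
def relPoints {S T : SSet.{v}} (i : S ⟶ T) {X Y : SimplicialObject C} (f : X ⟶ Y) :
    Cᵒᵖ ⥤ Type v where
  obj A := RelPoint i f A.unop
  map {A B} a := TypeCat.ofHom fun s =>
    { left := s.left ≫ (homSSet X).map a
      right := s.right ≫ (homSSet Y).map a
      w := by
        have h := (homSSetMap f).naturality a
        rw [Category.assoc, h, ← Category.assoc, ← Category.assoc]
        exact congrArg (· ≫ _) s.w }

/-- A presheaf `F` is representable by an object `L` (i.e. the limit in `C` of which `F` is the
functor of points exists), and the map `A ⟶ L` corresponding to the point `x` satisfies `Q`. -/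
def MapToLimit (F : Cᵒᵖ ⥤ Type v) {A : C} (x : F.obj (op A)) (Q : ∀ {L : C}, (A ⟶ L) → Prop) :
    Prop :=
  ∃ (L : C) (R : F.RepresentableBy L), Q (R.homEquiv.symm x)

/-- The tautological `X_k`-valued point of `hom(S, X)`, for `S ⊆ Δ^k`; it corresponds to the
restriction map `X_k ⟶ hom(S, X)`. -/
def absTaut (X : SimplicialObject C) {k : ℕ} (S : (Δ[k] : SSet.{v}).Subcomplex) :
    (homPoints (S : SSet.{v}) X).obj (op (X _⦋k⦌)) :=
  S.ι ≫ simplexMap X k (𝟙 (X _⦋k⦌))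

/-- The tautological `X_k`-valued point of `hom(S, X) ×_{hom(S, Y)} Y_k`, for `S ⊆ Δ^k`. -/
def relTaut {X Y : SimplicialObject C} (f : X ⟶ Y) {k : ℕ} (S : (Δ[k] : SSet.{v}).Subcomplex) :
    (relPoints S.ι f).obj (op (X _⦋k⦌)) where
  left := S.ι ≫ simplexMap X k (𝟙 (X _⦋k⦌))
  right := simplexMap Y k (f.app (op ⦋k⦌))
  w := by
    rw [Category.assoc]
    congr 1
    refine (SSet.yonedaEquiv_symm_comp _ _).trans ?_
    refine congrArg SSet.yonedaEquiv.symm ?_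
    exact Category.id_comp _

/-- `AbsLimit X S Q`: the limit `hom(S, X)` exists and the map `X_k ⟶ hom(S, X)` satisfies `Q`. -/
def AbsLimit (X : SimplicialObject C) {k : ℕ} (S : (Δ[k] : SSet.{v}).Subcomplex)
    (Q : ∀ {L : C}, (X _⦋k⦌ ⟶ L) → Prop) : Prop :=
  MapToLimit (homPoints (S : SSet.{v}) X) (absTaut X S) Q

/-- `RelLimit f S Q`: the limit `hom(S, X) ×_{hom(S, Y)} Y_k` exists and the map from `X_k` to it
satisfies `Q`.  For `S = Λ[k, i]` this is the map `λ^k_i(f)`, for `S = ∂Δ[k]` the map `μ_k(f)`. -/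
def RelLimit {X Y : SimplicialObject C} (f : X ⟶ Y) {k : ℕ} (S : (Δ[k] : SSet.{v}).Subcomplex)
    (Q : ∀ {L : C}, (X _⦋k⦌ ⟶ L) → Prop) : Prop :=
  MapToLimit (relPoints S.ι f) (relTaut f S) Q

/-! ### Lie `n`-groupoids, hypercovers, stacks, orbit spaces -/

/-- Lie `n`-groupoids, `n ∈ ℕ ∪ {∞}`. -/
def IsLieGroupoid (W : MorphismProperty C) (n : ℕ∞) (X : SimplicialObject C) : Prop :=
  ∀ (k : ℕ) (i : Fin (k + 1)), 0 < k →
    AbsLimit X (SSet.horn k i) (fun l => W l ∧ (n < (k : ℕ∞) → IsIso l))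

/-- `n`-hypercovers, `n ∈ ℕ ∪ {∞}`. -/
structure IsHypercover (W : MorphismProperty C) (n : ℕ∞) {X Y : SimplicialObject C} (f : X ⟶ Y) :
    Prop where
  source : IsLieGroupoid W ⊤ X
  target : IsLieGroupoid W ⊤ Y
  matching : ∀ k : ℕ,
    RelLimit f (SSet.boundary k) (fun l => W l ∧ (n ≤ (k : ℕ∞) → IsIso l))

/-- `n`-stacks, `n ∈ ℕ ∪ {∞}`. -/
structure IsStack (W : MorphismProperty C) (n : ℕ∞) {X Y : SimplicialObject C} (f : X ⟶ Y) :
    Prop where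
  source : IsLieGroupoid W ⊤ X
  target : IsLieGroupoid W ⊤ Y
  horns : ∀ (k : ℕ) (i : Fin (k + 1)), 0 < k →
    RelLimit f (SSet.horn k i) (fun l => W l ∧ (n < (k : ℕ∞) → IsIso l))

/-- `q : X_0 ⟶ Q` is an orbit space of `X`: a cover which is the coequalizer of the two face maps
`X_1 ⇉ X_0`. -/
def IsOrbitSpace (W : MorphismProperty C) (X : SimplicialObject C) {Q : C} (q : X _⦋0⦌ ⟶ Q) :
    Prop :=
  W q ∧ ∃ w : X.δ (0 : Fin 2) ≫ q = X.δ (1 : Fin 2) ≫ q, Nonempty (IsColimit (Cofork.ofπ q w))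

/-- The condition on a Lie `n`-groupoid to be regular: `μ_1(X) : X_1 ⟶ M_1(X) ≅ X_0 × X_0` is a
regular embedding. -/
def IsRegular (W : MorphismProperty C) (X : SimplicialObject C) : Prop :=
  AbsLimit X (SSet.boundary 1) (fun l => RegularEmbedding W l)

/-- Godemont's Theorem holds: every regular Lie `m`-groupoid has an orbit space. -/
def GodemontHolds (W : MorphismProperty C) : Prop :=
  ∀ (m : ℕ∞) (X : SimplicialObject C), IsLieGroupoid W m X → IsRegular W X →
    ∃ (Q : C) (q : X _⦋0⦌ ⟶ Q), IsOrbitSpace W X q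

/-- Orbit spaces of regular Lie `m`-groupoids are effective: if `q : X_0 ⟶ Q` is the orbit space,
then `(d_1, d_0)` identifies `X_1` with the kernel pair `X_0 ×_Q X_0`. -/
def EffectiveOrbitSpaces (W : MorphismProperty C) : Prop :=
  ∀ (m : ℕ∞) (X : SimplicialObject C), IsLieGroupoid W m X → IsRegular W X →
    ∀ (Q : C) (q : X _⦋0⦌ ⟶ Q), IsOrbitSpace W X q →
      IsKernelPair q (X.δ (1 : Fin 2)) (X.δ (0 : Fin 2))

/-! ### Local `n`-bundles -/

/-- Twisted Cartesian products: `p : E ⟶ X` together with a simplicial object `Y` and isomorphisms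
`(p_k, ψ_k) : E_k ≅ X_k × Y_k` over `X_k`, compatible with all degeneracies and with all face maps
but the last one. -/
def IsTwistedCartesianProduct {E X : SimplicialObject C} (p : E ⟶ X) : Prop :=
  ∃ (Y : SimplicialObject C) (ψ : ∀ k : ℕ, E _⦋k⦌ ⟶ Y _⦋k⦌),
    (∀ k : ℕ, Nonempty (IsLimit (BinaryFan.mk (p.app (op ⦋k⦌)) (ψ k)))) ∧
    (∀ (k : ℕ) (i : Fin (k + 2)), i.val < k + 1 → E.δ i ≫ ψ k = ψ (k + 1) ≫ Y.δ i) ∧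
    (∀ (k : ℕ) (i : Fin (k + 1)), E.σ i ≫ ψ (k + 1) = ψ k ≫ Y.σ i)

/-- Local `n`-bundles. -/
structure IsLocalBundle (W : MorphismProperty C) (n : ℕ) {E X : SimplicialObject C} (p : E ⟶ X) :
    Prop where
  twisted : IsTwistedCartesianProduct p
  stack : IsStack W n p

/-! ### Higher morphism spaces -/

/-- The map `1 ⋆ θ : [k-1] ⋆ [a] ⟶ [k-1] ⋆ [b]`. -/
def joinLeftMap (k : ℕ) {a b : ℕ} (θ : Fin (a + 1) →o Fin (b + 1)) :
    Fin (k + a + 1) →o Fin (k + b + 1) where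
  toFun j := if h : j.val < k then ⟨j.val, by omega⟩ else ⟨k + (θ ⟨j.val - k, by omega⟩).val, by omega⟩
  monotone' := by
    intro i j hij
    have hij' : i.val ≤ j.val := hij
    by_cases hi : i.val < k <;> by_cases hj : j.val < k
    · simpa [hi, hj] using hij
    · simp only [hi, hj, dite_true, dite_false, Fin.mk_le_mk]; omega
    · omega
    · simp only [hi, hj, dite_false, Fin.mk_le_mk]
      have h : θ ⟨i.val - k, by omega⟩ ≤ θ ⟨j.val - k, by omega⟩ :=
        θ.monotone (by simp only [Fin.mk_le_mk]; omega)
      have := Fin.le_def.mp h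
      omega

lemma joinLeftMap_val (k : ℕ) {a b : ℕ} (θ : Fin (a + 1) →o Fin (b + 1)) (j : Fin (k + a + 1)) :
    (joinLeftMap k θ j).val =
      if h : j.val < k then j.val else k + (θ ⟨j.val - k, by omega⟩).val :=
  apply_dite Fin.val _ _ _

lemma joinLeftMap_id (k a : ℕ) :
    joinLeftMap k (OrderHom.id : Fin (a + 1) →o Fin (a + 1)) = OrderHom.id := by
  ext j
  rw [joinLeftMap_val]
  by_cases h : j.val < k
  · simp [h]
  · simp [h]
    omega

lemma joinLeftMap_comp (k : ℕ) {a b c : ℕ} (θ : Fin (a + 1) →o Fin (b + 1))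
    (η : Fin (b + 1) →o Fin (c + 1)) :
    joinLeftMap k (η.comp θ) = (joinLeftMap k η).comp (joinLeftMap k θ) := by
  ext j
  simp only [OrderHom.comp_coe, Function.comp_apply, joinLeftMap_val]
  by_cases h : j.val < k
  · simp [h]
  · simp [h]

/-- The functor `[ℓ] ↦ [k-1] ⋆ [ℓ] = [k + ℓ]`; it is the ordinal sum with `{0, …, k-1}` on the
left (which is empty for `k = 0`). -/
def joinLeft (k : ℕ) : SimplexCategory ⥤ SimplexCategory where
  obj a := ⦋k + a.len⦌
  map θ := SimplexCategory.mkHom (joinLeftMap k θ.toOrderHom)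
  map_id a := congrArg SimplexCategory.mkHom (joinLeftMap_id k a.len)
  map_comp θ η := congrArg SimplexCategory.mkHom (joinLeftMap_comp k θ.toOrderHom η.toOrderHom)

/-- The simplicial object `X^{Δ^{k-1}⋆}`, with `ℓ`-simplices `hom(Δ^{k-1} ⋆ Δ^ℓ, X) = X_{k+ℓ}`. -/
def joinShift (k : ℕ) (X : SimplicialObject C) : SimplicialObject C :=
  (joinLeft k).op ⋙ X

/-- The map `[k + ℓ] ⟶ [k]`, `j ↦ min j k`, i.e. `1 ⋆ ([ℓ] ⟶ [0])`. -/
def collapse (k ℓ : ℕ) : (⦋k + ℓ⦌ : SimplexCategory) ⟶ ⦋k⦌ :=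
  SimplexCategory.mkHom
    { toFun := fun j : Fin (k + ℓ + 1) => (⟨min j.val k, by omega⟩ : Fin (k + 1))
      monotone' := fun i j hij => by
        have : i.val ≤ j.val := hij
        simp only [Fin.mk_le_mk]
        omega }

/-- The subcomplex `∂Δ^{k-1} ⋆ Δ^ℓ` of `Δ^{k-1} ⋆ Δ^ℓ = Δ^{k+ℓ}`: the union of the faces opposite
to the vertices `i < k`.  It is the preimage of `∂Δ^{k-1} ⋆ Δ^0 = Λ^k_k` under
`1 ⋆ (Δ^ℓ ⟶ Δ^0)`. -/
def boundaryJoin (k ℓ : ℕ) : (Δ[k + ℓ] : SSet.{v}).Subcomplex :=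
  (SSet.horn k (Fin.last k)).preimage (SSet.stdSimplex.map (collapse k ℓ))

/-- The projection `∂Δ^{k-1} ⋆ Δ^ℓ ⟶ ∂Δ^{k-1} ⋆ Δ^0 = Λ^k_k`. -/
def boundaryJoinProj (k ℓ : ℕ) :
    (boundaryJoin.{v} k ℓ : SSet.{v}) ⟶ (SSet.horn.{v} k (Fin.last k) : SSet.{v}) :=
  SSet.Subcomplex.lift ((boundaryJoin.{v} k ℓ).ι ≫ SSet.stdSimplex.map (collapse k ℓ)) (by
    rintro d _ ⟨x, rfl⟩
    exact x.2)

/-- An `A`-valued point `x` of `(X^{Δ^{k-1}⋆})_ℓ = X_{k+ℓ}` lies in `P^{≥k}(f)_ℓ`, that is, its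
image in `hom(∂Δ^{k-1} ⋆ Δ^ℓ, X) ×_{hom(∂Δ^{k-1} ⋆ Δ^ℓ, Y)} Y_{k+ℓ}` is the (total) degeneracy of
an `A`-valued point `s` of `Λ^k_k(f)`, viewed as the space of `0`-simplices. -/
def IsHigherMorphism (k : ℕ) {X Y : SimplicialObject C} (f : X ⟶ Y) (ℓ : ℕ) {A : C}
    (x : A ⟶ X _⦋k + ℓ⦌) : Prop :=
  ∃ s : RelPoint (SSet.horn.{v} k (Fin.last k)).ι f A,
    (boundaryJoin k ℓ).ι ≫ simplexMap X (k + ℓ) x = boundaryJoinProj k ℓ ≫ s.left ∧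
    simplexMap Y (k + ℓ) (x ≫ f.app (op ⦋k + ℓ⦌)) =
      SSet.stdSimplex.map (collapse k ℓ) ≫ s.right

/-- The simplicial object `P`, with its map `ι` to `X^{Δ^{k-1}⋆}`, is the relative higher morphism
space `P^{≥k}(f)`: the (levelwise) pullback of `X^{Δ^{k-1}⋆}` and the constant simplicial object
`Λ^k_k(f)` over `X^{∂Δ^{k-1}⋆} ×_{Y^{∂Δ^{k-1}⋆}} Y^{Δ^{k-1}⋆}`.  (A point of `Λ^k_k(f)` is
determined by its degeneracy, so the pullback is a subobject of `X^{Δ^{k-1}⋆}`.)  For `k = 0` this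
is the pullback of `X` and the constant simplicial object `Y_0` over `Y`. -/
def IsHigherMorphismSpace (k : ℕ) {X Y : SimplicialObject C} (f : X ⟶ Y) {P : SimplicialObject C}
    (ι : P ⟶ joinShift k X) : Prop :=
  ∀ ℓ : ℕ,
    (∀ {A : C} (a b : A ⟶ P _⦋ℓ⦌), a ≫ ι.app (op ⦋ℓ⦌) = b ≫ ι.app (op ⦋ℓ⦌) → a = b) ∧
    (∀ {A : C} (x : A ⟶ X _⦋k + ℓ⦌),
      IsHigherMorphism k f ℓ x ↔ ∃ a : A ⟶ P _⦋ℓ⦌, a ≫ ι.app (op ⦋ℓ⦌) = x)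

/-! ### Strictification -/

/-- `g : T ⟶ Y`, with the canonical map `q : X ⟶ T` over `Y`, is the `n`-strictification
`τ_n(f) : τ_n(X, f) ⟶ Y` of `f : X ⟶ Y`.
* `T_k = X_k` for `k < n`.
* `T_n` is the orbit space of `P^{≥n}(f)`, whose object of vertices is `X_n`.
* `T_{n+1} = Λ^{n+1}_1(τ_n(f))` (so that the face map `d_1` of `T` is a "missing face map", which,
  `q` being simplicial, is induced by `d_1 : X_{n+1} ⟶ X_n`).
* `T = csk_{n+1} tr_{n+1} T ×_{Csk_{n+1} Y} Y`, i.e. `T_k` is the limit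
  `hom(sk_{n+1} Δ^k, T) ×_{hom(sk_{n+1} Δ^k, Y)} Y_k` for all `k`; in the indexing of
  `SSet.skeleton`, `sk_{n+1}` is `skeleton (n + 2)`. -/
structure IsStrictification (W : MorphismProperty C) (n : ℕ) {X Y T : SimplicialObject C}
    (f : X ⟶ Y) (g : T ⟶ Y) (q : X ⟶ T) : Prop where
  fac : q ≫ g = f
  below : ∀ k : ℕ, k < n → IsIso (q.app (op ⦋k⦌))
  orbit : ∃ (P : SimplicialObject C) (ι : P ⟶ joinShift n X), IsHigherMorphismSpace n f ι ∧
    IsOrbitSpace W P (Q := T _⦋n⦌) (ι.app (op ⦋0⦌) ≫ q.app (op ⦋n⦌))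
  horn : RelLimit g (SSet.horn (n + 1) 1) (fun l => IsIso l)
  coskeletal : ∀ k : ℕ,
    RelLimit g ((Δ[k] : SSet.{v}).skeleton (n + 2)) (fun l => IsIso l)

end HigherStack

/-! Write g = fp. Let V_k be the limit of hom(sk_{n-1} Δ^k, U) and X_k over hom(sk_{n-1} Δ^k, X).
Since f is a hypercover, U_k → V_k is a cover. Call two points of E_k related (`HigherRel`) if they
have the same image in X_k and the same faces of dimension less than n, and if their n-dimensional
faces are joined by higher morphisms of g.

The heart of the proof is that this relation is a parallel transport along U_k → V_k: if a ∈ E_k and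
u ∈ U_k have the same image in V_k, there is exactly one b over u that is related to a
(`exists_transport`, `HigherRel.eq_of_map_eq`). For k = n, boundaries of dimension n + 1 have unique
fillers for f, which gives a homotopy in U from p(a) to u; horns of dimension n + 1 have unique
fillers for p, which lifts it to E. For k > n the transported faces are reassembled to a simplex.

Hence the relation R_k is E_k ×_{V_k} U_k, and its projection to E_k is a cover. With E_k ≅ U_k ×
Y_k, the map R_k → E_k × E_k ≅ E_k × U_k × Y_k is the graph R_k → R_k × Y_k followed by a base
change of the diagonal of V_k, so it is a regular embedding (`IsNerve.regularEmbedding`). A higher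
morphism is determined by its vertices (`IsHM.ext`), and pairwise related vertices span one
(`IsHM.exists_of_pairwise`). So P^{≥n}(g) is the nerve of R_n, a regular Lie 1-groupoid, and
Godemont's Theorem applies.

If orbit spaces are effective, all quotients T_k = E_k / R_k exist. A simplex of E is the same thing
as a pair of simplices of T and U with compatible images (`IsHigherQuotient.exists_of_overRel`).
Therefore the unique filling properties of p hold for T → X after passage to a cover, and they
descend by uniqueness. These are the properties that define the strictification.

That g is an (n+1)-stack is proved cell by cell. Limits are treated as presheaves throughout, and
"cover" is replaced by "relatively representable by covers" (`IsRelCover`), which is stable under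
composition and base change whether or not the limits are known to exist. -/

namespace HigherStack

open CategoryTheory.Limits Opposite Simplicial

variable {C : Type u} [Category.{v} C]

/-! ### Presheaf maps that are relatively representable by covers -/

section RelCover

variable {F G H : Cᵒᵖ ⥤ Type v}

lemma map_op_comp_apply (F : Cᵒᵖ ⥤ Type v) {A B D : C} (d : D ⟶ B) (b : B ⟶ A)
    (x : F.obj (op A)) : F.map (d ≫ b).op x = F.map d.op (F.map b.op x) := by
  rw [op_comp, F.map_comp]; rfl

lemma map_op_id_apply (F : Cᵒᵖ ⥤ Type v) {A : C} (x : F.obj (op A)) :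
    F.map (𝟙 A).op x = x := by
  rw [op_id, F.map_id]; rfl

/-- Naturality of a family of maps between the values of two presheaves. -/
def IsNatural (φ : ∀ A : C, F.obj (op A) → G.obj (op A)) : Prop :=
  ∀ ⦃A B : C⦄ (b : B ⟶ A) (x : F.obj (op A)), φ B (F.map b.op x) = G.map b.op (φ A x)

/-- The map `φ` of presheaves is relatively representable by covers. -/
def IsRelCover (W : MorphismProperty C) (φ : ∀ A : C, F.obj (op A) → G.obj (op A)) : Prop :=
  ∀ (A : C) (y : G.obj (op A)), ∃ (D : C) (c : D ⟶ A) (x : F.obj (op D)),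
    W c ∧ φ D x = G.map c.op y ∧
    ∀ (B : C) (b : B ⟶ A) (x' : F.obj (op B)), φ B x' = G.map b.op y →
      ∃! d : B ⟶ D, d ≫ c = b ∧ F.map d.op x = x'

variable {W : MorphismProperty C}

lemma IsRelCover.comp [W.IsMultiplicative] {φ : ∀ A : C, F.obj (op A) → G.obj (op A)}
    {ψ : ∀ A : C, G.obj (op A) → H.obj (op A)} (hψ : IsRelCover W ψ) (hφ : IsRelCover W φ)
    (nφ : IsNatural φ) (nψ : IsNatural ψ) : IsRelCover W (fun A x => ψ A (φ A x)) := by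
  intro A y
  obtain ⟨D₁, c₁, g, hc₁, hg, ug⟩ := hψ A y
  obtain ⟨D₂, c₂, x, hc₂, hx, ux⟩ := hφ D₁ g
  refine ⟨D₂, c₂ ≫ c₁, x, W.comp_mem _ _ hc₂ hc₁, ?_, fun B b x' hx' => ?_⟩
  · change ψ D₂ (φ D₂ x) = _
    rw [hx, nψ, hg, map_op_comp_apply]
  · obtain ⟨d₁, ⟨h₁, h₁'⟩, u₁⟩ := ug B b (φ B x') hx'
    obtain ⟨d₂, ⟨h₂, h₂'⟩, u₂⟩ := ux B d₁ x' h₁'.symm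
    refine ⟨d₂, ⟨by rw [← Category.assoc, h₂, h₁], h₂'⟩, ?_⟩
    rintro d ⟨hd, hd'⟩
    refine u₂ d ⟨u₁ _ ⟨by rw [Category.assoc, hd], ?_⟩, hd'⟩
    rw [map_op_comp_apply, ← hx, ← nφ, hd']

/-- The hypotheses `w`, `hinj` and `hex` say that the square is a pullback of sets on points over
each object, so the universal point for `φ` also serves for `φ'`. -/
lemma IsRelCover.baseChange {F' G' : Cᵒᵖ ⥤ Type v} {φ : ∀ A : C, F.obj (op A) → G.obj (op A)}
    (hφ : IsRelCover W φ) {φ' : ∀ A : C, F'.obj (op A) → G'.obj (op A)}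
    {a : ∀ A : C, F'.obj (op A) → F.obj (op A)} {b : ∀ A : C, G'.obj (op A) → G.obj (op A)}
    (nφ' : IsNatural φ') (na : IsNatural a) (nb : IsNatural b)
    (w : ∀ (A : C) (x : F'.obj (op A)), φ A (a A x) = b A (φ' A x))
    (hinj : ∀ (A : C) (x x' : F'.obj (op A)), φ' A x = φ' A x' → a A x = a A x' → x = x')
    (hex : ∀ (A : C) (y : G'.obj (op A)) (x : F.obj (op A)), b A y = φ A x →
      ∃ x', φ' A x' = y ∧ a A x' = x) : IsRelCover W φ' := by
  intro A y
  obtain ⟨D, c, x, hc, hx, ux⟩ := hφ A (b A y)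
  obtain ⟨x', h₁, h₂⟩ := hex D (G'.map c.op y) x (by rw [nb, hx])
  refine ⟨D, c, x', hc, h₁, fun B b₀ z hz => ?_⟩
  obtain ⟨d, ⟨hd, hd'⟩, ud⟩ := ux B b₀ (a B z) (by rw [w, hz, nb])
  refine ⟨d, ⟨hd, hinj _ _ _ ?_ ?_⟩, ?_⟩
  · rw [nφ', h₁, ← map_op_comp_apply, hd, hz]
  · rw [na, h₂, hd']
  · rintro d' ⟨e, e'⟩
    exact ud d' ⟨e, by rw [← h₂, ← na, e']⟩

lemma IsRelCover.of_bijective [W.IsMultiplicative] {φ : ∀ A : C, F.obj (op A) → G.obj (op A)}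
    (nφ : IsNatural φ) (h : ∀ A, Function.Bijective (φ A)) : IsRelCover W φ := by
  intro A y
  obtain ⟨x, hx⟩ := (h A).2 y
  refine ⟨A, 𝟙 A, x, W.id_mem _, by rw [hx, map_op_id_apply], fun B b x' hx' => ⟨b, ⟨by simp, ?_⟩, ?_⟩⟩
  · apply (h B).1
    rw [nφ, hx, hx']
  · rintro d ⟨hd, -⟩
    simpa using hd

/-- The values of a representable presheaf, from a universal element. -/
noncomputable def representableOfUniversal {L : C} (x : F.obj (op L))
    (h : ∀ (A : C) (y : F.obj (op A)), ∃! a : A ⟶ L, F.map a.op x = y) : F.RepresentableBy L where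
  homEquiv {A} := Equiv.ofBijective (fun a : A ⟶ L => F.map a.op x)
    ⟨fun a b hab => (h A _).unique hab rfl, fun y => (h A y).exists⟩
  homEquiv_comp f g := map_op_comp_apply F f g x

lemma representableOfUniversal_homEquiv {L : C} (x : F.obj (op L))
    (h : ∀ (A : C) (y : F.obj (op A)), ∃! a : A ⟶ L, F.map a.op x = y) {A : C} (a : A ⟶ L) :
    (representableOfUniversal x h).homEquiv a = F.map a.op x := rfl

/-- The representing object is the one attached to the universal point of `G`. -/
lemma IsRelCover.isRepresentable {φ : ∀ A : C, F.obj (op A) → G.obj (op A)}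
    (hφ : IsRelCover W φ) (nφ : IsNatural φ) {L : C} (R : G.RepresentableBy L) :
    ∃ L' : C, Nonempty (F.RepresentableBy L') := by
  obtain ⟨D, c, x, -, hx, ux⟩ := hφ L (R.homEquiv (𝟙 L))
  refine ⟨D, ⟨representableOfUniversal x fun A y => ?_⟩⟩
  obtain ⟨d, ⟨hd, hd'⟩, ud⟩ := ux A (R.homEquiv.symm (φ A y)) y (by
    rw [← R.homEquiv_comp, Category.comp_id, Equiv.apply_symm_apply])
  refine ⟨d, hd', fun d' h => ud d' ⟨?_, h⟩⟩
  apply R.homEquiv.injective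
  rw [Equiv.apply_symm_apply, ← h, nφ, hx, ← map_op_comp_apply, ← R.homEquiv_eq]

/-- The map of presheaves `Hom(-, A) ⟶ F` given by `x ∈ F(A)`. -/
def ofPoint (F : Cᵒᵖ ⥤ Type v) {L : C} (x : F.obj (op L)) (A : C) :
    (yoneda.obj L).obj (op A) → F.obj (op A) :=
  fun a => F.map (Quiver.Hom.op (show A ⟶ L from a)) x

lemma isNatural_ofPoint {L : C} (x : F.obj (op L)) : IsNatural (ofPoint F x) := by
  intro A B b a
  exact map_op_comp_apply F b a x

end RelCover

/-! ### Maps to limits and relative covers -/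

variable {W : MorphismProperty C}

lemma isCover_of_isIso (hW : IsCategoryWithCovers W) {A B : C} (e : A ⟶ B) [IsIso e] : W e :=
  have := hW.isMultiplicative
  hW.of_isPullback (IsPullback.of_vert_isIso (fst := e) (snd := e) (f := 𝟙 B) (g := 𝟙 B) ⟨rfl⟩)
    (W.id_mem B)

lemma MapToLimit.isRelCover (hW : IsCategoryWithCovers W) {F : Cᵒᵖ ⥤ Type v} {L : C}
    {x : F.obj (op L)} {Q : ∀ {M : C}, (L ⟶ M) → Prop} (h : MapToLimit F x Q)
    (hQ : ∀ {M : C} (l : L ⟶ M), Q l → W l) : IsRelCover W (ofPoint F x) := by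
  obtain ⟨M, R, hR⟩ := h
  intro A y
  have hl := hQ _ hR
  have := hW.hasPullback (R.homEquiv.symm x) (R.homEquiv.symm y) hl
  refine ⟨pullback (R.homEquiv.symm x) (R.homEquiv.symm y), pullback.snd _ _, pullback.fst _ _,
    hW.of_isPullback (IsPullback.of_hasPullback _ _) hl, ?_, fun B b x' hx' => ?_⟩
  · apply R.homEquiv.symm.injective
    have := pullback.condition (f := R.homEquiv.symm x) (g := R.homEquiv.symm y)
    rw [R.comp_homEquiv_symm, R.comp_homEquiv_symm] at this
    exact this
  · have e : (show B ⟶ L from x') ≫ R.homEquiv.symm x = b ≫ R.homEquiv.symm y := by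
      rw [R.comp_homEquiv_symm, R.comp_homEquiv_symm]
      exact congrArg _ hx'
    refine ⟨pullback.lift _ _ e, ⟨pullback.lift_snd _ _ _, pullback.lift_fst _ _ e⟩, ?_⟩
    rintro d ⟨h₁, h₂⟩
    apply pullback.hom_ext
    · rw [pullback.lift_fst]; exact h₂
    · rw [pullback.lift_snd]; exact h₁

lemma MapToLimit.bijective {F : Cᵒᵖ ⥤ Type v} {L : C}
    {x : F.obj (op L)} {Q : ∀ {M : C}, (L ⟶ M) → Prop} (h : MapToLimit F x Q)
    (hQ : ∀ {M : C} (l : L ⟶ M), Q l → IsIso l) (A : C) :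
    Function.Bijective (fun a : A ⟶ L => F.map a.op x) := by
  obtain ⟨M, R, hR⟩ := h
  have hl := hQ _ hR
  have e : ∀ a : A ⟶ L, F.map a.op x = R.homEquiv (a ≫ R.homEquiv.symm x) := by
    intro a
    rw [R.comp_homEquiv_symm, Equiv.apply_symm_apply]
  constructor
  · intro a b hab
    simp only [e] at hab
    exact (cancel_mono _).1 (R.homEquiv.injective hab)
  · intro y
    refine ⟨R.homEquiv.symm y ≫ inv (R.homEquiv.symm x), ?_⟩
    simp only [e]
    simp

lemma MapToLimit.exists_representableBy {F : Cᵒᵖ ⥤ Type v} {L : C}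
    {x : F.obj (op L)} {Q : ∀ {M : C}, (L ⟶ M) → Prop} (h : MapToLimit F x Q) :
    ∃ M : C, Nonempty (F.RepresentableBy M) := by
  obtain ⟨M, R, -⟩ := h
  exact ⟨M, ⟨R⟩⟩

/-- The object `D` attached to the universal point of `F` represents the fibre product of L and M
over F ≅ M, which is L itself. So the map L ⟶ M differs from the cover `c` by an isomorphism. -/
lemma mapToLimit_of_isRelCover (hW : IsCategoryWithCovers W) {F : Cᵒᵖ ⥤ Type v} {L M : C}
    {x : F.obj (op L)} (R : F.RepresentableBy M) (h : IsRelCover W (ofPoint F x)) :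
    MapToLimit F x (fun l => W l) := by
  have := hW.isMultiplicative
  refine ⟨M, R, ?_⟩
  obtain ⟨D, c, a, hc, ha, ua⟩ := h M (R.homEquiv (𝟙 M))
  have ha' : (show D ⟶ L from a) ≫ R.homEquiv.symm x = c := by
    rw [R.comp_homEquiv_symm, Equiv.symm_apply_eq, R.homEquiv_eq c]
    exact ha
  obtain ⟨d, ⟨hd, hd'⟩, -⟩ := ua L (R.homEquiv.symm x) (𝟙 L) (by
    rw [← R.homEquiv_eq, Equiv.apply_symm_apply]
    exact map_op_id_apply F x)
  change d ≫ (show D ⟶ L from a) = 𝟙 L at hd'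
  have hid : (show D ⟶ L from a) ≫ d = 𝟙 D := by
    refine (ua D c a ha).unique ⟨?_, ?_⟩ ⟨by simp, by simp⟩
    · rw [Category.assoc, hd, ha']
    · change ((show D ⟶ L from a) ≫ d) ≫ (show D ⟶ L from a) = a
      rw [Category.assoc, hd', Category.comp_id]
  have : IsIso d := ⟨⟨a, hd', hid⟩⟩
  rw [← hd]
  exact W.comp_mem _ _ (isCover_of_isIso hW d) hc

lemma mapToLimit_of_bijective {F : Cᵒᵖ ⥤ Type v} {L : C} {x : F.obj (op L)}
    {Q : ∀ {M : C}, (L ⟶ M) → Prop} (hQ : Q (𝟙 L))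
    (h : ∀ A : C, Function.Bijective (fun a : A ⟶ L => F.map a.op x)) : MapToLimit F x Q := by
  have hu : ∀ (A : C) (y : F.obj (op A)), ∃! a : A ⟶ L, F.map a.op x = y :=
    fun A y => (h A).existsUnique y
  refine ⟨L, representableOfUniversal x hu, ?_⟩
  convert hQ
  rw [Equiv.symm_apply_eq, representableOfUniversal_homEquiv, map_op_id_apply]

lemma mapToLimit_congr {F G : Cᵒᵖ ⥤ Type v} {L : C} {x : F.obj (op L)} {y : G.obj (op L)}
    (φ : ∀ A : C, F.obj (op A) ≃ G.obj (op A)) (nφ : IsNatural (fun A => φ A)) (hxy : φ L x = y)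
    {Q : ∀ {M : C}, (L ⟶ M) → Prop} : MapToLimit F x Q ↔ MapToLimit G y Q := by
  subst hxy
  constructor
  · rintro ⟨M, R, hR⟩
    refine ⟨M, ⟨fun {A} => R.homEquiv.trans (φ A), fun {A B} a b => ?_⟩, ?_⟩
    · simp only [Equiv.trans_apply, R.homEquiv_comp]
      exact nφ _ _
    · simpa using hR
  · rintro ⟨M, R, hR⟩
    refine ⟨M, ⟨fun {A} => R.homEquiv.trans (φ A).symm, fun {A B} a b => ?_⟩, ?_⟩
    · simp only [Equiv.trans_apply, R.homEquiv_comp, Equiv.symm_apply_eq]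
      refine Eq.trans ?_ (nφ a _).symm
      exact congrArg _ (Equiv.apply_symm_apply _ _).symm
    · simpa using hR


/-! ### Compatible families of simplices -/

/-- The set of vertices of a simplex of `Δ^k`. -/
def verts {k : ℕ} {m : SimplexCategory} (α : m ⟶ ⦋k⦌) : Finset (Fin (k + 1)) :=
  Finset.univ.image (fun j : Fin (m.len + 1) => (α.toOrderHom j : Fin (k + 1)))

lemma mem_verts {k : ℕ} {m : SimplexCategory} (α : m ⟶ ⦋k⦌) (i : Fin (k + 1)) :
    i ∈ verts α ↔ ∃ j : Fin (m.len + 1), α.toOrderHom j = i := by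
  simp [verts]

lemma verts_comp_subset {k : ℕ} {m m' : SimplexCategory} (β : m' ⟶ m) (α : m ⟶ ⦋k⦌) :
    verts (β ≫ α) ⊆ verts α := by
  intro i
  rw [mem_verts, mem_verts]
  rintro ⟨j, rfl⟩
  exact ⟨β.toOrderHom j, rfl⟩

/-- An `A`-valued point of `hom(S, X)`, for the subcomplex `S` of `Δ^k` which consists of the
simplices whose sets of vertices satisfy `P`. -/
structure Fam {k : ℕ} (P : Finset (Fin (k + 1)) → Prop) (X : SimplicialObject C) (A : C) where
  /-- the value on a simplex -/
  val : ∀ {m : SimplexCategory} (α : m ⟶ ⦋k⦌), P (verts α) → (A ⟶ X.obj (op m))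
  nat : ∀ {m m' : SimplexCategory} (β : m' ⟶ m) (α : m ⟶ ⦋k⦌) (h : P (verts α))
    (h' : P (verts (β ≫ α))), val (β ≫ α) h' = val α h ≫ X.map β.op

section

variable {k : ℕ} {P : Finset (Fin (k + 1)) → Prop} {X Y : SimplicialObject C} {A : C}

lemma Fam.ext' {y y' : Fam P X A}
    (h : ∀ {m : SimplexCategory} (α : m ⟶ ⦋k⦌) (hα : P (verts α)), y.val α hα = y'.val α hα) :
    y = y' := by
  cases y; cases y'
  congr
  funext m α hα
  exact h α hα

/-- Precomposition of a family with a map. -/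
def Fam.pre {B : C} (b : B ⟶ A) (y : Fam P X A) : Fam P X B where
  val α h := b ≫ y.val α h
  nat β α h h' := by rw [y.nat β α h h', Category.assoc]

/-- The family given by a simplex of `X`. -/
def Fam.ofSimplex (P : Finset (Fin (k + 1)) → Prop) (x : A ⟶ X _⦋k⦌) : Fam P X A where
  val α _ := x ≫ X.map α.op
  nat β α _ _ := by rw [op_comp, X.map_comp, Category.assoc]

/-- Restriction of a family. -/
def Fam.restrict {P' : Finset (Fin (k + 1)) → Prop} (hP : ∀ T, P T → P' T) (y : Fam P' X A) :
    Fam P X A where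
  val α h := y.val α (hP _ h)
  nat β α h h' := y.nat β α _ _

variable (P X) in
/-- The functor of points of `hom(S, X)`. -/
def absFam : Cᵒᵖ ⥤ Type v where
  obj A := Fam P X A.unop
  map a := TypeCat.ofHom fun y => y.pre a.unop
  map_id A := by
    ext y
    exact Fam.ext' fun α h => Category.id_comp _
  map_comp a b := by
    ext y
    exact Fam.ext' fun α h => Category.assoc _ _ _

/-- An `A`-valued point of `hom(S, X) ×_{hom(S, Y)} Y_k`. -/
structure RelFam (P : Finset (Fin (k + 1)) → Prop) (f : X ⟶ Y) (A : C) where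
  /-- the component in `hom(S, X)` -/
  left : Fam P X A
  /-- the component in `Y_k` -/
  right : A ⟶ Y _⦋k⦌
  w : ∀ {m : SimplexCategory} (α : m ⟶ ⦋k⦌) (h : P (verts α)),
    left.val α h ≫ f.app (op m) = right ≫ Y.map α.op

lemma RelFam.ext' {f : X ⟶ Y} {y y' : RelFam P f A}
    (h : ∀ {m : SimplexCategory} (α : m ⟶ ⦋k⦌) (hα : P (verts α)),
      y.left.val α hα = y'.left.val α hα) (hr : y.right = y'.right) : y = y' := by
  have := Fam.ext' h
  cases y; cases y'
  congr

/-- Precomposition of a relative family with a map. -/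
def RelFam.pre {f : X ⟶ Y} {B : C} (b : B ⟶ A) (y : RelFam P f A) : RelFam P f B where
  left := y.left.pre b
  right := b ≫ y.right
  w α h := by
    rw [Category.assoc, ← y.w α h]
    exact Category.assoc _ _ _

/-- The relative family given by a simplex of `X`. -/
def RelFam.ofSimplex (P : Finset (Fin (k + 1)) → Prop) (f : X ⟶ Y) (x : A ⟶ X _⦋k⦌) :
    RelFam P f A where
  left := Fam.ofSimplex P x
  right := x ≫ f.app (op ⦋k⦌)
  w α h := by
    change (x ≫ X.map α.op) ≫ _ = _
    rw [Category.assoc, Category.assoc, f.naturality]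

/-- Restriction of a relative family. -/
def RelFam.restrict {P' : Finset (Fin (k + 1)) → Prop} (hP : ∀ T, P T → P' T) {f : X ⟶ Y}
    (y : RelFam P' f A) : RelFam P f A where
  left := y.left.restrict hP
  right := y.right
  w α h := y.w α _

variable (P) in
/-- The functor of points of `hom(S, X) ×_{hom(S, Y)} Y_k`. -/
def relFam (f : X ⟶ Y) : Cᵒᵖ ⥤ Type v where
  obj A := RelFam P f A.unop
  map a := TypeCat.ofHom fun y => y.pre a.unop
  map_id A := by
    ext y
    exact RelFam.ext' (fun α h => Category.id_comp _) (Category.id_comp _)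
  map_comp a b := by
    ext y
    exact RelFam.ext' (fun α h => Category.assoc _ _ _) (Category.assoc _ _ _)

/-! ### Comparison with subcomplexes -/

variable {S : (Δ[k] : SSet.{v}).Subcomplex}

/-- The subcomplex `S` consists of the simplices whose sets of vertices satisfy `P`. -/
def IsVertexSubcomplex (S : (Δ[k] : SSet.{v}).Subcomplex) (P : Finset (Fin (k + 1)) → Prop) :
    Prop :=
  ∀ {m : SimplexCategory} (α : m ⟶ ⦋k⦌),
    SSet.stdSimplex.objEquiv.symm α ∈ S.obj (op m) ↔ P (verts α)

/-- Maps from a subcomplex of `Δ^k` to `Hom(A, X)` are compatible families. -/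
def famEquiv (hS : IsVertexSubcomplex S P) (X : SimplicialObject C) (A : C) :
    ((S : SSet.{v}) ⟶ (homSSet X).obj (op A)) ≃ Fam P X A where
  toFun φ :=
    { val := fun {m} α h => φ.app (op m) ⟨SSet.stdSimplex.objEquiv.symm α, (hS α).2 h⟩
      nat := fun {m m'} β α h h' => by
        exact ConcreteCategory.congr_hom (φ.naturality β.op)
          ⟨SSet.stdSimplex.objEquiv.symm α, (hS α).2 h⟩ }
  invFun y :=
    { app := fun m => TypeCat.ofHom fun s =>
        y.val (SSet.stdSimplex.objEquiv s.1) ((hS _).1 s.2)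
      naturality := fun m m' β => by
        ext s
        exact y.nat β.unop _ _ _ }
  left_inv φ := rfl
  right_inv y := rfl

/-- Points of `hom(S, X) ×_{hom(S, Y)} Y_k` are relative families. -/
def relFamEquiv (hS : IsVertexSubcomplex S P) (f : X ⟶ Y) (A : C) :
    RelPoint S.ι f A ≃ RelFam P f A where
  toFun s :=
    { left := famEquiv hS X A s.left
      right := SSet.yonedaEquiv s.right
      w := fun {m} α h => by
        have h₁ := ConcreteCategory.congr_hom (congrArg (fun t => t.app (op m)) s.w)
          ⟨SSet.stdSimplex.objEquiv.symm α, (hS α).2 h⟩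
        refine h₁.trans ?_
        have h₂ := ConcreteCategory.congr_hom (s.right.naturality α.op)
          (SSet.stdSimplex.objEquiv.symm (𝟙 ⦋k⦌))
        refine Eq.trans ?_ h₂
        change s.right.app (op m) (SSet.stdSimplex.objEquiv.symm α) =
          s.right.app (op m) (SSet.stdSimplex.objEquiv.symm (α ≫ 𝟙 _))
        rw [Category.comp_id] }
  invFun y :=
    { left := (famEquiv hS X A).symm y.left
      right := SSet.yonedaEquiv.symm y.right
      w := by
        ext m s
        exact y.w _ _ }
  left_inv s := by
    apply RelPoint.ext
    · rfl
    · exact Equiv.symm_apply_apply _ _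
  right_inv y := by
    refine RelFam.ext' (fun α hα => rfl) ?_
    exact Equiv.apply_symm_apply _ _

lemma absLimit_iff (hS : IsVertexSubcomplex S P) (Q : ∀ {L : C}, (X _⦋k⦌ ⟶ L) → Prop) :
    AbsLimit X S Q ↔ MapToLimit (absFam P X)
      (A := X _⦋k⦌) (Fam.ofSimplex P (𝟙 (X _⦋k⦌))) Q :=
  mapToLimit_congr (F := homPoints (S : SSet.{v}) X) (G := absFam P X)
    (fun A => famEquiv hS X A) (fun _ _ _ _ => rfl) rfl

lemma relLimit_iff (hS : IsVertexSubcomplex S P) (f : X ⟶ Y)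
    (Q : ∀ {L : C}, (X _⦋k⦌ ⟶ L) → Prop) :
    RelLimit f S Q ↔ MapToLimit (relFam P f)
      (A := X _⦋k⦌) (RelFam.ofSimplex P f (𝟙 (X _⦋k⦌))) Q :=
  mapToLimit_congr (F := relPoints S.ι f) (G := relFam P f)
    (fun A => relFamEquiv hS f A) (fun _ _ _ _ => rfl) (by
      refine RelFam.ext' (fun α hα => rfl) ?_
      exact (Equiv.apply_symm_apply _ _).trans (Category.id_comp (f.app (op ⦋k⦌))).symm)

/-! ### Horns, boundaries and skeleta as conditions on sets of vertices -/

/-- The condition on sets of vertices which defines the horn `Λ^k_i`. -/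
def HornP (i : Fin (k + 1)) (T : Finset (Fin (k + 1))) : Prop := ∃ j, j ≠ i ∧ j ∉ T

/-- The condition on sets of vertices which defines the boundary `∂Δ^k`. -/
def BdryP (T : Finset (Fin (k + 1))) : Prop := ∃ j, j ∉ T

/-- The condition on sets of vertices which defines the skeleton of dimension `< d`. -/
def SkelP (d : ℕ) (T : Finset (Fin (k + 1))) : Prop := T.card ≤ d

lemma isVertexSubcomplex_horn (i : Fin (k + 1)) :
    IsVertexSubcomplex (SSet.horn.{v} k i) (HornP i) := by
  intro m α
  induction m using SimplexCategory.rec with | _ m =>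
  rw [SSet.mem_horn_iff_notMem_range]
  simp only [HornP, mem_verts, exists_prop]
  rfl

lemma isVertexSubcomplex_boundary : IsVertexSubcomplex (SSet.boundary.{v} k) BdryP := by
  intro m α
  induction m using SimplexCategory.rec with | _ m =>
  rw [SSet.mem_boundary_iff_notMem_range]
  simp only [BdryP, mem_verts]
  rfl

/-- The face of `Δ^k` with given vertices. -/
def faceHom (T : Finset (Fin (k + 1))) {j : ℕ} (h : T.card = j + 1) :
    (⦋j⦌ : SimplexCategory) ⟶ ⦋k⦌ :=
  SimplexCategory.mkHom (T.orderEmbOfFin h).toOrderHom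

instance (T : Finset (Fin (k + 1))) {j : ℕ} (h : T.card = j + 1) : Mono (faceHom T h) :=
  SimplexCategory.mono_iff_injective.2 (T.orderEmbOfFin h).injective

lemma verts_faceHom (T : Finset (Fin (k + 1))) {j : ℕ} (h : T.card = j + 1) :
    verts (faceHom T h) = T := by
  refine Finset.coe_injective ?_
  rw [← T.range_orderEmbOfFin h]
  ext i
  rw [Finset.mem_coe, mem_verts]
  rfl

lemma exists_comp_faceHom (T : Finset (Fin (k + 1))) {j : ℕ} (h : T.card = j + 1)
    {m : SimplexCategory} (α : m ⟶ ⦋k⦌) (hα : verts α ⊆ T) :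
    ∃ θ : m ⟶ ⦋j⦌, θ ≫ faceHom T h = α := by
  have hT : ∀ i : Fin (m.len + 1), (α.toOrderHom i : Fin (k + 1)) ∈ T :=
    fun i => hα ((mem_verts α _).2 ⟨i, rfl⟩)
  refine ⟨SimplexCategory.Hom.mk
    { toFun := fun i => (T.orderIsoOfFin h).symm ⟨α.toOrderHom i, hT i⟩
      monotone' := fun a b hab => (T.orderIsoOfFin h).symm.monotone (α.toOrderHom.monotone hab) }, ?_⟩
  ext i : 3
  change (T.orderEmbOfFin h ((T.orderIsoOfFin h).symm ⟨α.toOrderHom i, hT i⟩)) = α.toOrderHom i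
  rw [← Finset.coe_orderIsoOfFin_apply, OrderIso.apply_symm_apply]

lemma verts_nonempty {m : SimplexCategory} (α : m ⟶ ⦋k⦌) : (verts α).Nonempty :=
  ⟨_, (mem_verts α _).2 ⟨0, rfl⟩⟩

lemma card_verts_le {m : SimplexCategory} (α : m ⟶ ⦋k⦌) : (verts α).card ≤ m.len + 1 :=
  Finset.card_image_le.trans_eq (Finset.card_fin _)

lemma isVertexSubcomplex_skeleton (d : ℕ) :
    IsVertexSubcomplex ((Δ[k] : SSet.{v}).skeleton d) (SkelP d) := by
  intro m α
  constructor
  · let S' : (Δ[k] : SSet.{v}).Subcomplex :=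
      { obj := fun m => {s | SkelP d (verts (SSet.stdSimplex.objEquiv s))}
        map := fun β s hs => (Finset.card_le_card (verts_comp_subset β.unop _)).trans hs }
    have h : (Δ[k] : SSet.{v}).skeleton d ≤ S' := by
      refine iSup₂_le fun i y => (SSet.Subcomplex.ofSimplex_le_iff _ _).2 ?_
      exact (card_verts_le _).trans i.2
    exact fun hα => h _ hα
  · intro hα
    obtain ⟨j, hj⟩ : ∃ j, (verts α).card = j + 1 :=
      Nat.exists_eq_succ_of_ne_zero (Finset.card_pos.2 (verts_nonempty α)).ne'
    obtain ⟨θ, hθ⟩ := exists_comp_faceHom (verts α) hj α subset_rfl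
    have hd : j < d := by
      change (verts α).card ≤ d at hα
      omega
    have := ((Δ[k] : SSet.{v}).skeleton d).map θ.op
      (SSet.mem_skeleton _ (SSet.stdSimplex.objEquiv.symm (faceHom (verts α) hj)) hd)
    rw [← hθ]
    exact this

end


/-! ### Restriction maps for hypercovers -/

section Cells

variable {k : ℕ} {P P' : Finset (Fin (k + 1)) → Prop} {X Y : SimplicialObject C} {A : C}

lemma Fam.val_congr (y : Fam P X A) {m : SimplexCategory} {α α' : m ⟶ ⦋k⦌} (e : α = α')
    (h : P (verts α)) (h' : P (verts α')) : y.val α h = y.val α' h' := by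
  subst e; rfl

/-- Closure under nonempty subsets. -/
def IsLower (P : Finset (Fin (k + 1)) → Prop) : Prop :=
  ∀ S S' : Finset (Fin (k + 1)), S.Nonempty → S ⊆ S' → P S' → P S

/-- Restriction, as a map of presheaves. -/
def restrictMap (f : X ⟶ Y) (hP : ∀ T, P T → P' T) (A : C) :
    (relFam P' f).obj (op A) → (relFam P f).obj (op A) :=
  fun y => RelFam.restrict (A := A) hP y

lemma isNatural_restrictMap (f : X ⟶ Y) (hP : ∀ T, P T → P' T) :
    IsNatural (restrictMap f hP) := fun _ _ _ _ => rfl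

/-- The tautological point of `relFam P f`. -/
def tautFam (P : Finset (Fin (k + 1)) → Prop) (f : X ⟶ Y) : (relFam P f).obj (op (X _⦋k⦌)) :=
  RelFam.ofSimplex P f (𝟙 (X _⦋k⦌))

lemma ofPoint_tautFam (f : X ⟶ Y) (x : A ⟶ X _⦋k⦌) :
    ofPoint (relFam P f) (tautFam P f) A x = RelFam.ofSimplex P f x :=
  RelFam.ext' (fun α hα => by
    change x ≫ 𝟙 _ ≫ X.map α.op = x ≫ X.map α.op
    rw [Category.id_comp]) (by
    change x ≫ 𝟙 _ ≫ f.app _ = x ≫ f.app _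
    rw [Category.id_comp])

lemma verts_comp_faceHom_eq_iff {T : Finset (Fin (k + 1))} {j : ℕ} (h : T.card = j + 1)
    {m : SimplexCategory} (θ : m ⟶ ⦋j⦌) :
    verts (θ ≫ faceHom T h) = T ↔ ¬ BdryP (verts θ) := by
  have h₀ : Function.Injective (faceHom T h).toOrderHom :=
    SimplexCategory.mono_iff_injective.1 inferInstance
  constructor
  · rintro e ⟨i, hi⟩
    have h₁ : (faceHom T h).toOrderHom i ∈ verts (θ ≫ faceHom T h) := by
      rw [e]
      exact (verts_faceHom T h).subset ((mem_verts _ _).2 ⟨i, rfl⟩)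
    obtain ⟨l, hl⟩ := (mem_verts _ _).1 h₁
    exact hi ((mem_verts _ _).2 ⟨l, h₀ hl⟩)
  · intro hθ
    simp only [BdryP, not_exists, not_not] at hθ
    refine Finset.Subset.antisymm ?_ fun i hi => ?_
    · exact (verts_comp_subset _ _).trans_eq (verts_faceHom T h)
    · obtain ⟨l, rfl⟩ := (mem_verts _ _).1 ((verts_faceHom T h).superset hi)
      obtain ⟨l', rfl⟩ := (mem_verts _ _).1 (hθ l)
      exact (mem_verts _ _).2 ⟨l', rfl⟩

/-- Adding one cell T, all of whose proper faces are already present, is a pushout along ∂Δ^j → Δ^j.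
On points, restriction is therefore a base change of the matching map μ_j(f). -/
lemma isRelCover_attach {W : MorphismProperty C} (f : X ⟶ Y) (hP : IsLower P)
    (hPP' : ∀ S, P S → P' S) {T : Finset (Fin (k + 1))} {j : ℕ} (hT : T.card = j + 1)
    (hP' : ∀ S, P' S ↔ P S ∨ S = T) (hPT : ¬ P T)
    (hlt : ∀ S : Finset (Fin (k + 1)), S.Nonempty → S ⊂ T → P S)
    (hcell : IsRelCover W (ofPoint (relFam BdryP f) (tautFam (k := j) BdryP f))) :
    IsRelCover W (restrictMap f hPP') := by
  have hb : ∀ {m : SimplexCategory} (θ : m ⟶ ⦋j⦌), BdryP (verts θ) →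
      P (verts (θ ≫ faceHom T hT)) := fun θ hθ => by
    refine hlt _ (verts_nonempty _) (Finset.ssubset_iff_subset_ne.2 ⟨?_, fun e => ?_⟩)
    · exact (verts_comp_subset _ _).trans_eq (verts_faceHom T hT)
    · exact (verts_comp_faceHom_eq_iff hT θ).1 e hθ
  have hT' : P' (verts (faceHom T hT)) := by
    rw [verts_faceHom]
    exact (hP' T).2 (Or.inr rfl)
  let a : ∀ A : C, (relFam P' f).obj (op A) → (yoneda.obj (X _⦋j⦌)).obj (op A) :=
    fun A y => (show RelFam P' f A from y).left.val (faceHom T hT) hT'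
  let b : ∀ A : C, (relFam P f).obj (op A) → (relFam (k := j) BdryP f).obj (op A) :=
    fun A y =>
      (show RelFam BdryP f A from
      { left :=
          { val := fun θ hθ => (show RelFam P f A from y).left.val _ (hb θ hθ)
            nat := fun β θ h h' => by
              rw [← (show RelFam P f A from y).left.nat]
              exact Fam.val_congr _ (Category.assoc _ _ _) _ _
              exact hP _ _ (verts_nonempty _) (verts_comp_subset _ _) (hb θ h) }
        right := (show RelFam P f A from y).right ≫ Y.map (faceHom T hT).op
        w := fun θ hθ => by
          refine ((show RelFam P f A from y).w _ (hb θ hθ)).trans ?_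
          rw [op_comp, Y.map_comp, Category.assoc] })
  refine hcell.baseChange (a := a) (b := b) (isNatural_restrictMap f hPP')
    (fun _ _ _ _ => rfl) (fun A B c y => ?_) (fun A y => ?_) (fun A y y' h₁ h₂ => ?_)
    (fun A y x hx => ?_)
  · exact RelFam.ext' (fun α hα => rfl) (Category.assoc _ _ _)
  · rw [ofPoint_tautFam]
    refine RelFam.ext' (fun θ hθ => ?_) ?_
    · exact ((show RelFam P' f A from y).left.nat θ _ _ _).symm
    · exact (show RelFam P' f A from y).w _ _
  · refine RelFam.ext' (fun α hα => ?_) (congrArg (fun z : RelFam P f A => z.right) h₁)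
    by_cases h : P (verts α)
    · exact congrArg (fun z : RelFam P f A => z.left.val α h) h₁
    · obtain ⟨θ, rfl⟩ := exists_comp_faceHom T hT α (((hP' _).1 hα).resolve_left h).subset
      rw [(show RelFam P' f A from y).left.nat θ _ hT', (show RelFam P' f A from y').left.nat θ _ hT']
      exact congrArg (· ≫ X.map θ.op) h₂
  · rw [ofPoint_tautFam] at hx
    have hxv : ∀ {m : SimplexCategory} (θ : m ⟶ ⦋j⦌) (hθ : BdryP (verts θ)),
        (show RelFam P f A from y).left.val _ (hb θ hθ) = (show A ⟶ _ from x) ≫ X.map θ.op :=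
      fun θ hθ => congrArg (fun z : RelFam BdryP f A => z.left.val θ hθ) hx
    have hxr : (show RelFam P f A from y).right ≫ Y.map (faceHom T hT).op =
        (show A ⟶ _ from x) ≫ f.app (op ⦋j⦌) := congrArg (fun z : RelFam BdryP f A => z.right) hx
    have hθ : ∀ {m : SimplexCategory} (α : m ⟶ ⦋k⦌), P' (verts α) → ¬ P (verts α) →
        ∃ θ : m ⟶ ⦋j⦌, θ ≫ faceHom T hT = α := fun α h h' =>
      exists_comp_faceHom T hT α (((hP' _).1 h).resolve_left h').subset
    choose θ eθ using @hθ
    -- The extended family takes the old values on simplices in P. Any other simplex has vertex set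
    -- exactly T, so it factors through the face T and takes its value from `x`.
    classical
    let z : RelFam P' f A :=
      { left :=
          { val := fun {m} α h =>
              if h' : P (verts α) then (show RelFam P f A from y).left.val α h'
              else (show A ⟶ _ from x) ≫ X.map (θ α h h').op
            nat := fun {m m'} β α h h' => by
              by_cases h₁ : P (verts α)
              · have h₂ : P (verts (β ≫ α)) :=
                  hP _ _ (verts_nonempty _) (verts_comp_subset _ _) h₁
                rw [dif_pos h₁, dif_pos h₂]
                exact (show RelFam P f A from y).left.nat _ _ _ _
              · rw [dif_neg h₁]
                have e : (β ≫ θ α h h₁) ≫ faceHom T hT = β ≫ α := by rw [Category.assoc, eθ]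
                rw [Category.assoc, ← X.map_comp, ← op_comp]
                by_cases h₂ : P (verts (β ≫ α))
                · rw [dif_pos h₂]
                  have h₃ : BdryP (verts (β ≫ θ α h h₁)) := by
                    by_contra h₃
                    have := (verts_comp_faceHom_eq_iff hT _).2 h₃
                    rw [e] at this
                    exact hPT (this ▸ h₂)
                  rw [← hxv _ h₃]
                  exact Fam.val_congr _ e.symm _ _
                · rw [dif_neg h₂]
                  congr 3
                  rw [← cancel_mono (faceHom T hT), e, eθ] }
        right := (show RelFam P f A from y).right
        w := fun {m} α h => by
          by_cases h' : P (verts α)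
          · simp only [dif_pos h']
            exact (show RelFam P f A from y).w α h'
          · simp only [dif_neg h']
            rw [Category.assoc, f.naturality, ← Category.assoc, ← hxr, Category.assoc,
              ← Y.map_comp, ← op_comp, eθ] }
    refine ⟨z, RelFam.ext' (fun α hα => dif_pos hα) rfl, ?_⟩
    have h₀ : ¬ P (verts (faceHom T hT)) := by rwa [verts_faceHom]
    change dite _ _ _ = x
    rw [dif_neg h₀]
    have : θ (faceHom T hT) hT' h₀ = 𝟙 _ := by
      rw [← cancel_mono (faceHom T hT), eθ, Category.id_comp]
    rw [this, op_id, X.map_id]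
    exact Category.comp_id _

lemma bijective_restrictMap (f : X ⟶ Y) (hPP' : ∀ S, P S → P' S)
    (h : ∀ S : Finset (Fin (k + 1)), S.Nonempty → P' S → P S) (A : C) :
    Function.Bijective (restrictMap f hPP' A) := by
  constructor
  · intro y y' e
    exact RelFam.ext' (fun α hα => congrArg (fun z : RelFam P f A => z.left.val α
      (h _ (verts_nonempty _) hα)) e) (congrArg (fun z : RelFam P f A => z.right) e)
  · intro (y : RelFam P f A)
    exact ⟨(show RelFam P' f A from
      { left :=
          { val := fun α hα => y.left.val α (h _ (verts_nonempty _) hα)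
            nat := fun β α _ _ => y.left.nat β α _ _ }
        right := y.right
        w := fun α hα => y.w α _ }), rfl⟩

/-- Induction on the number of missing faces: they are attached one at a time, and each restriction
is a relative cover. -/
lemma isRelCover_restrictMap {W : MorphismProperty C} [W.IsMultiplicative] (f : X ⟶ Y)
    (hP : IsLower P) (hP' : IsLower P') (hPP' : ∀ S, P S → P' S)
    (hcell : ∀ (j : ℕ) (T : Finset (Fin (k + 1))), T.card = j + 1 → P' T → ¬ P T →
      IsRelCover W (ofPoint (relFam BdryP f) (tautFam (k := j) BdryP f))) :
    IsRelCover W (restrictMap f hPP') := by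
  classical
  induction hN : (Finset.univ.filter fun T : Finset (Fin (k + 1)) =>
      T.Nonempty ∧ P' T ∧ ¬ P T).card using Nat.strong_induction_on generalizing P with
  | _ N ih =>
    by_cases hemp : (Finset.univ.filter fun T : Finset (Fin (k + 1)) =>
        T.Nonempty ∧ P' T ∧ ¬ P T).Nonempty
    -- A missing face with the fewest vertices has all its proper faces in P, as attaching requires.
    · obtain ⟨T, hT, hmin⟩ := Finset.exists_min_image _ Finset.card hemp
      simp only [Finset.mem_filter, Finset.mem_univ, true_and] at hT hmin
      obtain ⟨hne, hP'T, hPT⟩ := hT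
      obtain ⟨j, hj⟩ : ∃ j, T.card = j + 1 :=
        Nat.exists_eq_succ_of_ne_zero (Finset.card_pos.2 hne).ne'
      have hlt : ∀ S : Finset (Fin (k + 1)), S.Nonempty → S ⊂ T → P S := by
        intro S hS hST
        by_contra hPS
        exact absurd (hmin S ⟨hS, hP' _ _ hS hST.subset hP'T, hPS⟩)
          (not_le.2 (Finset.card_lt_card hST))
      have h₁ : ∀ S, P S → P S ∨ S = T := fun S h => Or.inl h
      have h₂ : ∀ S, P S ∨ S = T → P' S := by
        rintro S (h | rfl)
        exacts [hPP' S h, hP'T]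
      have hlow : IsLower (fun S => P S ∨ S = T) := by
        rintro S S' hS hSS' (h | rfl)
        · exact Or.inl (hP _ _ hS hSS' h)
        · by_cases e : S = S'
          · exact Or.inr e
          · exact Or.inl (hlt S hS (Finset.ssubset_iff_subset_ne.2 ⟨hSS', e⟩))
      have hcard : (Finset.univ.filter fun S : Finset (Fin (k + 1)) =>
          S.Nonempty ∧ P' S ∧ ¬ (P S ∨ S = T)).card < N := by
        rw [← hN]
        refine Finset.card_lt_card (Finset.ssubset_iff_of_subset ?_ |>.2 ⟨T, ?_, ?_⟩)
        · intro S
          simp only [Finset.mem_filter, Finset.mem_univ, true_and]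
          tauto
        · simp [hne, hP'T, hPT]
        · simp
      have ih' := ih _ hcard hlow h₂ (fun j S hS h h' => hcell j S hS h (fun h'' => h' (Or.inl h'')))
        (by congr!)
      exact (isRelCover_attach f hP h₁ hj (fun S => Iff.rfl) hPT hlt
        (hcell j T hj hP'T hPT)).comp ih' (isNatural_restrictMap f h₂) (isNatural_restrictMap f h₁)
    · refine IsRelCover.of_bijective (isNatural_restrictMap f hPP')
        (bijective_restrictMap f hPP' fun S hS h => ?_)
      by_contra h'
      exact hemp ⟨S, by simp [hS, h, h']⟩

/-- A simplex of `X` is a family on the full simplex. -/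
lemma bijective_ofPoint_tautFam (f : X ⟶ Y) (hP : ∀ S, P S) (A : C) :
    Function.Bijective (ofPoint (relFam P f) (tautFam P f) A) := by
  constructor
  · intro x y h
    rw [ofPoint_tautFam, ofPoint_tautFam] at h
    have h' : (show A ⟶ _ from x) ≫ X.map (𝟙 ⦋k⦌ : (⦋k⦌ : SimplexCategory) ⟶ ⦋k⦌).op =
        (show A ⟶ _ from y) ≫ X.map (𝟙 ⦋k⦌ : (⦋k⦌ : SimplexCategory) ⟶ ⦋k⦌).op :=
      congrArg (fun z : RelFam P f A => z.left.val (𝟙 _) (hP _)) h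
    simpa using h'
  · intro (y : RelFam P f A)
    refine ⟨y.left.val (𝟙 _) (hP _), ?_⟩
    rw [ofPoint_tautFam]
    refine RelFam.ext' (fun α hα => ?_) ?_
    · exact (y.left.nat α (𝟙 _) (hP _) (hP _)).symm.trans
        (Fam.val_congr _ (Category.comp_id _) _ _)
    · refine (y.w _ _).trans ?_
      simp

lemma isRelCover_tautFam {W : MorphismProperty C} [W.IsMultiplicative] (f : X ⟶ Y)
    (hP : IsLower P)
    (hcell : ∀ (j : ℕ) (T : Finset (Fin (k + 1))), T.card = j + 1 → ¬ P T →
      IsRelCover W (ofPoint (relFam BdryP f) (tautFam (k := j) BdryP f))) :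
    IsRelCover W (ofPoint (relFam P f) (tautFam P f)) :=
  (isRelCover_restrictMap (P' := fun _ => True) f hP (fun _ _ _ _ _ => trivial)
    (fun _ _ => trivial) fun j T hj _ h => hcell j T hj h).comp
    (IsRelCover.of_bijective (isNatural_ofPoint _) (bijective_ofPoint_tautFam f fun _ => trivial))
    (isNatural_ofPoint _) (isNatural_restrictMap _ _)

/-- For the empty complex the limit is Y_k; attaching the cells of P keeps it representable. -/
lemma exists_representableBy_relFam {W : MorphismProperty C} [W.IsMultiplicative] (f : X ⟶ Y)
    (hP : IsLower P)
    (hcell : ∀ (j : ℕ), IsRelCover W (ofPoint (relFam BdryP f) (tautFam (k := j) BdryP f))) :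
    ∃ L : C, Nonempty ((relFam P f).RepresentableBy L) := by
  have hP₀ : ∀ S : Finset (Fin (k + 1)), False → P S := fun S h => h.elim
  have h := isRelCover_restrictMap (W := W) f (P := fun _ => False) (fun _ _ _ _ h => h) hP hP₀
    (fun j _ _ _ _ => hcell j)
  let x : (relFam (fun _ : Finset (Fin (k + 1)) => False) f).obj (op (Y _⦋k⦌)) :=
    (show RelFam _ f (Y _⦋k⦌) from
    { left := { val := fun _ h => h.elim, nat := fun _ _ h => h.elim }
      right := 𝟙 _
      w := fun _ h => h.elim })
  refine h.isRepresentable (isNatural_restrictMap f hP₀)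
    (representableOfUniversal x fun A (y : RelFam _ f A) => ⟨y.right, ?_, fun a ha => ?_⟩)
  · exact RelFam.ext' (fun α h => h.elim) (Category.comp_id _)
  · exact (Category.comp_id a).symm.trans
      (congrArg (fun z : RelFam (fun _ : Finset (Fin (k + 1)) => False) f A => z.right) ha)

end Cells


/-! ### Composition of a stack with a hypercover -/

section Composition

variable {W : MorphismProperty C} {k : ℕ} {P : Finset (Fin (k + 1)) → Prop}
  {E U X : SimplicialObject C}

/-- With the isomorphisms as the class of covers, the cellular arguments also prove the clauses that
demand an isomorphism. -/
lemma IsRelCover.bijective {F G : Cᵒᵖ ⥤ Type v} {φ : ∀ A : C, F.obj (op A) → G.obj (op A)}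
    (h : IsRelCover (MorphismProperty.isomorphisms C) φ) (nφ : IsNatural φ) (A : C) :
    Function.Bijective (φ A) := by
  have key : ∀ y : G.obj (op A), ∃ x : F.obj (op A), φ A x = y ∧ ∀ x', φ A x' = y → x' = x := by
    intro y
    obtain ⟨D, c, x, hc, hx, ux⟩ := h A y
    have hc' : IsIso c := hc
    have hφ : φ A (F.map (inv c).op x) = y := by
      rw [nφ, hx, ← map_op_comp_apply, IsIso.inv_hom_id, map_op_id_apply]
    refine ⟨F.map (inv c).op x, hφ, fun x' hx' => ?_⟩
    obtain ⟨d, ⟨hd, hd'⟩, -⟩ := ux A (𝟙 A) x' (by rw [hx', map_op_id_apply])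
    have h₂ := (IsIso.eq_comp_inv c).2 hd
    rw [Category.id_comp] at h₂
    rw [← hd', h₂]
  constructor
  · intro x x' e
    obtain ⟨z, -, hz⟩ := key (φ A x')
    rw [hz x e, hz x' rfl]
  · intro y
    obtain ⟨x, hx, -⟩ := key y
    exact ⟨x, hx⟩

/-- The image of a family under a simplicial map. -/
def Fam.map {A : C} (p : E ⟶ U) (y : Fam P E A) : Fam P U A where
  val α h := y.val α h ≫ p.app _
  nat β α h h' := by rw [y.nat β α h h', Category.assoc, Category.assoc, p.naturality]

/-- The map from E_k factors through hom(S, E) ×_{hom(S, U)} U_k. The first factor is the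
corresponding map for p, and the second is a base change of U_k → hom(S, U) ×_{hom(S, X)} X_k. -/
lemma isRelCover_tautFam_comp [W.IsMultiplicative] (p : E ⟶ U) (f : U ⟶ X)
    (hp : IsRelCover W (ofPoint (relFam P p) (tautFam P p)))
    (hf : IsRelCover W (ofPoint (relFam P f) (tautFam P f))) :
    IsRelCover W (ofPoint (relFam P (p ≫ f)) (tautFam P (p ≫ f))) := by
  let φ : ∀ A : C, (relFam P p).obj (op A) → (relFam P (p ≫ f)).obj (op A) := fun A y =>
    (show RelFam P (p ≫ f) A from
    { left := (show RelFam P p A from y).left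
      right := (show RelFam P p A from y).right ≫ f.app _
      w := fun α h => by
        rw [NatTrans.comp_app, ← Category.assoc, (show RelFam P p A from y).w α h, Category.assoc,
          Category.assoc, f.naturality] })
  have nφ : IsNatural φ := fun A B b y =>
    RelFam.ext' (fun α h => rfl) (Category.assoc _ _ _)
  let a : ∀ A : C, (relFam P p).obj (op A) → (yoneda.obj (U _⦋k⦌)).obj (op A) :=
    fun A y => (show RelFam P p A from y).right
  let b : ∀ A : C, (relFam P (p ≫ f)).obj (op A) → (relFam P f).obj (op A) := fun A y =>
    (show RelFam P f A from
    { left := (show RelFam P (p ≫ f) A from y).left.map p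
      right := (show RelFam P (p ≫ f) A from y).right
      w := fun α h => (Category.assoc _ _ _).trans ((show RelFam P (p ≫ f) A from y).w α h) })
  have hφ : IsRelCover W φ := by
    refine hf.baseChange (a := a) (b := b) nφ (fun _ _ _ _ => rfl) (fun A B c y => ?_)
      (fun A y => ?_) (fun A y y' h₁ h₂ => ?_) (fun A y x hx => ?_)
    · exact RelFam.ext' (fun α h => Category.assoc _ _ _) rfl
    · rw [ofPoint_tautFam]
      exact RelFam.ext' (fun α h => ((show RelFam P p A from y).w α h).symm) rfl
    · exact RelFam.ext' (fun α h => congrArg (fun z : RelFam P (p ≫ f) A => z.left.val α h) h₁) h₂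
    · rw [ofPoint_tautFam] at hx
      refine ⟨(show RelFam P p A from
        { left := (show RelFam P (p ≫ f) A from y).left
          right := x
          w := fun α h => congrArg (fun z : RelFam P f A => z.left.val α h) hx }), ?_, rfl⟩
      exact RelFam.ext' (fun α h => rfl) (congrArg (fun z : RelFam P f A => z.right) hx).symm
  convert hφ.comp hp (isNatural_ofPoint _) nφ using 2 with A
  funext x
  rw [ofPoint_tautFam, ofPoint_tautFam]
  exact RelFam.ext' (fun α h => rfl) (Category.assoc _ _ _).symm

lemma isLower_hornP (i : Fin (k + 1)) : IsLower (HornP i) := by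
  rintro S S' - hSS' ⟨j, hj, hj'⟩
  exact ⟨j, hj, fun h => hj' (hSS' h)⟩

lemma isLower_skelP (d : ℕ) : IsLower (SkelP (k := k) d) :=
  fun _ _ _ h h' => (Finset.card_le_card h).trans h'

lemma le_card_of_not_hornP {i : Fin (k + 1)} {T : Finset (Fin (k + 1))} (h : ¬ HornP i T) :
    k ≤ T.card := by
  have : Finset.univ.erase i ⊆ T := by
    intro j hj
    by_contra hj'
    exact h ⟨j, (Finset.mem_erase.1 hj).1, hj'⟩
  have := Finset.card_le_card this
  rwa [Finset.card_erase_of_mem (Finset.mem_univ _), Finset.card_fin, Nat.add_sub_cancel] at this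

/-- The limits `Λ^k_i(g)` exist for all maps `g` of Lie groupoids. -/
lemma exists_representableBy_horn (hW : IsCategoryWithCovers W) (hE : IsLieGroupoid W ⊤ E)
    (hX : IsLieGroupoid W ⊤ X) (g : E ⟶ X) (hk : 0 < k) (i : Fin (k + 1)) :
    ∃ L : C, Nonempty ((relFam (HornP i) g).RepresentableBy L) := by
  have hX' := (absLimit_iff (isVertexSubcomplex_horn i) _).1 (hX k i hk)
  have hE' := (absLimit_iff (isVertexSubcomplex_horn i) _).1 (hE k i hk)
  obtain ⟨L, ⟨R⟩⟩ := hE'.exists_representableBy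
  have hc := hX'.isRelCover hW (fun l hl => hl.1)
  let a : ∀ A : C, (relFam (HornP i) g).obj (op A) → (yoneda.obj (X _⦋k⦌)).obj (op A) :=
    fun A y => (show RelFam _ g A from y).right
  let b : ∀ A : C, (absFam (HornP i) E).obj (op A) → (absFam (HornP i) X).obj (op A) :=
    fun A y => (show Fam _ E A from y).map g
  let φ : ∀ A : C, (relFam (HornP i) g).obj (op A) → (absFam (HornP i) E).obj (op A) :=
    fun A y => (show RelFam _ g A from y).left
  have nφ : IsNatural φ := fun _ _ _ _ => rfl
  have hpt : ∀ {A : C} (x : A ⟶ X _⦋k⦌), ofPoint (absFam (HornP i) X)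
      (show Fam _ X _ from Fam.ofSimplex (HornP i) (𝟙 (X _⦋k⦌))) A x = Fam.ofSimplex (HornP i) x :=
    fun x => Fam.ext' fun α h => by
      change x ≫ 𝟙 _ ≫ X.map α.op = x ≫ X.map α.op
      rw [Category.id_comp]
  -- Λ^k_i(g) → Λ^k_i(E) is the base change of X_k → Λ^k_i(X) along Λ^k_i(E) → Λ^k_i(X).
  have hφ : IsRelCover W φ := by
    refine hc.baseChange (a := a) (b := b) nφ (fun _ _ _ _ => rfl) (fun A B c y => ?_)
      (fun A y => ?_) (fun A y y' h₁ h₂ => ?_) (fun A y x hx => ?_)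
    · exact Fam.ext' fun α h => Category.assoc _ _ _
    · rw [hpt]
      exact Fam.ext' fun α h => ((show RelFam _ g A from y).w α h).symm
    · exact RelFam.ext' (fun α h => congrArg (fun z : Fam _ E A => z.val α h) h₁) h₂
    · rw [hpt] at hx
      exact ⟨(show RelFam _ g A from
        { left := y
          right := x
          w := fun α h => congrArg (fun z : Fam _ X A => z.val α h) hx }), rfl, rfl⟩
  exact hφ.isRepresentable nφ R

lemma IsHypercover.cell (hW : IsCategoryWithCovers W) {n : ℕ∞} {f : U ⟶ X}
    (hf : IsHypercover W n f) (j : ℕ) :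
    IsRelCover W (ofPoint (relFam BdryP f) (tautFam (k := j) BdryP f)) :=
  ((relLimit_iff isVertexSubcomplex_boundary f _).1 (hf.matching j)).isRelCover hW fun _ h => h.1

lemma IsHypercover.cell_iso {n : ℕ∞} {f : U ⟶ X}
    (hf : IsHypercover W n f) (j : ℕ) (hj : n ≤ j) (A : C) :
    Function.Bijective (ofPoint (relFam BdryP f) (tautFam (k := j) BdryP f) A) :=
  ((relLimit_iff isVertexSubcomplex_boundary f _).1 (hf.matching j)).bijective (fun _ h => h.2 hj) A

lemma IsStack.horn (hW : IsCategoryWithCovers W) {n : ℕ∞} {p : E ⟶ U}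
    (hp : IsStack W n p) (hk : 0 < k) (i : Fin (k + 1)) :
    IsRelCover W (ofPoint (relFam (HornP i) p) (tautFam (HornP i) p)) :=
  ((relLimit_iff (isVertexSubcomplex_horn i) p _).1 (hp.horns k i hk)).isRelCover hW fun _ h => h.1

lemma IsStack.horn_iso {n : ℕ∞} {p : E ⟶ U}
    (hp : IsStack W n p) (hk : n < k) (i : Fin (k + 1)) (A : C) :
    Function.Bijective (ofPoint (relFam (HornP i) p) (tautFam (HornP i) p) A) := by
  have h0 : 0 < k := by
    rcases Nat.eq_zero_or_pos k with rfl | h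
    · simp at hk
    · exact h
  exact ((relLimit_iff (isVertexSubcomplex_horn i) p _).1 (hp.horns k i h0)).bijective
    (fun _ h => h.2 hk) A

/-- The cells of Δ^k outside a horn have dimension at least k - 1. If k > n + 1, only the matching
maps μ_j(f) with j ≥ n + 1 occur, and these are isomorphisms, as is the horn map of p. -/
theorem IsStack.comp_isHypercover (hW : IsCategoryWithCovers W) {n : ℕ} {p : E ⟶ U}
    {f : U ⟶ X} (hp : IsStack W n p) (hf : IsHypercover W ((n : ℕ∞) + 1) f) :
    IsStack W ((n : ℕ∞) + 1) (p ≫ f) := by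
  have := hW.isMultiplicative
  refine ⟨hp.source, hf.target, fun k i hk => ?_⟩
  rw [relLimit_iff (isVertexSubcomplex_horn i)]
  by_cases hnk : ((n : ℕ∞) + 1) < k
  · refine mapToLimit_of_bijective ⟨W.id_mem _, fun _ => inferInstance⟩ fun A => ?_
    refine (isRelCover_tautFam_comp (W := MorphismProperty.isomorphisms C) p f ?_ ?_).bijective
      (isNatural_ofPoint _) A
    · refine IsRelCover.of_bijective (isNatural_ofPoint _) fun A => hp.horn_iso ?_ i A
      exact lt_of_le_of_lt le_self_add hnk
    · refine isRelCover_tautFam f (isLower_hornP i) fun j T hj hT =>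
        IsRelCover.of_bijective (isNatural_ofPoint _) fun A => hf.cell_iso j ?_ A
      have h₁ := le_card_of_not_hornP hT
      have h₂ : n + 1 < k := by exact_mod_cast hnk
      have h₃ : n + 1 ≤ j := by omega
      exact_mod_cast h₃
  · obtain ⟨L, ⟨R⟩⟩ := exists_representableBy_horn hW hp.source hf.target (p ≫ f) hk i
    obtain ⟨M, R', h⟩ := mapToLimit_of_isRelCover hW R (isRelCover_tautFam_comp p f
      (hp.horn hW hk i) (isRelCover_tautFam f (isLower_hornP i) fun j _ _ _ => hf.cell hW j))
    exact ⟨M, R', h, fun h' => absurd h' hnk⟩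

end Composition


/-! ### Faces of simplices -/

section Simplices

lemma δ_val {k : ℕ} (j : Fin (k + 2)) (i : Fin (k + 1)) :
    ((SimplexCategory.δ j).toOrderHom i : Fin (k + 2)).val =
      if i.val < j.val then i.val else i.val + 1 := by
  change (j.succAbove i).val = _
  simp only [Fin.succAbove, Fin.lt_def, Fin.val_castSucc]
  split_ifs <;> simp

lemma hom_ext_val {m : SimplexCategory} {k : ℕ} {α β : m ⟶ ⦋k⦌}
    (h : ∀ i : Fin (m.len + 1),
      (α.toOrderHom i : Fin (k + 1)).val = (β.toOrderHom i : Fin (k + 1)).val) : α = β := by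
  ext i : 3
  exact Fin.ext (h i)

lemma comp_apply_val {m m' : SimplexCategory} {k : ℕ} (β : m' ⟶ m) (α : m ⟶ ⦋k⦌)
    (i : Fin (m'.len + 1)) :
    ((β ≫ α).toOrderHom i : Fin (k + 1)).val = (α.toOrderHom (β.toOrderHom i) : Fin (k + 1)).val :=
  rfl

lemma exists_comp_δ {k : ℕ} {m : SimplexCategory} (α : m ⟶ ⦋k + 1⦌) (j : Fin (k + 2))
    (hj : j ∉ verts α) : ∃ β : m ⟶ ⦋k⦌, β ≫ SimplexCategory.δ j = α := by
  induction m using SimplexCategory.rec with | _ m =>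
  exact ⟨_, SimplexCategory.factor_δ_spec α j fun l hl => hj ((mem_verts _ _).2 ⟨l, hl⟩)⟩

lemma notMem_verts_comp_δ {k : ℕ} {m : SimplexCategory} (β : m ⟶ ⦋k⦌) (j : Fin (k + 2)) :
    j ∉ verts (β ≫ SimplexCategory.δ j) := by
  rw [mem_verts]
  rintro ⟨l, hl⟩
  exact Fin.succAbove_ne j _ hl

/-- The vertex `j` of the join factor `Δ^ℓ`, together with all vertices of `Δ^{n-1}`. -/
def vtx (n ℓ : ℕ) (j : Fin (ℓ + 1)) : (⦋n⦌ : SimplexCategory) ⟶ ⦋n + ℓ⦌ :=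
  SimplexCategory.mkHom
    { toFun := fun i : Fin (n + 1) =>
        if i.val < n then (⟨i.val, by omega⟩ : Fin (n + ℓ + 1)) else ⟨n + j.val, by omega⟩
      monotone' := fun a b hab => by
        have hab' : a.val ≤ b.val := hab
        dsimp only
        split_ifs <;> simp only [Fin.mk_le_mk] <;> omega }

lemma vtx_val (n ℓ : ℕ) (j : Fin (ℓ + 1)) (i : Fin (n + 1)) :
    ((vtx n ℓ j).toOrderHom i : Fin (n + ℓ + 1)).val = if i.val < n then i.val else n + j.val := by
  change (ite _ _ _ : Fin (n + ℓ + 1)).val = _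
  split_ifs <;> rfl

lemma collapse_val (n ℓ : ℕ) (i : Fin (n + ℓ + 1)) :
    ((collapse n ℓ).toOrderHom i : Fin (n + 1)).val = min i.val n := rfl

/-- The map `1 ⋆ θ`. -/
def joinHom (n : ℕ) {a b : ℕ} (θ : (⦋a⦌ : SimplexCategory) ⟶ ⦋b⦌) :
    (⦋n + a⦌ : SimplexCategory) ⟶ ⦋n + b⦌ :=
  (joinLeft n).map θ

lemma joinHom_val (n : ℕ) {a b : ℕ} (θ : (⦋a⦌ : SimplexCategory) ⟶ ⦋b⦌) (i : Fin (n + a + 1)) :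
    ((joinHom n θ).toOrderHom i : Fin (n + b + 1)).val =
      if h : i.val < n then i.val
      else n + (θ.toOrderHom (⟨i.val - n, by omega⟩ : Fin (a + 1)) : Fin (b + 1)).val :=
  joinLeftMap_val n θ.toOrderHom i

lemma vtx_comp_collapse (n ℓ : ℕ) (j : Fin (ℓ + 1)) : vtx n ℓ j ≫ collapse n ℓ = 𝟙 _ := by
  refine hom_ext_val fun (i : Fin (n + 1)) => ?_
  rw [comp_apply_val, collapse_val, vtx_val]
  change _ = i.val
  split_ifs <;> omega

lemma joinHom_comp_collapse (n : ℕ) {a b : ℕ} (θ : (⦋a⦌ : SimplexCategory) ⟶ ⦋b⦌) :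
    joinHom n θ ≫ collapse n b = collapse n a := by
  refine hom_ext_val fun (i : Fin (n + a + 1)) => ?_
  rw [comp_apply_val, collapse_val, collapse_val, joinHom_val]
  split_ifs <;> omega

lemma vtx_comp_joinHom (n : ℕ) {a b : ℕ} (θ : (⦋a⦌ : SimplexCategory) ⟶ ⦋b⦌) (j : Fin (a + 1)) :
    vtx n a j ≫ joinHom n θ = vtx n b (θ.toOrderHom j) := by
  refine hom_ext_val fun (i : Fin (n + 1)) => ?_
  have e := vtx_val n a j i
  have e' := vtx_val n b (θ.toOrderHom j) i
  rw [comp_apply_val, joinHom_val, e']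
  by_cases h : i.val < n
  · rw [if_pos h] at e ⊢
    rw [dif_pos (by omega), e]
  · rw [if_neg h] at e ⊢
    rw [dif_neg (by omega)]
    have e₂ : (⟨((vtx n a j).toOrderHom i : Fin (n + a + 1)).val - n, by omega⟩ : Fin (a + 1)) = j :=
      Fin.ext (by simp only [e]; omega)
    exact congrArg (fun l : Fin (a + 1) => n + (θ.toOrderHom l : Fin (b + 1)).val) e₂

lemma joinHom_δ (n ℓ : ℕ) (j : Fin (ℓ + 2)) :
    joinHom n (SimplexCategory.δ j) = SimplexCategory.δ (Fin.natAdd n j : Fin (n + ℓ + 2)) := by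
  refine hom_ext_val fun (i : Fin (n + ℓ + 1)) => ?_
  rw [joinHom_val, δ_val]
  simp only [Fin.val_natAdd]
  by_cases h : i.val < n
  · rw [dif_pos h, if_pos (by omega)]
  · rw [dif_neg h]
    refine (congrArg (n + ·) (δ_val j ⟨i.val - n, by omega⟩)).trans ?_
    simp only
    split_ifs <;> omega

lemma δ_natAdd_comp_collapse (n ℓ : ℕ) (j : Fin (ℓ + 2)) :
    SimplexCategory.δ (Fin.natAdd n j : Fin (n + ℓ + 2)) ≫ collapse n (ℓ + 1) = collapse n ℓ := by
  rw [← joinHom_δ]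
  exact joinHom_comp_collapse n (SimplexCategory.δ j)

lemma vtx_comp_δ_natAdd (n ℓ : ℕ) (j : Fin (ℓ + 2)) (i : Fin (ℓ + 1)) :
    vtx n ℓ i ≫ SimplexCategory.δ (Fin.natAdd n j : Fin (n + ℓ + 2)) =
      vtx n (ℓ + 1) (j.succAbove i) := by
  rw [← joinHom_δ]
  exact vtx_comp_joinHom n (SimplexCategory.δ j) i

lemma vtx_zero (n : ℕ) (j : Fin 1) : vtx n 0 j = 𝟙 _ := by
  refine hom_ext_val fun (i : Fin (n + 1)) => ?_
  rw [vtx_val]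
  change _ = i.val
  split_ifs <;> omega

/-- The simplex `α` of `Δ^{n + ℓ}` misses one of the first `n` vertices. -/
def MissesLow (n : ℕ) {k : ℕ} {m : SimplexCategory} (α : m ⟶ ⦋k⦌) : Prop :=
  ∃ i : Fin (k + 1), i.val < n ∧ i ∉ verts α

lemma missesLow_δ (n : ℕ) {k : ℕ} (i : Fin (k + 2)) (hi : i.val < n) :
    MissesLow n (SimplexCategory.δ i) := by
  refine ⟨i, hi, ?_⟩
  have := notMem_verts_comp_δ (𝟙 _) i
  rwa [Category.id_comp] at this

/-- Postcomposition with a map that is the identity on the first `n` vertices, and preserves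
the other ones. -/
lemma MissesLow.comp_right {n k k' : ℕ} (hk : n ≤ k') {m : SimplexCategory} {α : m ⟶ ⦋k⦌}
    (h : MissesLow n α) (β : (⦋k⦌ : SimplexCategory) ⟶ ⦋k'⦌)
    (hβ : ∀ i : Fin (k + 1), (β.toOrderHom i : Fin (k' + 1)).val < n →
      (β.toOrderHom i : Fin (k' + 1)).val = i.val) : MissesLow n (α ≫ β) := by
  obtain ⟨i, hi, hi'⟩ := h
  refine ⟨⟨i.val, by omega⟩, hi, ?_⟩
  rw [mem_verts]
  rintro ⟨l, hl⟩
  have hl' : (β.toOrderHom (α.toOrderHom l) : Fin (k' + 1)).val = i.val := congrArg Fin.val hl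
  refine hi' ((mem_verts _ _).2 ⟨l, Fin.ext ?_⟩)
  rw [← hβ _ (by rw [hl']; exact hi), hl']

lemma MissesLow.comp_collapse {n ℓ : ℕ} {m : SimplexCategory} {α : m ⟶ ⦋n + ℓ⦌}
    (h : MissesLow n α) : MissesLow n (α ≫ collapse n ℓ) :=
  h.comp_right le_rfl _ fun i hi => by
    rw [collapse_val] at hi ⊢
    omega

lemma MissesLow.comp_vtx {n ℓ : ℕ} {m : SimplexCategory} {α : m ⟶ ⦋n⦌}
    (h : MissesLow n α) (j : Fin (ℓ + 1)) : MissesLow n (α ≫ vtx n ℓ j) :=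
  h.comp_right (by omega) _ fun i hi => by
    rw [vtx_val] at hi ⊢
    split_ifs at hi ⊢ <;> omega

lemma MissesLow.comp_joinHom {n a b : ℕ} {m : SimplexCategory} {α : m ⟶ ⦋n + a⦌}
    (h : MissesLow n α) (θ : (⦋a⦌ : SimplexCategory) ⟶ ⦋b⦌) : MissesLow n (α ≫ joinHom n θ) :=
  h.comp_right (by omega) _ fun i hi => by
    rw [joinHom_val] at hi ⊢
    split_ifs at hi ⊢ <;> omega

end Simplices

/-! ### Unique horn fillers in terms of faces -/

section Faces

variable {E U X : SimplicialObject C}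

lemma map_op_comp (X : SimplicialObject C) {a b c : SimplexCategory} (α : a ⟶ b) (β : b ⟶ c) :
    X.map β.op ≫ X.map α.op = X.map (α ≫ β).op := by
  rw [op_comp, X.map_comp]

/-- Simplices with the same faces (except possibly one) and the same image are equal. -/
def HornInj (p : E ⟶ U) (k : ℕ) : Prop :=
  ∀ (i : Fin (k + 2)) {A : C} (x x' : A ⟶ E _⦋k + 1⦌),
    (∀ j, j ≠ i → x ≫ E.δ j = x' ≫ E.δ j) →
    x ≫ p.app (op ⦋k + 1⦌) = x' ≫ p.app (op ⦋k + 1⦌) → x = x'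

/-- Simplices with the same faces and the same image are equal. -/
def BdryInj (p : E ⟶ U) (k : ℕ) : Prop :=
  ∀ {A : C} (x x' : A ⟶ E _⦋k + 1⦌), (∀ j, x ≫ E.δ j = x' ≫ E.δ j) →
    x ≫ p.app (op ⦋k + 1⦌) = x' ≫ p.app (op ⦋k + 1⦌) → x = x'

/-- The faces `y j`, for the indices `j` in `Q`, are compatible. -/
def FaceCompat {k : ℕ} {A : C} (y : Fin (k + 2) → (A ⟶ E _⦋k⦌)) (Q : Fin (k + 2) → Prop) : Prop :=
  ∀ j j', Q j → Q j' → ∀ {m : SimplexCategory} (β β' : m ⟶ ⦋k⦌),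
    β ≫ SimplexCategory.δ j = β' ≫ SimplexCategory.δ j' →
      y j ≫ E.map β.op = y j' ≫ E.map β'.op

/-- Compatible families of faces, with indices in `Q`, can be filled. -/
def FacesFill (p : E ⟶ U) (k : ℕ) (Q : Fin (k + 2) → Prop) : Prop :=
  ∀ {A : C} (y : Fin (k + 2) → (A ⟶ E _⦋k⦌)) (z : A ⟶ U _⦋k + 1⦌),
    FaceCompat y Q → (∀ j, Q j → y j ≫ p.app (op ⦋k⦌) = z ≫ U.δ j) →
    ∃ x : A ⟶ E _⦋k + 1⦌, (∀ j, Q j → x ≫ E.δ j = y j) ∧ x ≫ p.app (op ⦋k + 1⦌) = z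

/-- Horns can be filled. -/
def HornFill (p : E ⟶ U) (k : ℕ) : Prop :=
  ∀ i : Fin (k + 2), FacesFill p k (fun j => j ≠ i)

lemma ofSimplex_ext {k : ℕ} {P : Finset (Fin (k + 2)) → Prop} (Q : Fin (k + 2) → Prop)
    (hPQ : ∀ T, P T → ∃ j, Q j ∧ j ∉ T) (p : E ⟶ U) {A : C} (x x' : A ⟶ E _⦋k + 1⦌)
    (h : ∀ j, Q j → x ≫ E.δ j = x' ≫ E.δ j)
    (h' : x ≫ p.app (op ⦋k + 1⦌) = x' ≫ p.app (op ⦋k + 1⦌)) :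
    RelFam.ofSimplex P p x = RelFam.ofSimplex P p x' := by
  refine RelFam.ext' (fun α hα => ?_) h'
  obtain ⟨j, hj, hj'⟩ := hPQ _ hα
  obtain ⟨β, rfl⟩ := exists_comp_δ α j hj'
  change x ≫ E.map _ = x' ≫ E.map _
  rw [← map_op_comp, ← Category.assoc, ← Category.assoc]
  exact congrArg (· ≫ E.map β.op) (h j hj)

lemma hornInj_of_bijective {p : E ⟶ U} {k : ℕ} (h : ∀ (i : Fin (k + 2)) (A : C),
    Function.Bijective (ofPoint (relFam (HornP i) p) (tautFam (HornP i) p) A)) : HornInj p k := by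
  intro i A x x' h₁ h₂
  refine (h i A).1 ?_
  rw [ofPoint_tautFam, ofPoint_tautFam]
  exact ofSimplex_ext (fun j => j ≠ i) (fun _ h => h) p x x' h₁ h₂

lemma bdryInj_of_bijective {p : E ⟶ U} {k : ℕ} (h : ∀ A : C,
    Function.Bijective (ofPoint (relFam BdryP p) (tautFam (k := k + 1) BdryP p) A)) :
    BdryInj p k := by
  intro A x x' h₁ h₂
  refine (h A).1 ?_
  rw [ofPoint_tautFam, ofPoint_tautFam]
  exact ofSimplex_ext (fun _ => True) (fun _ ⟨j, hj⟩ => ⟨j, trivial, hj⟩) p x x' (fun j _ => h₁ j) h₂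

lemma facesFill_of_surjective {p : E ⟶ U} {k : ℕ} {P : Finset (Fin (k + 2)) → Prop}
    {Q : Fin (k + 2) → Prop} (hPQ : ∀ T, P T ↔ ∃ j, Q j ∧ j ∉ T)
    (h : ∀ A : C, Function.Surjective (ofPoint (relFam P p) (tautFam P p) A)) :
    FacesFill p k Q := by
  intro A y z hy hz
  have hj : ∀ {m : SimplexCategory} (α : m ⟶ ⦋k + 1⦌), P (verts α) →
      ∃ (j : Fin (k + 2)) (β : m ⟶ ⦋k⦌), Q j ∧ β ≫ SimplexCategory.δ j = α := by
    rintro m α hα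
    obtain ⟨j, hj, hj'⟩ := (hPQ _).1 hα
    obtain ⟨β, hβ⟩ := exists_comp_δ α j hj'
    exact ⟨j, β, hj, hβ⟩
  choose j β hj hβ using @hj
  let s : RelFam P p A :=
    { left :=
        { val := fun α hα => y (j α hα) ≫ E.map (β α hα).op
          nat := fun γ α hα hα' => by
            rw [Category.assoc, map_op_comp]
            refine hy _ _ (hj _ _) (hj _ _) _ _ ?_
            rw [hβ, Category.assoc, hβ] }
      right := z
      w := fun α hα => by
        rw [Category.assoc, p.naturality, ← Category.assoc, hz _ (hj _ _), Category.assoc]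
        exact congrArg (z ≫ ·) ((map_op_comp U _ _).trans (by rw [hβ])) }
  obtain ⟨x, hx⟩ := h A s
  rw [ofPoint_tautFam] at hx
  refine ⟨x, fun l hl => ?_, congrArg (fun t : RelFam P p A => t.right) hx⟩
  have hl' : P (verts (SimplexCategory.δ l)) := (hPQ _).2 ⟨l, hl, by
    have := notMem_verts_comp_δ (𝟙 _) l
    rwa [Category.id_comp] at this⟩
  refine (congrArg (fun t : RelFam P p A => t.left.val _ hl') hx).trans ?_
  refine (hy _ l (hj _ _) hl _ (𝟙 _) ?_).trans (by simp)
  rw [hβ, Category.id_comp]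

/-- Compatibility of faces follows from the usual identities. -/
lemma faceCompat_of_δ {k : ℕ} {A : C} {y : Fin (k + 3) → (A ⟶ E _⦋k + 1⦌)} {Q : Fin (k + 3) → Prop}
    (h : ∀ i j : Fin (k + 2), i ≤ j → Q i.castSucc → Q j.succ →
      y j.succ ≫ E.δ i = y i.castSucc ≫ E.δ j) : FaceCompat y Q := by
  have key : ∀ i j : Fin (k + 2), i ≤ j → Q i.castSucc → Q j.succ →
      ∀ {m : SimplexCategory} (β β' : m ⟶ ⦋k + 1⦌),
        β ≫ SimplexCategory.δ i.castSucc = β' ≫ SimplexCategory.δ j.succ →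
        y i.castSucc ≫ E.map β.op = y j.succ ≫ E.map β'.op := by
    intro i j hij hi hj m β β' e
    -- The common simplex misses both vertices `i.castSucc` and `j.succ`, so it factors through the
    -- codimension 2 face opposite to them; there the simplicial identity suffices.
    have h₁ : i ∉ verts β' := by
      intro hi'
      obtain ⟨l, hl⟩ := (mem_verts _ _).1 hi'
      refine notMem_verts_comp_δ β i.castSucc ?_
      rw [e]
      refine (mem_verts _ _).2 ⟨l, Fin.ext ?_⟩
      refine (comp_apply_val _ _ _).trans ?_
      rw [δ_val]
      have hl' : (β'.toOrderHom l : Fin (k + 2)).val = i.val := congrArg Fin.val hl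
      have hij' : i.val ≤ j.val := hij
      simp only [Fin.val_succ, Fin.val_castSucc]
      split_ifs <;> omega
    obtain ⟨γ, rfl⟩ := exists_comp_δ β' i h₁
    have h₂ : β = γ ≫ SimplexCategory.δ j := by
      rw [← cancel_mono (SimplexCategory.δ i.castSucc), e, Category.assoc, Category.assoc,
        SimplexCategory.δ_comp_δ hij]
    rw [h₂, ← map_op_comp, ← map_op_comp, ← Category.assoc, ← Category.assoc]
    exact congrArg (· ≫ E.map γ.op) (h i j hij hi hj).symm
  intro j j' hj hj' m β β' e
  rcases lt_trichotomy j j' with hlt | rfl | hlt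
  · obtain ⟨b, rfl⟩ := Fin.exists_succ_eq.2 (Fin.ne_zero_of_lt hlt)
    obtain ⟨a, rfl⟩ := Fin.exists_castSucc_eq.2 (Fin.ne_last_of_lt hlt)
    exact key a b (Fin.castSucc_lt_succ_iff.1 hlt) hj hj' β β' e
  · rw [(cancel_mono _).1 e]
  · obtain ⟨b, rfl⟩ := Fin.exists_succ_eq.2 (Fin.ne_zero_of_lt hlt)
    obtain ⟨a, rfl⟩ := Fin.exists_castSucc_eq.2 (Fin.ne_last_of_lt hlt)
    exact (key a b (Fin.castSucc_lt_succ_iff.1 hlt) hj' hj β' β e.symm).symm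

/-- The faces of a simplex, one of which is replaced by another simplex, are compatible. -/
lemma faceCompat_update {k : ℕ} {A : C} (w : A ⟶ E _⦋k + 1⦌) (j₀ : Fin (k + 2)) (h : A ⟶ E _⦋k⦌)
    {Q : Fin (k + 2) → Prop}
    (hh : ∀ {m : SimplexCategory} (β : m ⟶ ⦋k⦌) (j : Fin (k + 2)), Q j → j ≠ j₀ →
      j ∉ verts (β ≫ SimplexCategory.δ j₀) →
      h ≫ E.map β.op = w ≫ E.map (β ≫ SimplexCategory.δ j₀).op) :
    FaceCompat (Function.update (fun j => w ≫ E.δ j) j₀ h) Q := by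
  have key : ∀ (j : Fin (k + 2)), Q j → j ≠ j₀ → ∀ {m : SimplexCategory} (β β' : m ⟶ ⦋k⦌),
      β ≫ SimplexCategory.δ j = β' ≫ SimplexCategory.δ j₀ →
      (w ≫ E.δ j) ≫ E.map β.op = h ≫ E.map β'.op := by
    intro j hj hj₀ m β β' e
    rw [hh β' j hj hj₀ (by rw [← e]; exact notMem_verts_comp_δ β j), ← e, Category.assoc,
      SimplicialObject.δ, map_op_comp]
  intro j j' hj hj' m β β' e
  by_cases h₁ : j = j₀
  · subst h₁
    by_cases h₂ : j' = j
    · subst h₂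
      rw [(cancel_mono _).1 e]
    · rw [Function.update_self, Function.update_of_ne h₂]
      exact (key j' hj' h₂ β' β e.symm).symm
  · rw [Function.update_of_ne h₁]
    by_cases h₂ : j' = j₀
    · subst h₂
      rw [Function.update_self]
      exact key j hj h₁ β β' e
    · rw [Function.update_of_ne h₂, Category.assoc, Category.assoc, SimplicialObject.δ,
        SimplicialObject.δ, map_op_comp, map_op_comp, e]

end Faces


/-! ### Pointwise study of higher morphism spaces -/

section HigherMorphisms

variable {E U X : SimplicialObject C} {n : ℕ} {A : C}

/-- The simplex `x` is a higher morphism, with the given vertex `a`: the faces of `x` which miss one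
of the first `n` vertices, and the image of `x`, are those of the degeneracy of `a`. -/
structure IsHM (n : ℕ) (g : E ⟶ X) (ℓ : ℕ) {A : C} (x : A ⟶ E _⦋n + ℓ⦌) (a : A ⟶ E _⦋n⦌) :
    Prop where
  low : ∀ {m : SimplexCategory} (α : m ⟶ ⦋n + ℓ⦌), MissesLow n α →
    x ≫ E.map α.op = a ≫ E.map (α ≫ collapse n ℓ).op
  base : x ≫ g.app (op ⦋n + ℓ⦌) = a ≫ E.map (collapse n ℓ).op ≫ g.app (op ⦋n + ℓ⦌)

/-- The simplices `a` and `a'` have the same faces (except for the last one) and the same image. -/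
structure SameLow (n : ℕ) (g : E ⟶ X) {A : C} (a a' : A ⟶ E _⦋n⦌) : Prop where
  low : ∀ {m : SimplexCategory} (α : m ⟶ ⦋n⦌), MissesLow n α → a ≫ E.map α.op = a' ≫ E.map α.op
  base : a ≫ g.app (op ⦋n⦌) = a' ≫ g.app (op ⦋n⦌)

variable {g : E ⟶ X}

lemma SameLow.symm {a a' : A ⟶ E _⦋n⦌} (h : SameLow n g a a') : SameLow n g a' a :=
  ⟨fun α hα => (h.low α hα).symm, h.base.symm⟩

lemma IsHM.sameLow {ℓ : ℕ} {x : A ⟶ E _⦋n + ℓ⦌} {a : A ⟶ E _⦋n⦌} (h : IsHM n g ℓ x a)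
    (j : Fin (ℓ + 1)) : SameLow n g (x ≫ E.map (vtx n ℓ j).op) a := by
  constructor
  · intro m α hα
    rw [Category.assoc, map_op_comp, h.low _ (hα.comp_vtx j), Category.assoc, vtx_comp_collapse,
      Category.comp_id]
  · rw [Category.assoc, g.naturality, ← Category.assoc, h.base]
    simp only [Category.assoc]
    rw [← g.naturality, ← Category.assoc (E.map _) (E.map _), map_op_comp, vtx_comp_collapse]
    simp

lemma IsHM.congr {ℓ : ℕ} {x : A ⟶ E _⦋n + ℓ⦌} {a a' : A ⟶ E _⦋n⦌} (h : IsHM n g ℓ x a)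
    (h' : SameLow n g a a') : IsHM n g ℓ x a' := by
  constructor
  · intro m α hα
    rw [h.low α hα, h'.low _ hα.comp_collapse]
  · rw [h.base, g.naturality, ← Category.assoc, ← Category.assoc, h'.base]

lemma IsHM.atVtx {ℓ : ℕ} {x : A ⟶ E _⦋n + ℓ⦌} {a : A ⟶ E _⦋n⦌} (h : IsHM n g ℓ x a)
    (j : Fin (ℓ + 1)) : IsHM n g ℓ x (x ≫ E.map (vtx n ℓ j).op) :=
  h.congr (h.sameLow j).symm

lemma IsHM.comp {b ℓ : ℕ} {x : A ⟶ E _⦋n + ℓ⦌} {a : A ⟶ E _⦋n⦌} (h : IsHM n g ℓ x a)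
    (θ : (⦋b⦌ : SimplexCategory) ⟶ ⦋ℓ⦌) : IsHM n g b (x ≫ E.map (joinHom n θ).op) a := by
  constructor
  · intro m α hα
    rw [Category.assoc, map_op_comp, h.low _ (hα.comp_joinHom θ), Category.assoc,
      joinHom_comp_collapse]
  · rw [Category.assoc, g.naturality, ← Category.assoc, h.base]
    simp only [Category.assoc]
    rw [← g.naturality, ← Category.assoc (E.map _) (E.map _), map_op_comp, joinHom_comp_collapse]

lemma IsHM.δ {ℓ : ℕ} {x : A ⟶ E _⦋n + (ℓ + 1)⦌} {a : A ⟶ E _⦋n⦌} (h : IsHM n g (ℓ + 1) x a)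
    (j : Fin (ℓ + 2)) :
    IsHM n g ℓ (x ≫ E.δ (Fin.natAdd n j : Fin (n + ℓ + 2))) a := by
  have := h.comp (SimplexCategory.δ j)
  rw [joinHom_δ] at this
  exact this

lemma IsHM.degenerate (g : E ⟶ X) (ℓ : ℕ) (a : A ⟶ E _⦋n⦌) :
    IsHM n g ℓ (a ≫ E.map (collapse n ℓ).op) a :=
  ⟨fun α _ => by rw [Category.assoc, map_op_comp], by rw [Category.assoc]⟩

lemma IsHM.pre {B : C} {ℓ : ℕ} {x : A ⟶ E _⦋n + ℓ⦌} {a : A ⟶ E _⦋n⦌} (h : IsHM n g ℓ x a)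
    (b : B ⟶ A) : IsHM n g ℓ (b ≫ x) (b ≫ a) :=
  ⟨fun α hα => by rw [Category.assoc, h.low α hα, Category.assoc],
    by rw [Category.assoc, h.base, Category.assoc]⟩

lemma degenerate_vtx (ℓ : ℕ) (a : A ⟶ E _⦋n⦌) (j : Fin (ℓ + 1)) :
    (a ≫ E.map (collapse n ℓ).op) ≫ E.map (vtx n ℓ j).op = a := by
  rw [Category.assoc, map_op_comp, vtx_comp_collapse]
  simp

lemma δ_natAdd_vtx {ℓ : ℕ} (x : A ⟶ E _⦋n + (ℓ + 1)⦌) (j : Fin (ℓ + 2)) (i : Fin (ℓ + 1)) :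
    (x ≫ E.δ (Fin.natAdd n j : Fin (n + ℓ + 2))) ≫ E.map (vtx n ℓ i).op =
      x ≫ E.map (vtx n (ℓ + 1) (j.succAbove i)).op := by
  rw [Category.assoc, SimplicialObject.δ, map_op_comp, vtx_comp_δ_natAdd]

/-- The unique filling properties of the composition of a local `n`-bundle and an
`(n + 1)`-hypercover. -/
structure UniqueFillings (n : ℕ) (p : E ⟶ U) (f : U ⟶ X) : Prop where
  pInj : ∀ k, n ≤ k → HornInj p k
  pFill : ∀ k, n ≤ k → HornFill p k
  fInj : ∀ k, n ≤ k → BdryInj f k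
  fFill : ∀ k, n ≤ k → FacesFill f k (fun _ => True)
  gFill : ∀ k, n + 1 ≤ k → HornFill (p ≫ f) k

/-- The index k refers to simplices of dimension k + 1. So k ≥ n is the range in which the n-stack p
and the (n+1)-hypercover f have isomorphisms, while the (n+1)-stack given by their composition needs
k ≥ n + 1. -/
lemma uniqueFillings {W : MorphismProperty C} (hW : IsCategoryWithCovers W) {p : E ⟶ U}
    {f : U ⟶ X} (hp : IsStack W n p) (hf : IsHypercover W ((n : ℕ∞) + 1) f) :
    UniqueFillings n p f where
  pInj k hk := hornInj_of_bijective fun i A => hp.horn_iso (by exact_mod_cast Nat.lt_succ_of_le hk) i A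
  pFill k hk := fun i => facesFill_of_surjective (fun _ => Iff.rfl) fun A =>
    (hp.horn_iso (by exact_mod_cast Nat.lt_succ_of_le hk) i A).2
  fInj k hk := bdryInj_of_bijective fun A =>
    hf.cell_iso (k + 1) (by exact_mod_cast Nat.succ_le_succ hk) A
  fFill k hk := facesFill_of_surjective (P := BdryP) (fun T => by simp [BdryP]) fun A =>
    (hf.cell_iso (k + 1) (by exact_mod_cast Nat.succ_le_succ hk) A).2
  gFill k hk := fun i => facesFill_of_surjective (fun _ => Iff.rfl) fun A =>
    ((hp.comp_isHypercover hW hf).horn_iso (by exact_mod_cast Nat.lt_succ_of_le hk) i A).2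

variable {p : E ⟶ U} {f : U ⟶ X}

/-- Uniqueness for f identifies the images in U, and then uniqueness for p applies. Unlike unique
horn filling for the composition, this also covers dimension n + 1. -/
lemma UniqueFillings.ext (H : UniqueFillings n p f) {k : ℕ} (hk : n ≤ k) {x x' : A ⟶ E _⦋k + 1⦌}
    (h : ∀ j, x ≫ E.δ j = x' ≫ E.δ j)
    (h' : x ≫ (p ≫ f).app (op ⦋k + 1⦌) = x' ≫ (p ≫ f).app (op ⦋k + 1⦌)) : x = x' := by
  refine H.pInj k hk 0 x x' (fun j _ => h j) (H.fInj k hk _ _ (fun j => ?_) ?_)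
  · rw [Category.assoc, Category.assoc, ← SimplicialObject.δ_naturality, ← Category.assoc, h,
      Category.assoc]
  · rw [Category.assoc, Category.assoc]
    exact h'

/-- By induction on ℓ all faces agree: those opposite to the first n vertices are degenerate on a
common vertex, and the others are higher morphisms with the same vertices. The images in X also
agree. -/
lemma IsHM.ext (H : UniqueFillings n p f) {ℓ : ℕ} {x x' : A ⟶ E _⦋n + ℓ⦌} {a a' : A ⟶ E _⦋n⦌}
    (h : IsHM n (p ≫ f) ℓ x a) (h' : IsHM n (p ≫ f) ℓ x' a')
    (hv : ∀ j, x ≫ E.map (vtx n ℓ j).op = x' ≫ E.map (vtx n ℓ j).op) : x = x' := by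
  induction ℓ with
  | zero =>
    have := hv 0
    rw [vtx_zero] at this
    simpa using this
  | succ ℓ ih =>
    have hx := h.atVtx 0
    have hx' := h'.atVtx 0
    rw [← hv 0] at hx'
    refine H.ext (k := n + ℓ) (by omega) (fun j => ?_) (hx.base.trans hx'.base.symm)
    by_cases hj : j.val < n
    · exact (hx.low _ (missesLow_δ n j hj)).trans (hx'.low _ (missesLow_δ n j hj)).symm
    · obtain ⟨j', rfl⟩ : ∃ j' : Fin (ℓ + 2), j = (Fin.natAdd n j' : Fin (n + ℓ + 2)) :=
        ⟨⟨j.val - n, by omega⟩, Fin.ext (by simp only [Fin.val_natAdd]; omega)⟩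
      refine ih (h.δ j') (h'.δ j') fun i => ?_
      rw [δ_natAdd_vtx, δ_natAdd_vtx, hv]

/-- Filling of horns in higher morphism spaces. -/
lemma IsHM.fill (H : UniqueFillings n p f) {ℓ : ℕ} (i : Fin (ℓ + 3))
    (t : Fin (ℓ + 3) → (A ⟶ E _⦋n⦌)) (ht : ∀ j, SameLow n (p ≫ f) (t j) (t 0))
    (y : Fin (ℓ + 3) → (A ⟶ E _⦋n + (ℓ + 1)⦌))
    (hy : ∀ j, j ≠ i → ∃ a, IsHM n (p ≫ f) (ℓ + 1) (y j) a)
    (hv : ∀ j, j ≠ i → ∀ l, y j ≫ E.map (vtx n (ℓ + 1) l).op = t (j.succAbove l)) :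
    ∃ x : A ⟶ E _⦋n + (ℓ + 2)⦌, IsHM n (p ≫ f) (ℓ + 2) x (t 0) ∧
      ∀ j, j ≠ i → x ≫ E.δ (Fin.natAdd n j : Fin (n + (ℓ + 1) + 2)) = y j := by
  have hy' : ∀ j, j ≠ i → IsHM n (p ≫ f) (ℓ + 1) (y j) (t 0) := fun j hj => by
    obtain ⟨a, ha⟩ := hy j hj
    refine (ha.atVtx 0).congr ?_
    rw [hv j hj]
    exact ht _
  -- Horn of E in dimension n + ℓ + 2 without the face n + i: the faces opposite to the first n
  -- vertices must be degenerate on `t 0`, and the remaining ones are the given `y j`.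
  let Y : Fin (n + ℓ + 3) → (A ⟶ E _⦋n + ℓ + 1⦌) := fun j =>
    if j.val < n then t 0 ≫ E.map (SimplexCategory.δ j ≫ collapse n (ℓ + 2)).op
    else y ⟨j.val - n, by omega⟩
  have Ylow : ∀ j : Fin (n + ℓ + 3), j.val < n →
      Y j = t 0 ≫ E.map (SimplexCategory.δ j ≫ collapse n (ℓ + 2)).op := fun j hj => if_pos hj
  have Yhigh : ∀ j : Fin (ℓ + 3), Y (Fin.natAdd n j : Fin (n + (ℓ + 3))) = y j := fun j => by
    refine (if_neg (by simp)).trans (congrArg y (Fin.ext ?_))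
    simp
  have hne : ∀ j : Fin (ℓ + 3), (Fin.natAdd n j : Fin (n + (ℓ + 3))) ≠ Fin.natAdd n i → j ≠ i := by
    rintro j hj rfl
    exact hj rfl
  have hcompat : FaceCompat Y (fun j => j ≠ (Fin.natAdd n i : Fin (n + (ℓ + 3)))) := by
    refine faceCompat_of_δ (k := n + ℓ) fun a b hab ha hb => ?_
    have hab' : a.val ≤ b.val := hab
    by_cases hbn : b.val + 1 < n
    · rw [Ylow _ (by simpa using hbn), Ylow _ (by simp only [Fin.val_castSucc]; omega)]
      rw [Category.assoc, Category.assoc, SimplicialObject.δ, SimplicialObject.δ, map_op_comp,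
        map_op_comp, ← Category.assoc, ← Category.assoc, SimplexCategory.δ_comp_δ hab]
    obtain ⟨b', hb'⟩ : ∃ b' : Fin (ℓ + 3), b.succ = (Fin.natAdd n b' : Fin (n + (ℓ + 3))) :=
      ⟨⟨b.val + 1 - n, by omega⟩, Fin.ext (by
        simp only [Fin.val_natAdd, Fin.val_succ]
        omega)⟩
    have hb'i : b' ≠ i := hne b' (by rw [← hb']; exact hb)
    rw [hb', Yhigh]
    by_cases han : a.val < n
    · rw [Ylow _ (by simpa using han)]
      refine ((hy' b' hb'i).low _ (missesLow_δ n a han)).trans ?_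
      rw [Category.assoc, SimplicialObject.δ, map_op_comp, ← Category.assoc,
        ← SimplexCategory.δ_comp_δ hab, Category.assoc, hb', δ_natAdd_comp_collapse n (ℓ + 1) b']
    · obtain ⟨a', ha'⟩ : ∃ a' : Fin (ℓ + 2), a = (Fin.natAdd n a' : Fin (n + (ℓ + 2))) :=
        ⟨⟨a.val - n, by omega⟩, Fin.ext (by simp only [Fin.val_natAdd]; omega)⟩
      obtain ⟨b'', hb''⟩ : ∃ b'' : Fin (ℓ + 2), b = (Fin.natAdd n b'' : Fin (n + (ℓ + 2))) :=
        ⟨⟨b.val - n, by omega⟩, Fin.ext (by simp only [Fin.val_natAdd]; omega)⟩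
      have e₁ : b' = b''.succ := by
        refine Fin.ext ?_
        have h₁ := congrArg Fin.val hb'
        have h₂ := congrArg Fin.val hb''
        simp only [Fin.val_natAdd, Fin.val_succ] at h₁ h₂ ⊢
        omega
      have e₂ : a.castSucc = (Fin.natAdd n a'.castSucc : Fin (n + (ℓ + 3))) := by
        rw [ha']
        rfl
      have ha'i : a'.castSucc ≠ i := hne _ (by rw [← e₂]; exact ha)
      have hab'' : a' ≤ b'' := by
        have h₁ := congrArg Fin.val ha'
        have h₂ := congrArg Fin.val hb''
        simp only [Fin.val_natAdd] at h₁ h₂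
        exact Fin.le_def.2 (by omega)
      rw [e₂, Yhigh, ha', hb'']
      -- Two high faces meet in higher morphisms with the same vertices, hence in the same simplex.
      refine IsHM.ext H ((hy' b' hb'i).δ a') ((hy' _ ha'i).δ b'') fun l => ?_
      refine (δ_natAdd_vtx _ _ _).trans (Eq.trans ?_ (δ_natAdd_vtx _ _ _).symm)
      rw [hv _ hb'i, hv _ ha'i, e₁]
      exact congrArg (fun h : (⦋ℓ⦌ : SimplexCategory) ⟶ ⦋ℓ + 2⦌ => t (h.toOrderHom l))
        (SimplexCategory.δ_comp_δ hab'')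
  obtain ⟨x, hx, hxz⟩ := H.gFill (n + ℓ + 1) (by omega) (Fin.natAdd n i : Fin (n + (ℓ + 3))) Y
    (t 0 ≫ E.map (collapse n (ℓ + 2)).op ≫ (p ≫ f).app (op ⦋n + (ℓ + 2)⦌)) hcompat (fun j hj => by
      simp only [Category.assoc]
      rw [SimplicialObject.δ, ← (p ≫ f).naturality, ← Category.assoc (E.map _)]
      erw [map_op_comp]
      by_cases hjn : j.val < n
      · rw [Ylow _ hjn, Category.assoc]
      · obtain ⟨j', rfl⟩ : ∃ j' : Fin (ℓ + 3), j = (Fin.natAdd n j' : Fin (n + (ℓ + 3))) :=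
          ⟨⟨j.val - n, by omega⟩, Fin.ext (by simp only [Fin.val_natAdd]; omega)⟩
        erw [δ_natAdd_comp_collapse n (ℓ + 1) j']
        rw [Yhigh]
        exact (hy' j' (hne _ hj)).base)
  refine ⟨x, ⟨fun {m} α hα => ?_, hxz⟩, fun j hj => ?_⟩
  · obtain ⟨l, hl, hl'⟩ := hα
    obtain ⟨β, rfl⟩ := exists_comp_δ (k := n + ℓ + 1) α l hl'
    have hli : l ≠ (Fin.natAdd n i : Fin (n + (ℓ + 3))) := by
      rintro rfl
      simp at hl
    rw [← map_op_comp, ← Category.assoc]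
    refine (congrArg (· ≫ E.map β.op) ((hx l hli).trans (Ylow l hl))).trans ?_
    simp only [Category.assoc]
    rw [map_op_comp]
  · refine (hx _ fun h => hj ?_).trans (Yhigh j)
    exact Fin.natAdd_injective _ _ h

/-! ### The equivalence relation given by higher morphisms -/

/-- The equivalence relation on `Hom(A, E_n)` which is given by the higher morphisms. -/
def HMRel (n : ℕ) (g : E ⟶ X) {A : C} (a b : A ⟶ E _⦋n⦌) : Prop :=
  ∃ h : A ⟶ E _⦋n + 1⦌, IsHM n g 1 h a ∧ h ≫ E.map (vtx n 1 0).op = a ∧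
    h ≫ E.map (vtx n 1 1).op = b

lemma HMRel.sameLow {a b : A ⟶ E _⦋n⦌} (h : HMRel n g a b) : SameLow n g a b := by
  obtain ⟨h, hh, -, rfl⟩ := h
  exact (hh.sameLow 1).symm

lemma HMRel.refl (g : E ⟶ X) (a : A ⟶ E _⦋n⦌) : HMRel n g a a :=
  ⟨_, IsHM.degenerate g 1 a, degenerate_vtx 1 a 0, degenerate_vtx 1 a 1⟩

lemma HMRel.pre {a b : A ⟶ E _⦋n⦌} (h : HMRel n g a b) {B : C} (c : B ⟶ A) :
    HMRel n g (c ≫ a) (c ≫ b) := by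
  obtain ⟨h, hh, h₀, h₁⟩ := h
  exact ⟨c ≫ h, hh.pre c, by rw [Category.assoc, h₀], by rw [Category.assoc, h₁]⟩

lemma IsHM.hmRel {ℓ : ℕ} {x : A ⟶ E _⦋n + ℓ⦌} {a : A ⟶ E _⦋n⦌} (h : IsHM n g ℓ x a)
    {i j : Fin (ℓ + 1)} (hij : i ≤ j) :
    HMRel n g (x ≫ E.map (vtx n ℓ i).op) (x ≫ E.map (vtx n ℓ j).op) := by
  have h' := h.comp (SimplexCategory.mkOfLe i j hij)
  have h₀ : (x ≫ E.map (joinHom n (SimplexCategory.mkOfLe i j hij)).op) ≫ E.map (vtx n 1 0).op =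
      x ≫ E.map (vtx n ℓ i).op := by
    rw [Category.assoc, map_op_comp, vtx_comp_joinHom]
    rfl
  have h₁ : (x ≫ E.map (joinHom n (SimplexCategory.mkOfLe i j hij)).op) ≫ E.map (vtx n 1 1).op =
      x ≫ E.map (vtx n ℓ j).op := by
    rw [Category.assoc, map_op_comp, vtx_comp_joinHom]
    rfl
  refine ⟨_, ?_, h₀, h₁⟩
  have := h'.atVtx 0
  rwa [h₀] at this

/-- Filling a horn Λ^2_0 whose edges join a to b and a to c yields an edge from b to c. Together
with reflexivity this gives an equivalence relation. -/
lemma HMRel.euclidean (H : UniqueFillings n p f) {a b c : A ⟶ E _⦋n⦌}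
    (hab : HMRel n (p ≫ f) a b) (hac : HMRel n (p ≫ f) a c) : HMRel n (p ≫ f) b c := by
  obtain ⟨h₁, hh₁, h₁₀, h₁₁⟩ := id hab
  obtain ⟨h₂, hh₂, h₂₀, h₂₁⟩ := id hac
  -- Face 1 is the edge from a to c and face 2 the edge from a to b. Entry 0 of the list of faces is
  -- a dummy, since this face is missing from the horn.
  obtain ⟨x, hx, hx'⟩ := IsHM.fill H (ℓ := 0) 0 ![a, b, c]
    (fun j => by
      fin_cases j
      · exact (HMRel.refl _ a).sameLow
      · exact hab.sameLow.symm
      · exact hac.sameLow.symm) ![h₁, h₂, h₁]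
    (fun j _ => by
      fin_cases j
      · exact ⟨a, hh₁⟩
      · exact ⟨a, hh₂⟩
      · exact ⟨a, hh₁⟩)
    (fun j hj l => by
      fin_cases j
      · exact absurd rfl hj
      · fin_cases l
        · exact h₂₀
        · exact h₂₁
      · fin_cases l
        · exact h₁₀
        · exact h₁₁)
  have := hx.hmRel (i := 1) (j := 2) (by decide)
  have e₁ : x ≫ E.map (vtx n 2 1).op = b := by
    rw [← h₁₁]
    have := δ_natAdd_vtx (ℓ := 1) x 2 1
    rw [hx' 2 (by decide)] at this
    exact this.symm
  have e₂ : x ≫ E.map (vtx n 2 2).op = c := by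
    rw [← h₂₁]
    have := δ_natAdd_vtx (ℓ := 1) x 1 1
    rw [hx' 1 (by decide)] at this
    exact this.symm
  rwa [e₁, e₂] at this

lemma HMRel.symm (H : UniqueFillings n p f) {a b : A ⟶ E _⦋n⦌}
    (hab : HMRel n (p ≫ f) a b) : HMRel n (p ≫ f) b a :=
  hab.euclidean H (HMRel.refl _ a)

lemma HMRel.trans (H : UniqueFillings n p f) {a b c : A ⟶ E _⦋n⦌}
    (hab : HMRel n (p ≫ f) a b) (hbc : HMRel n (p ≫ f) b c) : HMRel n (p ≫ f) a c :=
  (hab.symm H).euclidean H hbc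

/-- Pairwise related vertices span a higher morphism. -/
lemma IsHM.exists_of_pairwise (H : UniqueFillings n p f) {ℓ : ℕ} (t : Fin (ℓ + 1) → (A ⟶ E _⦋n⦌))
    (ht : ∀ i j, HMRel n (p ≫ f) (t i) (t j)) :
    ∃ x : A ⟶ E _⦋n + ℓ⦌, IsHM n (p ≫ f) ℓ x (t 0) ∧ ∀ j, x ≫ E.map (vtx n ℓ j).op = t j := by
  induction ℓ with
  | zero =>
    have h := IsHM.degenerate (n := n) (p ≫ f) 0 (t 0)
    refine ⟨_, h, fun j => ?_⟩
    obtain rfl : j = 0 := Fin.eq_zero j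
    exact degenerate_vtx _ _ _
  | succ ℓ ih =>
    rcases ℓ with _ | ℓ
    · obtain ⟨h, hh, h₀, h₁⟩ := ht 0 1
      refine ⟨h, hh, fun j => ?_⟩
      fin_cases j
      exacts [h₀, h₁]
    -- From dimension 2 on, induction provides all faces, and the horn at 0 is filled.
    · have hy := fun j : Fin (ℓ + 3) => ih (fun l => t (j.succAbove l)) fun i i' => ht _ _
      choose y hy hv using hy
      obtain ⟨x, hx, hx'⟩ := IsHM.fill H (ℓ := ℓ) 0 t (fun j => (ht j 0).sameLow) y
        (fun j _ => ⟨_, hy j⟩) (fun j _ => hv j)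
      refine ⟨x, hx, fun j => ?_⟩
      -- The vertex j is read off from a face that contains it and belongs to the horn, that is, one
      -- with i ≠ j and i ≠ 0.
      obtain ⟨i, hi, hij⟩ : ∃ i : Fin (ℓ + 3), i ≠ 0 ∧ i ≠ j := by
        by_cases h : j = 1
        · exact ⟨⟨2, by omega⟩, by simp [Fin.ext_iff], by rw [h]; simp [Fin.ext_iff]⟩
        · exact ⟨1, by simp, Ne.symm h⟩
      obtain ⟨l, rfl⟩ := Fin.exists_succAbove_eq hij.symm
      rw [← hv i l, ← hx' i hi]
      exact (δ_natAdd_vtx _ _ _).symm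

end HigherMorphisms


/-! ### The relation on simplices of all dimensions, and transport -/

section Transport

variable {E U X : SimplicialObject C} {n : ℕ} {A : C} {g : E ⟶ X}

lemma δ_eq_vtx_one (n : ℕ) :
    SimplexCategory.δ (Fin.natAdd n (0 : Fin 2) : Fin (n + 2)) = vtx n 1 1 := by
  have := vtx_comp_δ_natAdd n 0 0 0
  rwa [vtx_zero, Category.id_comp] at this

lemma δ_eq_vtx_zero (n : ℕ) :
    SimplexCategory.δ (Fin.natAdd n (1 : Fin 2) : Fin (n + 2)) = vtx n 1 0 := by
  have := vtx_comp_δ_natAdd n 0 1 0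
  rwa [vtx_zero, Category.id_comp] at this

lemma exists_factor_of_bdryP {k : ℕ} {m : SimplexCategory} (α : m ⟶ ⦋k⦌) (h : BdryP (verts α)) :
    ∃ j, j < k ∧ ∃ (β : m ⟶ ⦋j⦌) (θ : (⦋j⦌ : SimplexCategory) ⟶ ⦋k⦌), β ≫ θ = α := by
  obtain ⟨i, hi⟩ := h
  rcases k with _ | k
  · exact absurd ((mem_verts α i).2 ⟨0, Subsingleton.elim (α := Fin 1) _ _⟩) hi
  · obtain ⟨β, hβ⟩ := exists_comp_δ α i hi
    exact ⟨k, by omega, β, _, hβ⟩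

lemma eq_id_of_not_bdryP {k : ℕ} (α : (⦋k⦌ : SimplexCategory) ⟶ ⦋k⦌) (h : ¬ BdryP (verts α)) :
    α = 𝟙 _ := by
  have : Epi α := by
    rw [SimplexCategory.epi_iff_surjective]
    intro i
    by_contra hi
    exact h ⟨i, fun h' => hi ((mem_verts _ _).1 h')⟩
  exact SimplexCategory.eq_id_of_epi α

/-- Faces missing one of the first n vertices agree by definition of a higher morphism. The face
opposite to the last vertex is spanned by the first n vertices, which both ends of the higher
morphism share. -/
lemma HMRel.bdry {a b : A ⟶ E _⦋n⦌} (h : HMRel n g a b) {m : SimplexCategory} (α : m ⟶ ⦋n⦌)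
    (hα : BdryP (verts α)) : a ≫ E.map α.op = b ≫ E.map α.op := by
  obtain ⟨i, hi⟩ := hα
  by_cases hin : i.val < n
  · exact h.sameLow.low α ⟨i, hin, hi⟩
  · obtain ⟨h, -, rfl, rfl⟩ := h
    suffices hv : α ≫ vtx n 1 0 = α ≫ vtx n 1 1 by
      rw [Category.assoc, Category.assoc, map_op_comp, map_op_comp, hv]
    refine hom_ext_val fun l => ?_
    have hl : (α.toOrderHom l : Fin (n + 1)) ≠ i := fun e => hi ((mem_verts _ _).2 ⟨l, e⟩)
    have hl' : (α.toOrderHom l : Fin (n + 1)).val ≠ i.val := fun e => hl (Fin.ext e)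
    have h₁ : (α.toOrderHom l : Fin (n + 1)).val < n + 1 := (α.toOrderHom l : Fin (n + 1)).isLt
    have h₂ : i.val < n + 1 := i.isLt
    have hl'' : (α.toOrderHom l : Fin (n + 1)).val < n := by omega
    rw [comp_apply_val, comp_apply_val, vtx_val, vtx_val, if_pos hl'', if_pos hl'']

/-- The relation on `Hom(A, E_k)`: the images, and the faces of dimension less than `n`, are equal;
the faces of dimension `n` are related by higher morphisms. -/
structure HigherRel (n : ℕ) (g : E ⟶ X) (k : ℕ) {A : C} (a b : A ⟶ E _⦋k⦌) : Prop where
  base : a ≫ g.app (op ⦋k⦌) = b ≫ g.app (op ⦋k⦌)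
  low : ∀ j, j < n → ∀ θ : (⦋j⦌ : SimplexCategory) ⟶ ⦋k⦌, a ≫ E.map θ.op = b ≫ E.map θ.op
  mid : ∀ θ : (⦋n⦌ : SimplexCategory) ⟶ ⦋k⦌, HMRel n g (a ≫ E.map θ.op) (b ≫ E.map θ.op)

/-- The relation on `Hom(A, U_k)`: the images, and the faces of dimension less than `n`, are
equal. -/
structure LowRel (n : ℕ) (f : U ⟶ X) (k : ℕ) {A : C} (a b : A ⟶ U _⦋k⦌) : Prop where
  base : a ≫ f.app (op ⦋k⦌) = b ≫ f.app (op ⦋k⦌)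
  low : ∀ j, j < n → ∀ θ : (⦋j⦌ : SimplexCategory) ⟶ ⦋k⦌, a ≫ U.map θ.op = b ≫ U.map θ.op

/-- An n-dimensional operator on an n-simplex either misses a vertex, where the two simplices agree,
or is the identity. So in dimension n `HigherRel` adds nothing to `HMRel`. -/
lemma HMRel.higherRel {a b : A ⟶ E _⦋n⦌} (h : HMRel n g a b) : HigherRel n g n a b where
  base := h.sameLow.base
  low j hj θ := h.bdry θ (by
    by_contra h'
    have : Fintype.card (Fin (n + 1)) ≤ Fintype.card (Fin (j + 1)) := by
      refine Fintype.card_le_of_surjective θ.toOrderHom fun i => ?_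
      by_contra hi
      exact h' ⟨i, fun h' => hi ((mem_verts _ _).1 h')⟩
    simp only [Fintype.card_fin] at this
    omega)
  mid θ := by
    by_cases hθ : BdryP (verts θ)
    · rw [h.bdry θ hθ]
      exact HMRel.refl _ _
    · rw [eq_id_of_not_bdryP θ hθ, op_id, E.map_id]
      simpa using h

variable {k : ℕ}

lemma HigherRel.hmRel {a b : A ⟶ E _⦋n⦌} (h : HigherRel n g n a b) : HMRel n g a b := by
  have := h.mid (𝟙 _)
  rw [op_id, E.map_id] at this
  simpa using this

lemma HigherRel.refl (g : E ⟶ X) (a : A ⟶ E _⦋k⦌) : HigherRel n g k a a :=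
  ⟨rfl, fun _ _ _ => rfl, fun _ => HMRel.refl _ _⟩

lemma HigherRel.eq_of_lt {a b : A ⟶ E _⦋k⦌} (h : HigherRel n g k a b) (hk : k < n) : a = b := by
  have := h.low k hk (𝟙 _)
  rw [op_id, E.map_id] at this
  simpa using this

lemma HigherRel.comp {a b : A ⟶ E _⦋k⦌} (h : HigherRel n g k a b) {k' : ℕ}
    (θ : (⦋k'⦌ : SimplexCategory) ⟶ ⦋k⦌) :
    HigherRel n g k' (a ≫ E.map θ.op) (b ≫ E.map θ.op) where
  base := by
    rw [Category.assoc, Category.assoc, g.naturality, ← Category.assoc, h.base, Category.assoc]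
  low j hj γ := by
    rw [Category.assoc, Category.assoc, map_op_comp]
    exact h.low j hj _
  mid γ := by
    rw [Category.assoc, Category.assoc, map_op_comp]
    exact h.mid _

lemma HigherRel.pre {a b : A ⟶ E _⦋k⦌} (h : HigherRel n g k a b) {B : C} (c : B ⟶ A) :
    HigherRel n g k (c ≫ a) (c ≫ b) where
  base := by rw [Category.assoc, h.base, Category.assoc]
  low j hj γ := by rw [Category.assoc, h.low j hj, Category.assoc]
  mid γ := by
    rw [Category.assoc, Category.assoc]
    exact (h.mid γ).pre c

lemma LowRel.comp {f : U ⟶ X} {a b : A ⟶ U _⦋k⦌} (h : LowRel n f k a b) {k' : ℕ}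
    (θ : (⦋k'⦌ : SimplexCategory) ⟶ ⦋k⦌) :
    LowRel n f k' (a ≫ U.map θ.op) (b ≫ U.map θ.op) where
  base := by
    rw [Category.assoc, Category.assoc, f.naturality, ← Category.assoc, h.base, Category.assoc]
  low j hj γ := by
    rw [Category.assoc, Category.assoc, map_op_comp]
    exact h.low j hj _

lemma LowRel.eq_of_lt {f : U ⟶ X} {a b : A ⟶ U _⦋k⦌} (h : LowRel n f k a b) (hk : k < n) :
    a = b := by
  have := h.low k hk (𝟙 _)
  rw [op_id, U.map_id] at this
  simpa using this

lemma LowRel.bdry {f : U ⟶ X} {a b : A ⟶ U _⦋n⦌} (h : LowRel n f n a b) {m : SimplexCategory}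
    (α : m ⟶ ⦋n⦌) (hα : BdryP (verts α)) : a ≫ U.map α.op = b ≫ U.map α.op := by
  obtain ⟨j, hj, β, θ, rfl⟩ := exists_factor_of_bdryP α hα
  rw [← map_op_comp, ← Category.assoc, ← Category.assoc, h.low j hj]

variable {p : E ⟶ U} {f : U ⟶ X}

lemma HigherRel.symm (H : UniqueFillings n p f) {a b : A ⟶ E _⦋k⦌}
    (h : HigherRel n (p ≫ f) k a b) : HigherRel n (p ≫ f) k b a :=
  ⟨h.base.symm, fun j hj θ => (h.low j hj θ).symm, fun θ => (h.mid θ).symm H⟩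

lemma HigherRel.trans (H : UniqueFillings n p f) {a b c : A ⟶ E _⦋k⦌}
    (h : HigherRel n (p ≫ f) k a b) (h' : HigherRel n (p ≫ f) k b c) :
    HigherRel n (p ≫ f) k a c :=
  ⟨h.base.trans h'.base, fun j hj θ => (h.low j hj θ).trans (h'.low j hj θ),
    fun θ => (h.mid θ).trans H (h'.mid θ)⟩

lemma HigherRel.lowRel {a b : A ⟶ E _⦋k⦌} (h : HigherRel n (p ≫ f) k a b) :
    LowRel n f k (a ≫ p.app (op ⦋k⦌)) (b ≫ p.app (op ⦋k⦌)) where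
  base := by
    rw [Category.assoc, Category.assoc]
    exact h.base
  low j hj θ := by
    rw [Category.assoc, Category.assoc, ← p.naturality, ← Category.assoc, h.low j hj,
      Category.assoc]

/-- Related simplices with the same image in `U` are equal. -/
lemma HigherRel.eq_of_map_eq (H : UniqueFillings n p f) {a b : A ⟶ E _⦋k⦌}
    (h : HigherRel n (p ≫ f) k a b) (h' : a ≫ p.app (op ⦋k⦌) = b ≫ p.app (op ⦋k⦌)) : a = b := by
  induction k with
  | zero =>
    rcases Nat.eq_zero_or_pos n with rfl | hn
    · exact key H h h'
    · exact h.eq_of_lt hn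
  | succ k ih =>
    rcases lt_trichotomy (k + 1) n with hk | rfl | hk
    · exact h.eq_of_lt hk
    · exact key H h h'
    -- Above dimension n the faces agree by induction, and simplices with the same horn and the same
    -- image in U are equal.
    · refine H.pInj k (by omega) 0 _ _ (fun j _ => ih (h.comp _) ?_) h'
      rw [Category.assoc, Category.assoc, SimplicialObject.δ_naturality, ← Category.assoc, h',
        Category.assoc]
where
  key {n : ℕ} {a b : A ⟶ E _⦋n⦌} (H : UniqueFillings n p f)
      (h : HigherRel n (p ≫ f) n a b) (h' : a ≫ p.app (op ⦋n⦌) = b ≫ p.app (op ⦋n⦌)) : a = b := by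
    obtain ⟨x, hx, h₀, h₁⟩ := h.hmRel
    have hs := IsHM.degenerate (p ≫ f) 1 a
    have hlow : ∀ j : Fin (n + 2), j ≠ (Fin.natAdd n (0 : Fin 2) : Fin (n + 2)) →
        x ≫ E.δ j = (a ≫ E.map (collapse n 1).op) ≫ E.δ j := by
      intro j hj
      by_cases hjn : j.val < n
      · exact (hx.low _ (missesLow_δ n j hjn)).trans (hs.low _ (missesLow_δ n j hjn)).symm
      · obtain rfl : j = (Fin.natAdd n (1 : Fin 2) : Fin (n + 2)) := by
          refine Fin.ext ?_
          have : j.val ≠ n := fun h => hj (Fin.ext h)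
          simp only [Fin.val_natAdd]
          change _ = n + 1
          omega
        rw [SimplicialObject.δ, δ_eq_vtx_zero, degenerate_vtx, h₀]
    -- The higher morphism x from a to b agrees with the degenerate one on all faces except possibly
    -- the face b. In U that face agrees too, because a and b have the same image; so the images in
    -- U coincide by uniqueness for f, and then x is degenerate by uniqueness for p.
    have hxs : x = a ≫ E.map (collapse n 1).op := by
      refine H.pInj n le_rfl _ _ _ hlow (H.fInj n le_rfl _ _ (fun j => ?_) ?_)
      · rw [Category.assoc, Category.assoc, ← SimplicialObject.δ_naturality, ← Category.assoc,
          ← Category.assoc]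
        by_cases hj : j = (Fin.natAdd n (0 : Fin 2) : Fin (n + 2))
        · subst hj
          rw [SimplicialObject.δ, δ_eq_vtx_one, degenerate_vtx, h₁, h']
        · rw [hlow j hj]
      · rw [Category.assoc, Category.assoc]
        exact hx.base.trans hs.base.symm
    rw [← h₁, hxs, degenerate_vtx]

/-- Transport of `n`-simplices. -/
lemma exists_transport_self (H : UniqueFillings n p f) (a : A ⟶ E _⦋n⦌) (u : A ⟶ U _⦋n⦌)
    (h : LowRel n f n (a ≫ p.app (op ⦋n⦌)) u) :
    ∃ b : A ⟶ E _⦋n⦌, HMRel n (p ≫ f) a b ∧ b ≫ p.app (op ⦋n⦌) = u := by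
  -- Deleting vertex n from [n+1] leaves the first n vertices and the vertex 1 of the join factor,
  -- so the face `j₀` is the target of the homotopy.
  let j₀ : Fin (n + 2) := Fin.natAdd n (0 : Fin 2)
  let s : A ⟶ E _⦋n + 1⦌ := a ≫ E.map (collapse n 1).op
  have hj₀ : SimplexCategory.δ j₀ ≫ collapse n 1 = 𝟙 _ := by
    rw [δ_eq_vtx_one, vtx_comp_collapse]
  have hs₀ : s ≫ E.δ j₀ = a := by
    rw [SimplicialObject.δ, Category.assoc, map_op_comp, hj₀]
    simp
  have hsp : s ≫ p.app (op ⦋n + 1⦌) = a ≫ p.app (op ⦋n⦌) ≫ U.map (collapse n 1).op := by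
    rw [Category.assoc, p.naturality]
  -- Homotopy in U: the boundary of the degenerate simplex on p(a), with its target replaced by u,
  -- is filled over the degenerate simplex in X.
  obtain ⟨z, hz, hzf⟩ := H.fFill n le_rfl
    (Function.update (fun j => (s ≫ p.app (op ⦋n + 1⦌)) ≫ U.δ j) j₀ u)
    (s ≫ (p ≫ f).app (op ⦋n + 1⦌))
    (faceCompat_update _ _ _ fun {m} β j _ hj hβ => by
      have hβ' : BdryP (verts β) := by
        obtain ⟨i, rfl⟩ := Fin.exists_succAbove_eq hj
        refine ⟨i, fun hi => hβ ?_⟩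
        obtain ⟨l, rfl⟩ := (mem_verts _ _).1 hi
        exact (mem_verts _ _).2 ⟨l, rfl⟩
      rw [← h.bdry β hβ', hsp]
      simp only [Category.assoc]
      rw [map_op_comp, Category.assoc, hj₀, Category.comp_id]) (fun j _ => by
      by_cases hj : j = j₀
      · subst hj
        rw [Function.update_self, ← h.base, Category.assoc, Category.assoc,
          ← SimplicialObject.δ_naturality, ← Category.assoc s, hs₀]
        rfl
      · rw [Function.update_of_ne hj, NatTrans.comp_app]
        simp only [Category.assoc]
        rw [SimplicialObject.δ_naturality])
  have hzn : ∀ j, j ≠ j₀ → z ≫ U.δ j = (s ≫ p.app (op ⦋n + 1⦌)) ≫ U.δ j := fun j hj => by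
    rw [hz j trivial, Function.update_of_ne hj]
  -- Lift of the homotopy to E, starting from the horn of the degenerate simplex on a; its missing
  -- face is the transported simplex.
  obtain ⟨x, hx, hxz⟩ := H.pFill n le_rfl j₀ (fun j => s ≫ E.δ j) z
    (fun j j' _ _ m β β' e => by
      simp only [SimplicialObject.δ]
      rw [Category.assoc s, Category.assoc s, map_op_comp, map_op_comp, e])
    (fun j hj => by
      rw [hzn j hj, Category.assoc s, Category.assoc s, SimplicialObject.δ_naturality])
  have h₁ : (Fin.natAdd n (1 : Fin 2) : Fin (n + 2)) ≠ j₀ := fun h => by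
    have := Fin.natAdd_injective _ _ h
    exact absurd this (by decide)
  refine ⟨x ≫ E.map (vtx n 1 1).op, ⟨x, ⟨fun {m} α hα => ?_, ?_⟩, ?_, rfl⟩, ?_⟩
  · obtain ⟨i, hi, hi'⟩ := hα
    obtain ⟨β, rfl⟩ := exists_comp_δ (k := n) α i hi'
    have hij : i ≠ j₀ := fun h => by
      have : i.val = n := congrArg Fin.val h
      omega
    rw [← map_op_comp, ← Category.assoc]
    refine (congrArg (· ≫ E.map β.op) (hx i hij)).trans ?_
    simp only [Category.assoc, s, SimplicialObject.δ]
    rw [map_op_comp, map_op_comp, Category.assoc]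
  · rw [NatTrans.comp_app, ← Category.assoc, hxz, hzf, Category.assoc]
    rfl
  · rw [← δ_eq_vtx_zero]
    refine (hx _ h₁).trans ?_
    rw [SimplicialObject.δ, δ_eq_vtx_zero]
    exact degenerate_vtx 1 a 0
  · rw [← δ_eq_vtx_one, Category.assoc, p.naturality, ← Category.assoc, hxz]
    exact (hz j₀ trivial).trans (Function.update_self _ _ _)

/-- Replacement of one face of an `(n + 1)`-simplex by a related one. -/
lemma exists_replace_face (H : UniqueFillings n p f) (e : A ⟶ E _⦋n + 1⦌) (j : Fin (n + 2))
    (b : A ⟶ E _⦋n⦌) (h : HMRel n (p ≫ f) (e ≫ E.δ j) b) :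
    ∃ e' : A ⟶ E _⦋n + 1⦌,
      e' ≫ (p ≫ f).app (op ⦋n + 1⦌) = e ≫ (p ≫ f).app (op ⦋n + 1⦌) ∧
      e' ≫ E.δ j = b ∧ ∀ l, l ≠ j → e' ≫ E.δ l = e ≫ E.δ l := by
  obtain ⟨x, hx, hx₀, hx₁⟩ := h
  -- Here t is the last vertex of the j-th face of e. Doubling this vertex makes the face J of `e ≫
  -- E.σ t` the degenerate higher morphism on that face, which is where `x` can be inserted.
  obtain ⟨t, ht⟩ : ∃ t : Fin (n + 2), t.val = if j.val = n + 1 then n else n + 1 :=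
    ⟨⟨if j.val = n + 1 then n else n + 1, by split_ifs <;> omega⟩, rfl⟩
  let J : Fin (n + 3) := t.castSucc.succAbove j
  have hJ : J.val = if j.val = n + 1 then n + 2 else j.val := by
    have := δ_val t.castSucc j
    rw [Fin.val_castSucc, ht] at this
    refine this.trans ?_
    split_ifs <;> omega
  have σ_val : ∀ i : Fin (n + 3), ((SimplexCategory.σ t).toOrderHom i : Fin (n + 2)).val =
      if i.val ≤ t.val then i.val else i.val - 1 := fun i => by
    change (t.predAbove i).val = _
    simp only [Fin.predAbove, Fin.lt_def, Fin.val_castSucc]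
    split_ifs <;> simp <;> omega
  have HI₁ : SimplexCategory.δ J ≫ SimplexCategory.σ t = collapse n 1 ≫ SimplexCategory.δ j := by
    refine hom_ext_val fun (i : Fin (n + 2)) => ?_
    rw [comp_apply_val, comp_apply_val, σ_val, δ_val, δ_val, collapse_val, ht, hJ]
    split_ifs <;> omega
  have HI₃ : SimplexCategory.δ j ≫ SimplexCategory.δ t.castSucc = vtx n 1 1 ≫ SimplexCategory.δ J := by
    refine hom_ext_val fun (i : Fin (n + 1)) => ?_
    rw [comp_apply_val, comp_apply_val, δ_val, δ_val, δ_val, vtx_val, Fin.val_castSucc, ht, hJ]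
    split_ifs <;> simp only [Fin.val_one] at * <;> omega
  let w : A ⟶ E _⦋n + 2⦌ := e ≫ E.σ t
  have hwJ : w ≫ E.δ J = (e ≫ E.δ j) ≫ E.map (collapse n 1).op := by
    simp only [w, SimplicialObject.δ, SimplicialObject.σ, Category.assoc]
    rw [map_op_comp, map_op_comp, HI₁]
  -- The face t of the degenerate simplex is e. After `x` replaces the face J, the horn without the
  -- face t is filled, and the new face t is the required modification of e.
  obtain ⟨y, hy, hyg⟩ := H.gFill (n + 1) le_rfl t.castSucc
    (Function.update (fun l => w ≫ E.δ l) J x) (w ≫ (p ≫ f).app (op ⦋n + 2⦌))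
    (faceCompat_update _ _ _ fun {m} β l hl hlJ hβ => by
      obtain ⟨l', rfl⟩ := Fin.exists_succAbove_eq hlJ
      have hl' : l' ∉ verts β := by
        intro hl'
        obtain ⟨i, rfl⟩ := (mem_verts _ _).1 hl'
        exact hβ ((mem_verts _ _).2 ⟨i, rfl⟩)
      have hln : l'.val ≠ n := by
        intro h₁
        refine hl (Fin.ext ?_)
        refine (δ_val J l').trans ?_
        rw [Fin.val_castSucc, ht, hJ, h₁]
        split_ifs <;> omega
      have hw : w ≫ E.map (β ≫ SimplexCategory.δ J).op =
          (e ≫ E.δ j) ≫ E.map (β ≫ collapse n 1).op := by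
        rw [← map_op_comp, ← Category.assoc]
        refine (congrArg (· ≫ E.map β.op) hwJ).trans ?_
        rw [Category.assoc, map_op_comp]
      rw [hw]
      by_cases hln' : l'.val < n
      · exact hx.low β ⟨l', hln', hl'⟩
      · obtain rfl : l' = (Fin.natAdd n (1 : Fin 2) : Fin (n + 2)) := by
          refine Fin.ext ?_
          change _ = n + 1
          omega
        obtain ⟨γ, rfl⟩ := exists_comp_δ β _ hl'
        rw [← map_op_comp, δ_eq_vtx_zero, Category.assoc γ, vtx_comp_collapse, Category.comp_id,
          ← Category.assoc x, hx₀])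
    (fun l hl => by
      by_cases hlJ : l = J
      · subst hlJ
        rw [Function.update_self]
        refine hx.base.trans ?_
        rw [Category.assoc w, ← SimplicialObject.δ_naturality, ← Category.assoc w, hwJ,
          Category.assoc (e ≫ E.δ j)]
      · rw [Function.update_of_ne hlJ, Category.assoc w, Category.assoc w,
          SimplicialObject.δ_naturality])
  have hδσ : SimplexCategory.δ t.castSucc ≫ SimplexCategory.σ t = 𝟙 _ :=
    SimplexCategory.δ_comp_σ_self
  refine ⟨y ≫ E.δ t.castSucc, ?_, ?_, fun l hl => ?_⟩
  · rw [Category.assoc, SimplicialObject.δ_naturality, ← Category.assoc, hyg, Category.assoc,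
      ← SimplicialObject.δ_naturality]
    simp only [w, Category.assoc]
    rw [SimplicialObject.δ_comp_σ_self_assoc]
  · rw [Category.assoc, SimplicialObject.δ, SimplicialObject.δ, map_op_comp, HI₃, ← map_op_comp,
      ← Category.assoc]
    refine (congrArg (· ≫ E.map _) ((hy J (Fin.succAbove_ne _ _)).trans
      (Function.update_self _ _ _))).trans hx₁
  · have hL : t.castSucc.succAbove l ∉ verts (SimplexCategory.δ l ≫ SimplexCategory.δ t.castSucc) := by
      intro h'
      obtain ⟨i, hi⟩ := (mem_verts _ _).1 h'
      exact Fin.succAbove_ne l i (Fin.succAbove_right_injective hi)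
    obtain ⟨γ, hγ⟩ := exists_comp_δ _ _ hL
    rw [Category.assoc, SimplicialObject.δ, SimplicialObject.δ, map_op_comp, ← hγ, ← map_op_comp,
      ← Category.assoc]
    refine (congrArg (· ≫ E.map γ.op) ((hy _ (Fin.succAbove_ne _ _)).trans
      (Function.update_of_ne (fun h' => hl (Fin.succAbove_right_injective h')) _ _))).trans ?_
    simp only [w, SimplicialObject.δ, SimplicialObject.σ, Category.assoc]
    rw [map_op_comp, hγ, map_op_comp, Category.assoc, hδσ, Category.comp_id]

/-- Each replacement leaves the other faces unchanged, so the faces can be replaced one after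
another. -/
lemma exists_replace_faces (H : UniqueFillings n p f) (e : A ⟶ E _⦋n + 1⦌)
    (b : Fin (n + 2) → (A ⟶ E _⦋n⦌)) (h : ∀ j, HMRel n (p ≫ f) (e ≫ E.δ j) (b j)) :
    ∃ e' : A ⟶ E _⦋n + 1⦌,
      e' ≫ (p ≫ f).app (op ⦋n + 1⦌) = e ≫ (p ≫ f).app (op ⦋n + 1⦌) ∧
      ∀ j, e' ≫ E.δ j = b j := by
  have key : ∀ S : Finset (Fin (n + 2)), ∃ e' : A ⟶ E _⦋n + 1⦌,
      e' ≫ (p ≫ f).app (op ⦋n + 1⦌) = e ≫ (p ≫ f).app (op ⦋n + 1⦌) ∧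
      (∀ j, j ∈ S → e' ≫ E.δ j = b j) ∧ ∀ j, j ∉ S → e' ≫ E.δ j = e ≫ E.δ j := by
    intro S
    induction S using Finset.induction_on with
    | empty => exact ⟨e, rfl, fun j hj => absurd hj (Finset.notMem_empty j), fun _ _ => rfl⟩
    | insert j S hj ih =>
      obtain ⟨e', h₁, h₂, h₃⟩ := ih
      obtain ⟨e'', h₁', h₂', h₃'⟩ := exists_replace_face H e' j (b j) (by rw [h₃ j hj]; exact h j)
      refine ⟨e'', h₁'.trans h₁, fun l hl => ?_, fun l hl => ?_⟩
      · rcases Finset.mem_insert.1 hl with rfl | hl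
        · exact h₂'
        · rw [h₃' l (fun h => hj (h ▸ hl)), h₂ l hl]
      · rw [Finset.mem_insert, not_or] at hl
        rw [h₃' l hl.1, h₃ l hl.2]
  obtain ⟨e', h₁, h₂, -⟩ := key Finset.univ
  exact ⟨e', h₁, fun j => h₂ j (Finset.mem_univ j)⟩

/-- The relation only sees simplices of dimension at most n, so it can be tested on any collection
of faces that contains all of these. -/
lemma HigherRel.of_faces {a b : A ⟶ E _⦋k + 1⦌} (Q : Fin (k + 2) → Prop)
    (hQ : ∀ j, j ≤ n → ∀ θ : (⦋j⦌ : SimplexCategory) ⟶ ⦋k + 1⦌, ∃ l, Q l ∧ l ∉ verts θ)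
    (hb : a ≫ g.app (op ⦋k + 1⦌) = b ≫ g.app (op ⦋k + 1⦌))
    (h : ∀ l, Q l → HigherRel n g k (a ≫ E.δ l) (b ≫ E.δ l)) : HigherRel n g (k + 1) a b where
  base := hb
  low j hj θ := by
    obtain ⟨l, hl, hl'⟩ := hQ j hj.le θ
    obtain ⟨γ, rfl⟩ := exists_comp_δ θ l hl'
    rw [← map_op_comp, ← Category.assoc, ← Category.assoc]
    exact (h l hl).low j hj γ
  mid θ := by
    obtain ⟨l, hl, hl'⟩ := hQ n le_rfl θ
    obtain ⟨γ, rfl⟩ := exists_comp_δ θ l hl'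
    rw [← map_op_comp, ← Category.assoc, ← Category.assoc]
    exact (h l hl).mid γ

/-- Transport of simplices along the relation on `U`. -/
theorem exists_transport (H : UniqueFillings n p f) (a : A ⟶ E _⦋k⦌) (u : A ⟶ U _⦋k⦌)
    (h : LowRel n f k (a ≫ p.app (op ⦋k⦌)) u) :
    ∃ b : A ⟶ E _⦋k⦌, HigherRel n (p ≫ f) k a b ∧ b ≫ p.app (op ⦋k⦌) = u := by
  have base : ∀ {k : ℕ} (a : A ⟶ E _⦋k⦌) (u : A ⟶ U _⦋k⦌),
      LowRel n f k (a ≫ p.app (op ⦋k⦌)) u → k ≤ n →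
      ∃ b : A ⟶ E _⦋k⦌, HigherRel n (p ≫ f) k a b ∧ b ≫ p.app (op ⦋k⦌) = u := by
    intro k a u h hk
    rcases hk.lt_or_eq with hk | rfl
    · exact ⟨a, HigherRel.refl _ _, h.eq_of_lt hk⟩
    · obtain ⟨b, hb, hb'⟩ := exists_transport_self H a u h
      exact ⟨b, hb.higherRel, hb'⟩
  induction k with
  | zero => exact base a u h (Nat.zero_le n)
  | succ k ih =>
    by_cases hk : k + 1 ≤ n
    · exact base a u h hk
    have hface : ∀ l : Fin (k + 2), ∃ b : A ⟶ E _⦋k⦌, HigherRel n (p ≫ f) k (a ≫ E.δ l) b ∧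
        b ≫ p.app (op ⦋k⦌) = u ≫ U.δ l := fun l => by
      refine ih _ _ ?_
      rw [Category.assoc, SimplicialObject.δ_naturality, ← Category.assoc]
      exact h.comp _
    choose b hb hbp using hface
    by_cases hkn : k = n
    · subst hkn
      obtain ⟨e, he, he'⟩ := exists_replace_faces H a b fun l => (hb l).hmRel
      refine ⟨e, HigherRel.of_faces (fun _ => True) (fun j hj θ => ?_) he.symm
        (fun l _ => by rw [he' l]; exact hb l), H.fInj k le_rfl _ _ (fun l => ?_) ?_⟩
      · by_contra! h'
        have h₁ := card_verts_le θ
        rw [Finset.eq_univ_iff_forall.2 fun l => h' l trivial, Finset.card_univ,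
          Fintype.card_fin] at h₁
        change _ ≤ j + 1 at h₁
        omega
      · rw [Category.assoc, ← SimplicialObject.δ_naturality, ← Category.assoc, he', hbp]
      · rw [← h.base, Category.assoc, Category.assoc]
        exact he
    -- Above dimension n + 1 the transported faces are compatible, being related and having equal
    -- images in U. Filling a horn for p then suffices, since the horn contains all simplices of
    -- dimension at most n.
    · obtain ⟨e, he, hep⟩ := H.pFill k (by omega) 0 b u (fun j j' _ _ m β β' eβ => by
        induction m using SimplexCategory.rec with | _ m =>
        have h₁ := (hb j).comp β
        have h₂ := (hb j').comp β'
        rw [Category.assoc, SimplicialObject.δ, map_op_comp] at h₁ h₂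
        rw [← eβ] at h₂
        refine ((h₁.symm H).trans H h₂).eq_of_map_eq H ?_
        rw [Category.assoc, Category.assoc, p.naturality, p.naturality, ← Category.assoc,
          ← Category.assoc, hbp, hbp, Category.assoc, Category.assoc, SimplicialObject.δ,
          SimplicialObject.δ, map_op_comp, map_op_comp, eβ]) (fun j _ => hbp j)
      refine ⟨e, HigherRel.of_faces (fun l => l ≠ 0) (fun j hj θ => ?_) ?_
        (fun l hl => by rw [he l hl]; exact hb l), hep⟩
      · by_contra! h'
        have h₀ : Finset.univ.erase (0 : Fin (k + 2)) ⊆ verts θ := fun l hl =>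
          h' l (Finset.ne_of_mem_erase hl)
        have h₁ := (Finset.card_le_card h₀).trans (card_verts_le θ)
        rw [Finset.card_erase_of_mem (Finset.mem_univ _), Finset.card_univ, Fintype.card_fin] at h₁
        change _ ≤ j + 1 at h₁
        omega
      · rw [NatTrans.comp_app, ← Category.assoc, ← Category.assoc, hep, h.base]

end Transport


/-! ### Products and pullbacks in terms of points -/

section Points

lemma isPullback_of_existsUnique {P X Y Z : C} {fst : P ⟶ X} {snd : P ⟶ Y} {f : X ⟶ Z} {g : Y ⟶ Z}
    (w : fst ≫ f = snd ≫ g) (h : ∀ (A : C) (x : A ⟶ X) (y : A ⟶ Y), x ≫ f = y ≫ g →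
      ∃! z : A ⟶ P, z ≫ fst = x ∧ z ≫ snd = y) : IsPullback fst snd f g :=
  ⟨⟨w⟩, ⟨PullbackCone.IsLimit.mk w (fun s => (h _ s.fst s.snd s.condition).choose)
    (fun s => (h _ s.fst s.snd s.condition).choose_spec.1.1)
    (fun s => (h _ s.fst s.snd s.condition).choose_spec.1.2)
    (fun s m h₁ h₂ => (h _ s.fst s.snd s.condition).choose_spec.2 m ⟨h₁, h₂⟩)⟩⟩

lemma IsPullback.existsUnique_lift {P X Y Z : C} {fst : P ⟶ X} {snd : P ⟶ Y} {f : X ⟶ Z}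
    {g : Y ⟶ Z} (h : IsPullback fst snd f g) {A : C} (x : A ⟶ X) (y : A ⟶ Y)
    (hxy : x ≫ f = y ≫ g) : ∃! z : A ⟶ P, z ≫ fst = x ∧ z ≫ snd = y :=
  ⟨h.lift x y hxy, ⟨h.lift_fst _ _ _, h.lift_snd _ _ _⟩, fun z ⟨h₁, h₂⟩ => h.hom_ext
    (by rw [h₁, h.lift_fst]) (by rw [h₂, h.lift_snd])⟩

/-- `P` is the product of `X` and `Y`, in terms of points. -/
def IsProd {P X Y : C} (fst : P ⟶ X) (snd : P ⟶ Y) : Prop :=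
  ∀ (A : C) (x : A ⟶ X) (y : A ⟶ Y), ∃! z : A ⟶ P, z ≫ fst = x ∧ z ≫ snd = y

variable {P X Y : C} {fst : P ⟶ X} {snd : P ⟶ Y}

lemma IsProd.isLimit (h : IsProd fst snd) : Nonempty (IsLimit (BinaryFan.mk fst snd)) :=
  ⟨BinaryFan.isLimitMk (fun s => (h _ s.fst s.snd).choose)
    (fun s => (h _ s.fst s.snd).choose_spec.1.1) (fun s => (h _ s.fst s.snd).choose_spec.1.2)
    (fun s m h₁ h₂ => (h _ s.fst s.snd).choose_spec.2 m ⟨h₁, h₂⟩)⟩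

lemma isProd_of_isLimit (h : Nonempty (IsLimit (BinaryFan.mk fst snd))) : IsProd fst snd := by
  obtain ⟨h⟩ := h
  intro A x y
  refine ⟨h.lift (BinaryFan.mk x y), ⟨h.fac (BinaryFan.mk x y) ⟨.left⟩,
    h.fac (BinaryFan.mk x y) ⟨.right⟩⟩, fun z ⟨h₁, h₂⟩ => ?_⟩
  refine BinaryFan.IsLimit.hom_ext h ?_ ?_
  · exact h₁.trans (h.fac (BinaryFan.mk x y) ⟨.left⟩).symm
  · exact h₂.trans (h.fac (BinaryFan.mk x y) ⟨.right⟩).symm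

lemma IsProd.hom_ext (h : IsProd fst snd) {A : C} {a b : A ⟶ P} (h₁ : a ≫ fst = b ≫ fst)
    (h₂ : a ≫ snd = b ≫ snd) : a = b :=
  (h A (b ≫ fst) (b ≫ snd)).unique ⟨h₁, h₂⟩ ⟨rfl, rfl⟩

variable {W : MorphismProperty C}

lemma exists_isProd (hW : IsCategoryWithCovers W) (X Y : C) :
    ∃ (P : C) (fst : P ⟶ X) (snd : P ⟶ Y), IsProd fst snd := by
  obtain ⟨pt, ⟨hpt⟩, hc⟩ := hW.exists_terminal
  have := hW.hasPullback (hpt.from X) (hpt.from Y) (hc _ _)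
  have h := IsPullback.of_hasPullback (hpt.from X) (hpt.from Y)
  exact ⟨_, _, _, fun A x y => IsPullback.existsUnique_lift h x y (hpt.hom_ext _ _)⟩

lemma IsProd.isCover_fst (hW : IsCategoryWithCovers W) (h : IsProd fst snd) : W fst := by
  obtain ⟨pt, ⟨hpt⟩, hc⟩ := hW.exists_terminal
  exact hW.of_isPullback (isPullback_of_existsUnique (fst := snd) (snd := fst)
    (hpt.hom_ext (snd ≫ hpt.from Y) (fst ≫ hpt.from X)) fun A x y _ => by
      obtain ⟨z, ⟨h₁, h₂⟩, h₃⟩ := h A y x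
      exact ⟨z, ⟨h₂, h₁⟩, fun z' ⟨h₄, h₅⟩ => h₃ z' ⟨h₅, h₄⟩⟩) (hc _ _)

end Points

/-! ### Nerves of equivalence relations -/

section Nerve

/-- `N` is the nerve of the relation `r` on the points of `B`: the points of `N_ℓ` are the families
of `ℓ + 1` pairwise related points. -/
structure IsNerve {B : C} (r : ∀ {A : C}, (A ⟶ B) → (A ⟶ B) → Prop) (N : SimplicialObject C)
    (π : ∀ ℓ : ℕ, Fin (ℓ + 1) → (N _⦋ℓ⦌ ⟶ B)) : Prop where
  map_π : ∀ {ℓ ℓ' : ℕ} (θ : (⦋ℓ⦌ : SimplexCategory) ⟶ ⦋ℓ'⦌) (i : Fin (ℓ + 1)),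
    N.map θ.op ≫ π ℓ i = π ℓ' (θ.toOrderHom i)
  rel : ∀ (ℓ : ℕ) (i j : Fin (ℓ + 1)), r (π ℓ i) (π ℓ j)
  existsUnique : ∀ (ℓ : ℕ) {A : C} (t : Fin (ℓ + 1) → (A ⟶ B)), (∀ i j, r (t i) (t j)) →
    ∃! x : A ⟶ N _⦋ℓ⦌, ∀ i, x ≫ π ℓ i = t i

/-- An equivalence relation on the points of `B` whose first projection is a cover. -/
structure IsCoverRel (W : MorphismProperty C) {B : C}
    (r : ∀ {A : C}, (A ⟶ B) → (A ⟶ B) → Prop) : Prop where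
  refl : ∀ {A : C} (a : A ⟶ B), r a a
  symm : ∀ {A : C} {a b : A ⟶ B}, r a b → r b a
  trans : ∀ {A : C} {a b c : A ⟶ B}, r a b → r b c → r a c
  pre : ∀ {A D : C} {a b : A ⟶ B} (d : D ⟶ A), r a b → r (d ≫ a) (d ≫ b)
  cover : ∀ {A : C} (a : A ⟶ B), ∃ (D : C) (c : D ⟶ A) (b : D ⟶ B), W c ∧ r (c ≫ a) b ∧
    ∀ {A' : C} (x : A' ⟶ A) (y : A' ⟶ B), r (x ≫ a) y → ∃! z : A' ⟶ D, z ≫ c = x ∧ z ≫ b = y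

variable {W : MorphismProperty C} {B : C} {r : ∀ {A : C}, (A ⟶ B) → (A ⟶ B) → Prop}

/-- A longer tuple is a shorter one together with a point related to its first entry; transitivity
supplies the other relations. -/
lemma IsCoverRel.exists_tupleSpace (hr : IsCoverRel W r) (ℓ : ℕ) :
    ∃ (N : C) (π : Fin (ℓ + 1) → (N ⟶ B)), (∀ i j, r (π i) (π j)) ∧
      ∀ {A : C} (t : Fin (ℓ + 1) → (A ⟶ B)), (∀ i j, r (t i) (t j)) →
        ∃! x : A ⟶ N, ∀ i, x ≫ π i = t i := by
  induction ℓ with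
  | zero =>
    refine ⟨B, fun _ => 𝟙 B, fun _ _ => hr.refl _, fun t _ => ⟨t 0, fun i => ?_, fun x hx => ?_⟩⟩
    · rw [Category.comp_id, Fin.eq_zero i]
    · rw [← hx 0, Category.comp_id]
  | succ ℓ ih =>
    obtain ⟨N, π, hπ, u⟩ := ih
    obtain ⟨D, c, b, -, hb, ub⟩ := hr.cover (π 0)
    have h₀ : ∀ i, r b (c ≫ π i) := fun i => hr.trans (hr.symm hb) (hr.pre c (hπ 0 i))
    refine ⟨D, Fin.cons b fun i => c ≫ π i, fun i j => ?_, fun {A} t ht => ?_⟩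
    · refine Fin.cases ?_ (fun i => ?_) i <;> refine Fin.cases ?_ (fun j => ?_) j
      · exact hr.refl _
      · exact h₀ j
      · exact hr.symm (h₀ i)
      · exact hr.pre c (hπ i j)
    · obtain ⟨x, hx, ux⟩ := u (fun i => t i.succ) fun i j => ht _ _
      obtain ⟨z, ⟨hz, hz'⟩, uz⟩ := ub x (t 0) (by rw [hx]; exact ht _ _)
      refine ⟨z, fun i => ?_, fun z' hz' => uz z' ⟨ux _ fun i => ?_, hz' 0⟩⟩
      · refine Fin.cases ?_ (fun i => ?_) i
        · exact hz'
        · rw [Fin.cons_succ, ← Category.assoc, hz, hx]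
      · rw [Category.assoc]
        exact hz' i.succ

lemma IsCoverRel.exists_isNerve (hr : IsCoverRel W r) :
    ∃ (N : SimplicialObject C) (π : ∀ ℓ : ℕ, Fin (ℓ + 1) → (N _⦋ℓ⦌ ⟶ B)), IsNerve r N π := by
  choose N π hπ u using fun ℓ => hr.exists_tupleSpace ℓ
  have hext : ∀ {ℓ : ℕ} {A : C} {x y : A ⟶ N ℓ}, (∀ i, x ≫ π ℓ i = y ≫ π ℓ i) → x = y :=
    fun {ℓ A x y} h => (u ℓ (fun i => y ≫ π ℓ i) fun i j => hr.pre y (hπ ℓ i j)).unique h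
      fun _ => rfl
  choose L hL using fun {ℓ ℓ' : ℕ} (θ : (⦋ℓ⦌ : SimplexCategory) ⟶ ⦋ℓ'⦌) =>
    (u ℓ (fun i => π ℓ' (θ.toOrderHom i)) fun i j => hπ ℓ' _ _).exists
  exact ⟨{ obj := fun m => N m.unop.len
           map := fun θ => L θ.unop
           map_id := fun m => hext fun i => by
             rw [hL, Category.id_comp]
             rfl
           map_comp := fun θ η => hext fun i => by
             rw [hL, Category.assoc, hL, hL]
             rfl }, π, ⟨fun θ i => hL θ i, hπ, fun ℓ => u ℓ⟩⟩

variable {N : SimplicialObject C} {π : ∀ ℓ : ℕ, Fin (ℓ + 1) → (N _⦋ℓ⦌ ⟶ B)}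

lemma IsNerve.hom_ext (h : IsNerve r N π) (hr : IsCoverRel W r) {ℓ : ℕ} {A : C}
    {x y : A ⟶ N _⦋ℓ⦌} (hxy : ∀ i, x ≫ π ℓ i = y ≫ π ℓ i) : x = y :=
  (h.existsUnique ℓ (fun i => y ≫ π ℓ i) fun i j => hr.pre y (h.rel ℓ i j)).unique hxy fun _ => rfl

/-- The map from `[0]` to `[k]` with the given image. -/
def pointHom {k : ℕ} (i : Fin (k + 1)) : (⦋0⦌ : SimplexCategory) ⟶ ⦋k⦌ :=
  SimplexCategory.const ⦋0⦌ ⦋k⦌ i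

lemma verts_pointHom {k : ℕ} (i : Fin (k + 1)) : verts (pointHom i) = {i} := by
  ext j
  rw [mem_verts, Finset.mem_singleton]
  exact ⟨fun ⟨_, h⟩ => h.symm, fun h => ⟨0, h.symm⟩⟩

lemma IsNerve.map_pointHom (h : IsNerve r N π) {k : ℕ} (i : Fin (k + 1)) :
    N.map (pointHom i).op ≫ π 0 0 = π k i :=
  h.map_π (pointHom i) 0

lemma IsNerve.val_π (h : IsNerve r N π) {k : ℕ} {P : Finset (Fin (k + 1)) → Prop} {A : C}
    (y : Fam P N A) {m : ℕ} (α : (⦋m⦌ : SimplexCategory) ⟶ ⦋k⦌) (hα : P (verts α)) (l : Fin (m + 1))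
    (hl : P (verts (pointHom (α.toOrderHom l : Fin (k + 1))))) :
    y.val α hα ≫ π m l = y.val (pointHom (α.toOrderHom l : Fin (k + 1))) hl ≫ π 0 0 := by
  have e : pointHom (α.toOrderHom l : Fin (k + 1)) = pointHom l ≫ α := by
    ext i : 3
    rfl
  rw [y.val_congr e hl (e ▸ hl), y.nat, Category.assoc, h.map_pointHom]

/-- A simplex of the nerve is determined by its vertices, so a family is determined by its values at
vertices. -/
lemma IsNerve.fam_ext (h : IsNerve r N π) (hr : IsCoverRel W r) {k : ℕ}
    {P : Finset (Fin (k + 1)) → Prop} (hP : IsLower P) {A : C} {y y' : Fam P N A}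
    (hy : ∀ i (hi : P (verts (pointHom i))),
      y.val (pointHom i) hi ≫ π 0 0 = y'.val (pointHom i) hi ≫ π 0 0) : y = y' := by
  refine Fam.ext' fun {m} α hα => ?_
  induction m using SimplexCategory.rec with | _ m =>
  refine h.hom_ext hr fun l => ?_
  have hl : P (verts (pointHom (α.toOrderHom l : Fin (k + 1)))) := by
    refine hP _ _ (verts_nonempty _) ?_ hα
    rw [verts_pointHom, Finset.singleton_subset_iff]
    exact (mem_verts _ _).2 ⟨l, rfl⟩
  rw [h.val_π y α hα l hl, h.val_π y' α hα l hl, hy]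

lemma IsNerve.map_ofSimplex_val (h : IsNerve r N π) {k : ℕ} {P : Finset (Fin (k + 1)) → Prop}
    {A : C} (x : A ⟶ N _⦋k⦌) (i : Fin (k + 1)) (hi : P (verts (pointHom i))) :
    (Fam.ofSimplex P x).val (pointHom i) hi ≫ π 0 0 = x ≫ π k i := by
  change (x ≫ N.map _) ≫ _ = _
  rw [Category.assoc, h.map_pointHom]

lemma absFam_map_ofSimplex {X : SimplicialObject C} {k : ℕ} {P : Finset (Fin (k + 1)) → Prop}
    {A D : C} (a : A ⟶ D) (x : D ⟶ X _⦋k⦌) :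
    (absFam P X).map a.op (Fam.ofSimplex P x) = Fam.ofSimplex P (a ≫ x) :=
  Fam.ext' fun _ _ => (Category.assoc _ _ _).symm

/-- For k = 1 the horn is a point and the horn map is a projection of the relation, a cover. For k ≥
2 the horn contains all vertices and all edges at the vertex i, so its vertices are pairwise related
and span a unique simplex. -/
lemma IsNerve.isLieGroupoid (hW : IsCategoryWithCovers W) (hr : IsCoverRel W r)
    (h : IsNerve r N π) : IsLieGroupoid W 1 N := by
  have := hW.isMultiplicative
  intro k i hk
  rw [absLimit_iff (isVertexSubcomplex_horn i)]
  obtain rfl | hk : k = 1 ∨ 2 ≤ k := by omega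
  · suffices MapToLimit (absFam (HornP i) N) (A := N _⦋1⦌) (Fam.ofSimplex (HornP i) (𝟙 _))
        (fun l => W l) by
      obtain ⟨L, R, hR⟩ := this
      exact ⟨L, R, hR, fun h1 => absurd h1 (lt_irrefl _)⟩
    have hne : i + 1 ≠ i := by fin_cases i <;> decide
    have hall : ∀ j : Fin 2, j ≠ i → j = i + 1 := by fin_cases i <;> decide
    have hi : HornP i (verts (pointHom i)) := ⟨i + 1, hne, by simp [verts_pointHom]⟩
    have honly : ∀ j, HornP i (verts (pointHom j)) → j = i := by
      rintro j ⟨l, hl, hl'⟩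
      rw [verts_pointHom, Finset.mem_singleton] at hl'
      by_contra hj
      exact hl' ((hall l hl).trans (hall j hj).symm)
    have hrep : ∀ (A : C) (y : (absFam (HornP i) N).obj (op A)), ∃! a : A ⟶ N _⦋0⦌,
        (absFam (HornP i) N).map a.op (Fam.ofSimplex (HornP i) (N.σ 0)) = y := by
      intro A (y : Fam (HornP i) N A)
      have hσ : ∀ a : A ⟶ N _⦋0⦌, (a ≫ N.σ 0) ≫ π 1 i = a ≫ π 0 0 := fun a => by
        rw [Category.assoc, SimplicialObject.σ, h.map_π]
        congr 2
        exact Subsingleton.elim (α := Fin 1) _ _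
      refine ⟨y.val (pointHom i) hi, ?_, fun a ha => ?_⟩
      · refine (absFam_map_ofSimplex _ _).trans (h.fam_ext hr (isLower_hornP i) fun j hj => ?_)
        obtain rfl := honly j hj
        rw [h.map_ofSimplex_val, hσ]
      · have := congrArg (fun y : Fam (HornP i) N A => y.val (pointHom i) hi ≫ π 0 0)
          ((absFam_map_ofSimplex _ _).symm.trans ha)
        rw [h.map_ofSimplex_val, hσ] at this
        exact h.hom_ext hr fun j => by rw [Fin.eq_zero j]; exact this
    refine mapToLimit_of_isRelCover hW (representableOfUniversal _ hrep) ?_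
    intro A (y : Fam (HornP i) N A)
    -- `D` classifies the points related to the given vertex i; they become the other vertex of the
    -- edge.
    obtain ⟨D, c, b, hc, hb, ub⟩ := hr.cover (y.val (pointHom i) hi ≫ π 0 0)
    obtain ⟨x, hx, -⟩ := h.existsUnique 1
      (fun j => if j = i then c ≫ y.val (pointHom i) hi ≫ π 0 0 else b) (fun j l => by
        split_ifs
        · exact hr.refl _
        · exact hb
        · exact hr.symm hb
        · exact hr.refl _)
    have hxi := (hx i).trans (if_pos rfl)
    have hxi' := (hx (i + 1)).trans (if_neg hne)
    have key : ∀ {A' : C} (d : A' ⟶ A) (x' : A' ⟶ N _⦋1⦌),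
        ofPoint (absFam (HornP i) N) (Fam.ofSimplex (HornP i) (𝟙 (N _⦋1⦌))) A' x' =
          (absFam (HornP i) N).map d.op y ↔ x' ≫ π 1 i = d ≫ y.val (pointHom i) hi ≫ π 0 0 := by
      intro A' d x'
      have e : ofPoint (absFam (HornP i) N) (Fam.ofSimplex (HornP i) (𝟙 (N _⦋1⦌))) A' x' =
          Fam.ofSimplex (HornP i) x' := by
        refine (absFam_map_ofSimplex _ _).trans ?_
        rw [Category.comp_id]
      rw [e]
      constructor
      · intro he
        have := congrArg (fun y : Fam (HornP i) N A' => y.val (pointHom i) hi ≫ π 0 0) he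
        rw [h.map_ofSimplex_val] at this
        exact this.trans (Category.assoc _ _ _)
      · intro he
        refine h.fam_ext hr (isLower_hornP i) fun j hj => ?_
        obtain rfl := honly j hj
        rw [h.map_ofSimplex_val, he]
        exact (Category.assoc _ _ _).symm
    refine ⟨D, c, x, hc, (key _ _).2 hxi, fun A' d x' hx' => ?_⟩
    have hx'' := (key _ _).1 hx'
    obtain ⟨z, ⟨hz, hz'⟩, uz⟩ := ub d (x' ≫ π 1 (i + 1)) (by
      rw [← hx'']
      exact hr.pre _ (h.rel 1 _ _))
    have hπ : ∀ z : A' ⟶ D, z ≫ c = d → (z ≫ x = x' ↔ z ≫ b = x' ≫ π 1 (i + 1)) := by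
      intro z hz
      constructor
      · rintro rfl
        rw [Category.assoc, hxi']
      · intro e
        refine h.hom_ext hr fun j => ?_
        by_cases hj : j = i
        · rw [hj, Category.assoc, hxi, ← Category.assoc, hz, hx'']
        · rw [hall j hj, Category.assoc, hxi', e]
    exact ⟨z, ⟨hz, (hπ z hz).2 hz'⟩, fun z' ⟨h₁, h₂⟩ => uz z' ⟨h₁, (hπ z' h₁).1 h₂⟩⟩
  · refine mapToLimit_of_bijective ⟨W.id_mem _, fun _ => inferInstance⟩ fun A => ?_
    have hpair : ∀ j, HornP i {i, j} := fun j => by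
      obtain ⟨l, hl⟩ : ∃ l, l ∉ ({i, j} : Finset (Fin (k + 1))) := by
        by_contra! hl
        have h₁ := Finset.card_le_card (fun l _ => hl l : Finset.univ ⊆ ({i, j} : Finset _))
        rw [Finset.card_univ, Fintype.card_fin] at h₁
        have h₂ := Finset.card_le_two (a := i) (b := j)
        omega
      exact ⟨l, fun e => hl (by simp [e]), hl⟩
    have hpt : ∀ j, HornP i (verts (pointHom j)) := fun j =>
      isLower_hornP i _ _ (verts_nonempty _) (by simp [verts_pointHom]) (hpair j)
    constructor
    · intro x x' hx
      have hx : Fam.ofSimplex (HornP i) x = Fam.ofSimplex (HornP i) x' := by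
        have := (absFam_map_ofSimplex _ _).symm.trans (hx.trans (absFam_map_ofSimplex _ _))
        rw [Category.comp_id, Category.comp_id] at this
        exact this
      refine h.hom_ext hr fun j => ?_
      rw [← h.map_ofSimplex_val x j (hpt j), hx, h.map_ofSimplex_val]
    · intro (y : Fam (HornP i) N A)
      have hrel : ∀ j, r (y.val (pointHom i) (hpt i) ≫ π 0 0) (y.val (pointHom j) (hpt j) ≫ π 0 0) := by
        intro j
        obtain ⟨m, hm⟩ : ∃ m, ({i, j} : Finset (Fin (k + 1))).card = m + 1 :=
          Nat.exists_eq_succ_of_ne_zero (Finset.card_pos.2 ⟨i, by simp⟩).ne'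
        have hv := verts_faceHom _ hm
        have hα : HornP i (verts (faceHom _ hm)) := by rw [hv]; exact hpair j
        obtain ⟨l, hl⟩ := (mem_verts (faceHom _ hm) i).1 (by rw [hv]; simp)
        obtain ⟨l', hl'⟩ := (mem_verts (faceHom _ hm) j).1 (by rw [hv]; simp)
        have e₁ := h.val_π y (faceHom _ hm) hα l (hpt _)
        have e₂ := h.val_π y (faceHom _ hm) hα l' (hpt _)
        have := hr.pre (y.val (faceHom _ hm) hα) (h.rel m l l')
        rw [e₁, e₂] at this
        convert this using 4
        · exact hl.symm
        · exact hl'.symm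
      obtain ⟨x, hx, -⟩ := h.existsUnique k (fun j => y.val (pointHom j) (hpt j) ≫ π 0 0)
        fun j l => hr.trans (hr.symm (hrel j)) (hrel l)
      refine ⟨x, (absFam_map_ofSimplex _ _).trans (h.fam_ext hr (isLower_hornP i) fun j hj => ?_)⟩
      rw [h.map_ofSimplex_val, Category.comp_id, hx]

/-! ### Transport relations and their quotients -/

/-- The relation `r` on the points of `B` is the transport relation of a cover `v` of the quotient
`V` of `U`, for a map `P : B ⟶ U`. -/
structure IsTransportRel {B U V : C} (P : B ⟶ U) (v : U ⟶ V)
    (r : ∀ {A : C}, (A ⟶ B) → (A ⟶ B) → Prop) : Prop where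
  refl : ∀ {A : C} (a : A ⟶ B), r a a
  symm : ∀ {A : C} {a b : A ⟶ B}, r a b → r b a
  trans : ∀ {A : C} {a b c : A ⟶ B}, r a b → r b c → r a c
  pre : ∀ {A D : C} {a b : A ⟶ B} (d : D ⟶ A), r a b → r (d ≫ a) (d ≫ b)
  map : ∀ {A : C} {a b : A ⟶ B}, r a b → (a ≫ P) ≫ v = (b ≫ P) ≫ v
  transport : ∀ {A : C} (a : A ⟶ B) (u : A ⟶ U), (a ≫ P) ≫ v = u ≫ v → ∃ b, r a b ∧ b ≫ P = u
  eq_of_map_eq : ∀ {A : C} {a b : A ⟶ B}, r a b → a ≫ P = b ≫ P → a = b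

variable {U V Y : C} {P : B ⟶ U} {v : U ⟶ V}

/-- The points related to a correspond to the points u of U with the same image in V as a, by
existence and uniqueness of transport. So they are classified by the pullback of the cover v along
`a ≫ P ≫ v`. -/
lemma IsTransportRel.isCoverRel (hW : IsCategoryWithCovers W) (hr : IsTransportRel P v r)
    (hv : W v) : IsCoverRel W r where
  refl := hr.refl
  symm := hr.symm
  trans := hr.trans
  pre := hr.pre
  cover {A} a := by
    have := hW.hasPullback v (a ≫ P ≫ v) hv
    have h := IsPullback.of_hasPullback v (a ≫ P ≫ v)
    obtain ⟨b, hb, hb'⟩ := hr.transport (pullback.snd v (a ≫ P ≫ v) ≫ a)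
      (pullback.fst v (a ≫ P ≫ v)) (by simpa using h.w.symm)
    refine ⟨_, _, b, hW.of_isPullback h hv, hb, fun x y hxy => ?_⟩
    obtain ⟨z, ⟨h₁, h₂⟩, h₃⟩ := IsPullback.existsUnique_lift h (y ≫ P) x (by
      simpa using (hr.map hxy).symm)
    refine ⟨z, ⟨h₂, ?_⟩, fun z' ⟨h₄, h₅⟩ => h₃ z' ⟨?_, h₄⟩⟩
    · refine hr.eq_of_map_eq (hr.trans (hr.symm (hr.pre z hb)) ?_) ?_
      · rw [← Category.assoc, h₂]
        exact hxy
      · rw [Category.assoc, hb', h₁]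
    · rw [← h₅, Category.assoc, hb']

/-- The relation embeds in B × U as the pullback of the diagonal of V. Multiplying by Y gives a
regular embedding in B × U × Y ≅ B × B, and the anchor is its composition with the graph of the
Y-component of the second point. -/
lemma IsNerve.regularEmbedding (hW : IsCategoryWithCovers W) (hr : IsTransportRel P v r)
    (hv : W v) (h : IsNerve r N π) {ψ : B ⟶ Y} (hB : IsProd P ψ) {BB : C} {p₁ p₂ : BB ⟶ B}
    (hBB : IsProd p₁ p₂) (l : N _⦋1⦌ ⟶ BB) (h₁ : l ≫ p₁ = π 1 0) (h₂ : l ≫ p₂ = π 1 1) :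
    RegularEmbedding W l := by
  have := hW.isMultiplicative
  have hc := hr.isCoverRel hW hv
  obtain ⟨BU, b₁, b₂, hBU⟩ := exists_isProd hW B U
  obtain ⟨VU, c₁, c₂, hVU⟩ := exists_isProd hW V U
  obtain ⟨VV, v₁, v₂, hVV⟩ := exists_isProd hW V V
  obtain ⟨M, m₁, m₂, hM⟩ := exists_isProd hW (N _⦋1⦌) Y
  have hP : W (P ≫ v) := W.comp_mem _ _ (hB.isCover_fst hW) hv
  obtain ⟨s, ⟨hs₁, hs₂⟩, -⟩ := hVU _ (b₁ ≫ P ≫ v) b₂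
  obtain ⟨t, ⟨ht₁, ht₂⟩, -⟩ := hVV _ c₁ (c₂ ≫ v)
  obtain ⟨δ, ⟨hδ₁, hδ₂⟩, -⟩ := hVV _ (𝟙 V) (𝟙 V)
  obtain ⟨j, ⟨hj₁, hj₂⟩, -⟩ := hBU _ (π 1 0) (π 1 1 ≫ P)
  have hs : W s := hW.of_isPullback (isPullback_of_existsUnique (fst := b₁) (snd := s)
    (f := P ≫ v) (g := c₁) hs₁.symm fun A x y hxy => by
      obtain ⟨z, ⟨hz₁, hz₂⟩, uz⟩ := hBU A x (y ≫ c₂)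
      refine ⟨z, ⟨hz₁, hVU.hom_ext ?_ ?_⟩, fun z' ⟨h, h'⟩ => uz z' ⟨h, ?_⟩⟩
      · rw [Category.assoc, hs₁, ← Category.assoc, hz₁, hxy]
      · rw [Category.assoc, hs₂, hz₂]
      · rw [← h', Category.assoc, hs₂]) hP
  have ht : W t := hW.of_isPullback (isPullback_of_existsUnique (fst := c₂) (snd := t)
    (f := v) (g := v₂) ht₂.symm fun A x y hxy => by
      obtain ⟨z, ⟨hz₁, hz₂⟩, uz⟩ := hVU A (y ≫ v₁) x
      refine ⟨z, ⟨hz₂, hVV.hom_ext ?_ ?_⟩, fun z' ⟨h, h'⟩ => uz z' ⟨?_, h⟩⟩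
      · rw [Category.assoc, ht₁, hz₁]
      · rw [Category.assoc, ht₂, ← Category.assoc, hz₂, hxy]
      · rw [← h', Category.assoc, ht₁]) hv
  -- `j` sends a related pair (a, b) to (a, P b); it is the base change of the diagonal `δ` of V
  -- along the cover B × U → V × V.
  have hj : RegularEmbedding W j := by
    refine RegularEmbedding.pullback (c' := π 1 0 ≫ P ≫ v) (i := δ) (c := s ≫ t)
      (isPullback_of_existsUnique (hVV.hom_ext ?_ ?_) fun A x y hxy => ?_) (W.comp_mem _ _ hs ht)
      (RegularEmbedding.graph v₁ v₂ hVV.isLimit δ hδ₁)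
    · simp only [Category.assoc, hδ₁, ht₁, hs₁]
      rw [← Category.assoc j, hj₁, Category.comp_id]
    · simp only [Category.assoc, hδ₂, ht₂]
      rw [← Category.assoc s, hs₂, ← Category.assoc j, hj₂, Category.comp_id]
      simpa using hr.map (h.rel 1 0 1)
    · have e₁ := congrArg (· ≫ v₁) hxy
      have e₂ := congrArg (· ≫ v₂) hxy
      simp only [Category.assoc, hδ₁, ht₁, hs₁, Category.comp_id] at e₁
      simp only [Category.assoc, hδ₂, ht₂, Category.comp_id] at e₂
      rw [← Category.assoc s, hs₂] at e₂
      obtain ⟨b, hb, hb'⟩ := hr.transport (y ≫ b₁) (y ≫ b₂) (by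
        simpa using e₁.symm.trans e₂)
      obtain ⟨z, hz, uz⟩ := h.existsUnique 1 ![y ≫ b₁, b] (fun i j => by
        fin_cases i <;> fin_cases j
        exacts [hr.refl _, hb, hr.symm hb, hr.refl _])
      have hz₀ : z ≫ π 1 0 = y ≫ b₁ := hz 0
      have hz₁ : z ≫ π 1 1 = b := hz 1
      refine ⟨z, ⟨?_, hBU.hom_ext ?_ ?_⟩, fun z' ⟨h, h'⟩ => uz z' fun i => ?_⟩
      · rw [← Category.assoc, hz₀, e₁, Category.assoc]
      · rw [Category.assoc, hj₁, hz₀]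
      · rw [Category.assoc, hj₂, ← Category.assoc, hz₁, hb']
      · have e₀ : z' ≫ π 1 0 = y ≫ b₁ := by rw [← h', Category.assoc, hj₁]
        fin_cases i
        · exact e₀
        · refine hr.eq_of_map_eq (a := z' ≫ π 1 1) (b := b) ?_ ?_
          · refine hr.trans (hr.symm ?_) hb
            rw [← e₀]
            exact hr.pre z' (IsNerve.rel ‹_› 1 0 1)
          · rw [hb', ← h', Category.assoc, Category.assoc, hj₂]
  obtain ⟨c, ⟨hc₁, hc₂⟩, -⟩ := hBU _ p₁ (p₂ ≫ P)
  have hcW : W c := hW.of_isPullback (isPullback_of_existsUnique (fst := p₂) (snd := c)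
    (f := P) (g := b₂) hc₂.symm fun A x y hxy => by
      obtain ⟨z, ⟨hz₁, hz₂⟩, uz⟩ := hBB A (y ≫ b₁) x
      refine ⟨z, ⟨hz₂, hBU.hom_ext ?_ ?_⟩, fun z' ⟨h, h'⟩ => uz z' ⟨?_, h⟩⟩
      · rw [Category.assoc, hc₁, hz₁]
      · rw [Category.assoc, hc₂, ← Category.assoc, hz₂, hxy]
      · rw [← h', Category.assoc, hc₁]) (hB.isCover_fst hW)
  obtain ⟨e, ⟨he₁, he₂⟩, -⟩ := hB _ (m₁ ≫ π 1 1 ≫ P) m₂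
  obtain ⟨i, ⟨hi₁, hi₂⟩, -⟩ := hBB _ (m₁ ≫ π 1 0) e
  obtain ⟨γ, ⟨hγ₁, hγ₂⟩, -⟩ := hM _ (𝟙 _) (π 1 1 ≫ ψ)
  -- `i` is the base change of `j` along 1 × P : B × B → B × U, with source N_1 × Y because B = U ×
  -- Y.
  have hi : RegularEmbedding W i := by
    refine RegularEmbedding.pullback (c' := m₁) (i := j) (c := c)
      (isPullback_of_existsUnique (hBU.hom_ext ?_ ?_) fun A x y hxy => ?_) hcW hj
    · rw [Category.assoc, hj₁, Category.assoc, hc₁, hi₁]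
    · rw [Category.assoc, hj₂, Category.assoc, hc₂, ← Category.assoc i, hi₂, he₁]
    · have e₁ := congrArg (· ≫ b₁) hxy
      have e₂ := congrArg (· ≫ b₂) hxy
      simp only [Category.assoc, hj₁, hc₁] at e₁
      simp only [Category.assoc, hj₂, hc₂] at e₂
      obtain ⟨z, ⟨hz₁, hz₂⟩, uz⟩ := hM A x (y ≫ p₂ ≫ ψ)
      refine ⟨z, ⟨hz₁, hBB.hom_ext ?_ (hB.hom_ext ?_ ?_)⟩, fun z' ⟨h, h'⟩ => uz z' ⟨h, ?_⟩⟩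
      · rw [Category.assoc, hi₁, ← Category.assoc, hz₁, e₁]
      · rw [Category.assoc z, hi₂, Category.assoc z, he₁, ← Category.assoc, hz₁, e₂, Category.assoc]
      · rw [Category.assoc z, hi₂, Category.assoc z, he₂, hz₂, Category.assoc]
      · rw [← h', Category.assoc, ← Category.assoc i, hi₂, he₂]
  have hl : l = γ ≫ i := by
    refine hBB.hom_ext ?_ (hB.hom_ext ?_ ?_)
    · rw [h₁, Category.assoc, hi₁, ← Category.assoc, hγ₁, Category.id_comp]
    · rw [h₂, Category.assoc γ, hi₂, Category.assoc, he₁, ← Category.assoc γ, hγ₁,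
        Category.id_comp]
    · rw [h₂, Category.assoc γ, hi₂, Category.assoc, he₂, hγ₂]
  rw [hl]
  exact RegularEmbedding.comp _ _ (RegularEmbedding.graph m₁ m₂ hM.isLimit γ hγ₁) hi

lemma IsNerve.isRegular (hW : IsCategoryWithCovers W) (hr : IsTransportRel P v r)
    (hv : W v) (h : IsNerve r N π) {ψ : B ⟶ Y} (hB : IsProd P ψ) : IsRegular W N := by
  obtain ⟨BB, p₁, p₂, hBB⟩ := exists_isProd hW B B
  have hc := hr.isCoverRel hW hv
  refine (absLimit_iff isVertexSubcomplex_boundary _).2 ?_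
  have hlow : IsLower (BdryP : Finset (Fin 2) → Prop) :=
    fun S S' _ hS ⟨j, hj⟩ => ⟨j, fun h => hj (hS h)⟩
  have hpt : ∀ j : Fin 2, BdryP (verts (pointHom j)) := fun j => ⟨j + 1, by
    rw [verts_pointHom]
    fin_cases j <;> decide⟩
  have honly : ∀ {m : SimplexCategory} (α : m ⟶ ⦋1⦌), BdryP (verts α) →
      ∃ j : Fin 2, ∀ l, (α.toOrderHom l : Fin 2) = j := by
    rintro m α ⟨j, hj⟩
    refine ⟨j + 1, fun l => ?_⟩
    have : (α.toOrderHom l : Fin 2) ≠ j := fun e => hj ((mem_verts _ _).2 ⟨l, e⟩)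
    generalize (α.toOrderHom l : Fin 2) = i at *
    revert this
    fin_cases i <;> fin_cases j <;> decide
  choose κ hκ using fun {A : C} (b : A ⟶ B) =>
    (h.existsUnique 0 (fun _ => b) fun _ _ => hc.refl b).exists
  have hκ0 : ∀ {A : C} (b : A ⟶ B), κ b ≫ π 0 0 = b := fun b => hκ b 0
  have hκD : ∀ {A D : C} (b : A ⟶ B) (d : D ⟶ A), d ≫ κ b = κ (d ≫ b) := fun b d =>
    h.hom_ext hc fun i => by rw [Category.assoc, hκ, hκ]
  -- A simplex of ∂Δ^1 is constant at one vertex; its value is the degenerate simplex on the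
  -- matching projection. This exhibits B × B as M_1(N).
  let y : Fam BdryP N BB :=
    { val := fun {m} α hα => κ (if (honly α hα).choose = 0 then p₁ else p₂) ≫
        N.map (SimplexCategory.const m ⦋0⦌ 0).op
      nat := fun {m m'} β α hα hα' => by
        have e : (honly (β ≫ α) hα').choose = (honly α hα).choose := by
          rw [← (honly (β ≫ α) hα').choose_spec 0, ← (honly α hα).choose_spec (β.toOrderHom 0)]
          rfl
        rw [e, Category.assoc, map_op_comp]
        rfl }
  have hy : ∀ (j : Fin 2), y.val (pointHom j) (hpt j) ≫ π 0 0 = if j = 0 then p₁ else p₂ := by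
    intro j
    have e : (honly (pointHom j) (hpt j)).choose = j :=
      ((honly (pointHom j) (hpt j)).choose_spec 0).symm
    change (κ (if (honly (pointHom j) (hpt j)).choose = 0 then p₁ else p₂) ≫ _) ≫ _ = _
    rw [e, Category.assoc, h.map_π]
    exact hκ0 _
  have hrep : ∀ (A : C) (x : (absFam BdryP N).obj (op A)), ∃! a : A ⟶ BB,
      (absFam BdryP N).map a.op y = x := by
    intro A (x : Fam BdryP N A)
    obtain ⟨a, ⟨h₁, h₂⟩, ua⟩ := hBB A (x.val (pointHom 0) (hpt 0) ≫ π 0 0)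
      (x.val (pointHom 1) (hpt 1) ≫ π 0 0)
    have hv : ∀ (a : A ⟶ BB) j, (y.pre a).val (pointHom j) (hpt j) ≫ π 0 0 =
        a ≫ if j = 0 then p₁ else p₂ := fun a j => by
      rw [← hy]
      exact Category.assoc _ _ _
    refine ⟨a, h.fam_ext hc hlow fun j hj => (hv a j).trans ?_, fun a' ha' => ua a' ⟨?_, ?_⟩⟩
    · fin_cases j
      exacts [h₁, h₂]
    · rw [← show y.pre a' = x from ha']
      exact (hv a' 0).symm
    · rw [← show y.pre a' = x from ha']
      exact (hv a' 1).symm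
  obtain ⟨l, ⟨hl₁, hl₂⟩, -⟩ := hBB _ (π 1 0) (π 1 1)
  refine ⟨BB, representableOfUniversal _ hrep, ?_⟩
  have hl : (representableOfUniversal _ hrep).homEquiv.symm (Fam.ofSimplex BdryP (𝟙 (N _⦋1⦌))) =
      l := by
    refine (Equiv.symm_apply_eq _).2 ?_
    refine h.fam_ext hc hlow fun j hj => ?_
    rw [h.map_ofSimplex_val, Category.id_comp]
    refine Eq.symm ((Category.assoc _ _ _).trans ?_)
    rw [hy]
    fin_cases j
    exacts [hl₁, hl₂]
  rw [hl]
  exact h.regularEmbedding hW hr hv hB hBB l hl₁ hl₂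

lemma IsNerve.isIso_π (h : IsNerve r N π) (hr : IsCoverRel W r) : IsIso (π 0 0) := by
  obtain ⟨i, hi, -⟩ := h.existsUnique 0 (fun _ => 𝟙 B) fun _ _ => hr.refl _
  refine ⟨i, h.hom_ext hr fun j => ?_, hi 0⟩
  rw [Fin.eq_zero j, Category.assoc, hi, Category.comp_id, Category.id_comp]

/-- If Godemont's Theorem holds and orbit spaces are effective, transport relations have effective
quotients. -/
theorem IsTransportRel.exists_quotient (hW : IsCategoryWithCovers W) (hG : GodemontHolds W)
    (hE : EffectiveOrbitSpaces W) (hr : IsTransportRel P v r) (hv : W v) {ψ : B ⟶ Y}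
    (hB : IsProd P ψ) :
    ∃ (Q : C) (q : B ⟶ Q), W q ∧ ∀ {A : C} (a b : A ⟶ B), a ≫ q = b ≫ q ↔ r a b := by
  have := hW.isMultiplicative
  have hc := hr.isCoverRel hW hv
  obtain ⟨N, π, h⟩ := hc.exists_isNerve
  have hN := h.isLieGroupoid hW hc
  have hR := h.isRegular hW hr hv hB
  obtain ⟨Q, q, hq⟩ := hG 1 N hN hR
  have hk := hE 1 N hN hR Q q hq
  have := h.isIso_π hc
  have h₁ : N.δ (1 : Fin 2) ≫ π 0 0 = π 1 0 := h.map_π _ _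
  have h₀ : N.δ (0 : Fin 2) ≫ π 0 0 = π 1 1 := h.map_π _ _
  refine ⟨Q, inv (π 0 0) ≫ q, W.comp_mem _ _ (isCover_of_isIso hW _) hq.1, fun a b => ⟨?_, ?_⟩⟩
  · intro e
    obtain ⟨z, ⟨hz₁, hz₂⟩, -⟩ := IsPullback.existsUnique_lift hk (a ≫ inv (π 0 0))
      (b ≫ inv (π 0 0)) (by simpa using e)
    have := hr.pre z (h.rel 1 0 1)
    rw [← h₁, ← h₀, ← Category.assoc, ← Category.assoc, hz₁, hz₂] at this
    simpa using this
  · intro e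
    obtain ⟨z, hz, -⟩ := h.existsUnique 1 ![a, b] (fun i j => by
      fin_cases i <;> fin_cases j
      exacts [hr.refl _, e, hr.symm e, hr.refl _])
    have hz₀ : z ≫ π 1 0 = a := hz 0
    have hz₁ : z ≫ π 1 1 = b := hz 1
    rw [← hz₀, ← hz₁, ← h₁, ← h₀]
    simpa using congrArg (z ≫ ·) hk.w

end Nerve


/-! ### The higher morphism space -/

section HigherMorphismSpace

variable {W : MorphismProperty C} {E U X : SimplicialObject C} {n : ℕ} {A : C} {g : E ⟶ X}
  {p : E ⟶ U} {f : U ⟶ X}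

lemma IsCategoryWithCovers.hom_ext (hW : IsCategoryWithCovers W) {X Y Z : C} {q : X ⟶ Y} (hq : W q)
    {a b : Y ⟶ Z} (h : q ≫ a = q ≫ b) : a = b := by
  have := hW.hasPullback q q hq
  obtain ⟨hc⟩ := hW.effective q _ _ (IsPullback.of_hasPullback q q) hq
  exact Cofork.IsColimit.hom_ext hc h

/-- A cover is the coequalizer of its kernel pair, and the hypothesis is applied to the two
projections of that pair. -/
lemma IsCategoryWithCovers.exists_desc (hW : IsCategoryWithCovers W) {X Y Z : C} {q : X ⟶ Y}
    (hq : W q) (φ : X ⟶ Z) (h : ∀ {A : C} (a b : A ⟶ X), a ≫ q = b ≫ q → a ≫ φ = b ≫ φ) :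
    ∃ ψ : Y ⟶ Z, q ≫ ψ = φ := by
  have := hW.hasPullback q q hq
  have hk := IsPullback.of_hasPullback q q
  obtain ⟨hc⟩ := hW.effective q _ _ hk hq
  exact ⟨_, Cofork.IsColimit.π_desc' hc φ (h _ _ hk.w)⟩

lemma ofSimplex_skelP_eq_iff {f : U ⟶ X} {k : ℕ} (a b : A ⟶ U _⦋k⦌) :
    RelFam.ofSimplex (SkelP n) f a = RelFam.ofSimplex (SkelP n) f b ↔ LowRel n f k a b := by
  constructor
  · intro h
    exact ⟨congrArg (fun y : RelFam (SkelP n) f A => y.right) h, fun j hj θ =>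
      congrArg (fun y : RelFam (SkelP n) f A => y.left.val θ ((card_verts_le θ).trans hj)) h⟩
  · intro h
    refine RelFam.ext' (fun α hα => ?_) h.base
    obtain ⟨j, hj⟩ : ∃ j, (verts α).card = j + 1 :=
      Nat.exists_eq_succ_of_ne_zero (Finset.card_pos.2 (verts_nonempty α)).ne'
    obtain ⟨θ, hθ⟩ := exists_comp_faceHom (verts α) hj α subset_rfl
    have hjn : j < n := by
      change (verts α).card ≤ n at hα
      omega
    change a ≫ U.map α.op = b ≫ U.map α.op
    rw [← hθ, ← map_op_comp, ← Category.assoc, ← Category.assoc, h.low j hjn]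

/-- The quotient of `U_k` by the relation `LowRel`. -/
lemma IsHypercover.exists_lowQuotient (hW : IsCategoryWithCovers W) {m : ℕ∞}
    (hf : IsHypercover W m f) (n k : ℕ) : ∃ (V : C) (v : U _⦋k⦌ ⟶ V), W v ∧
      ∀ {A : C} (a b : A ⟶ U _⦋k⦌), a ≫ v = b ≫ v ↔ LowRel n f k a b := by
  have := hW.isMultiplicative
  -- The quotient is the limit of hom(sk_{n-1} Δ^k, U) and X_k. The condition `SkelP n` allows at
  -- most n vertices, that is, dimension less than n.
  obtain ⟨L, ⟨R⟩⟩ := exists_representableBy_relFam (W := W) (k := k) f (isLower_skelP n)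
    fun j => hf.cell hW j
  obtain ⟨V, R', hv⟩ := mapToLimit_of_isRelCover hW R
    (isRelCover_tautFam f (isLower_skelP n) fun j _ _ _ => hf.cell hW j)
  refine ⟨V, _, hv, fun {A} a b => ?_⟩
  have e : ∀ a : A ⟶ U _⦋k⦌, R'.homEquiv (a ≫ R'.homEquiv.symm (tautFam (SkelP n) f)) =
      RelFam.ofSimplex (SkelP n) f a := fun a => by
    rw [R'.homEquiv_comp, Equiv.apply_symm_apply]
    exact ofPoint_tautFam f a
  rw [← ofSimplex_skelP_eq_iff, ← R'.homEquiv.injective.eq_iff, e, e]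
  rfl

lemma UniqueFillings.isTransportRel (H : UniqueFillings n p f) {k : ℕ} {V : C} {v : U _⦋k⦌ ⟶ V}
    (hv : ∀ {A : C} (a b : A ⟶ U _⦋k⦌), a ≫ v = b ≫ v ↔ LowRel n f k a b) :
    IsTransportRel (p.app (op ⦋k⦌)) v (fun {_} a b => HigherRel n (p ≫ f) k a b) where
  refl a := HigherRel.refl _ a
  symm h := h.symm H
  trans h h' := h.trans H h'
  pre d h := h.pre d
  map h := (hv _ _).2 h.lowRel
  transport a u h := exists_transport H a u ((hv _ _).1 h)
  eq_of_map_eq h h' := h.eq_of_map_eq H h'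

lemma missesLow_iff_hornP {ℓ : ℕ} {m : SimplexCategory} (α : m ⟶ ⦋n + ℓ⦌) :
    HornP (Fin.last n) (verts (α ≫ collapse n ℓ)) ↔ MissesLow n α := by
  have key : ∀ l, ((α ≫ collapse n ℓ).toOrderHom l : Fin (n + 1)).val =
      min (α.toOrderHom l : Fin (n + ℓ + 1)).val n := fun l => rfl
  constructor
  · rintro ⟨j, hj, hj'⟩
    have hjn : j.val < n := by
      have : j.val ≠ n := fun h => hj (Fin.ext h)
      omega
    refine ⟨⟨j.val, by omega⟩, hjn, fun h => hj' ?_⟩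
    obtain ⟨l, hl⟩ := (mem_verts _ _).1 h
    refine (mem_verts _ _).2 ⟨l, Fin.ext ((key l).trans ?_)⟩
    rw [hl]
    exact min_eq_left hjn.le
  · rintro ⟨i, hi, hi'⟩
    refine ⟨⟨i.val, by omega⟩, fun h => hi.ne (congrArg Fin.val h), fun h => hi' ?_⟩
    obtain ⟨l, hl⟩ := (mem_verts _ _).1 h
    refine (mem_verts _ _).2 ⟨l, Fin.ext ?_⟩
    have h₁ := (key l).symm.trans (congrArg Fin.val hl)
    change min _ n = i.val at h₁
    omega

/-- A point of Λ^n_n(g) whose degeneracy is the image of x is the restriction of any vertex of x, so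
it can be replaced by an n-simplex a. -/
lemma isHigherMorphism_iff {ℓ : ℕ} (x : A ⟶ E _⦋n + ℓ⦌) :
    IsHigherMorphism n g ℓ x ↔ ∃ a, IsHM n g ℓ x a := by
  constructor
  · rintro ⟨s, h₁, h₂⟩
    let y := relFamEquiv (isVertexSubcomplex_horn (Fin.last n)) g A s
    have hlow : ∀ {m : SimplexCategory} (α : m ⟶ ⦋n + ℓ⦌) (hα : MissesLow n α),
        x ≫ E.map α.op = y.left.val (α ≫ collapse n ℓ) ((missesLow_iff_hornP α).2 hα) := by
      intro m α hα
      exact ConcreteCategory.congr_hom (congrArg (fun t => t.app (op m)) h₁)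
        ⟨SSet.stdSimplex.objEquiv.symm α, (isVertexSubcomplex_horn (Fin.last n) _).2
          ((missesLow_iff_hornP α).2 hα)⟩
    have hbase : x ≫ g.app (op ⦋n + ℓ⦌) = y.right ≫ X.map (collapse n ℓ).op := by
      have h₃ := (Equiv.symm_apply_eq _).1 h₂
      refine h₃.trans ?_
      have h₄ := ConcreteCategory.congr_hom (s.right.naturality (collapse n ℓ).op)
        (SSet.stdSimplex.objEquiv.symm (𝟙 ⦋n⦌))
      refine Eq.trans ?_ h₄
      change s.right.app _ (SSet.stdSimplex.objEquiv.symm (𝟙 _ ≫ collapse n ℓ)) =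
        s.right.app _ (SSet.stdSimplex.objEquiv.symm (collapse n ℓ ≫ 𝟙 _))
      rw [Category.comp_id, Category.id_comp]
    refine ⟨x ≫ E.map (vtx n ℓ 0).op, fun {m} α hα => ?_, ?_⟩
    · have hα' := hα.comp_collapse.comp_vtx (ℓ := ℓ) 0
      rw [Category.assoc, map_op_comp, hlow α hα, hlow _ hα']
      exact y.left.val_congr (by
        rw [Category.assoc, Category.assoc, vtx_comp_collapse, Category.comp_id]) _ _
    · rw [hbase, ← Category.assoc, Category.assoc x, map_op_comp, Category.assoc, g.naturality,
        ← Category.assoc, hbase, Category.assoc, map_op_comp, Category.assoc, vtx_comp_collapse,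
        Category.comp_id]
  · rintro ⟨a, ha⟩
    refine ⟨(relFamEquiv (isVertexSubcomplex_horn (Fin.last n)) g A).symm
      (RelFam.ofSimplex (HornP (Fin.last n)) g a), ?_, ?_⟩
    · ext m s
      obtain ⟨s, hs⟩ := s
      exact ha.low (SSet.stdSimplex.objEquiv s) ((missesLow_iff_hornP _).1
        ((isVertexSubcomplex_horn (Fin.last n) _).1 hs))
    · refine (Equiv.symm_apply_eq _).2 ?_
      refine ha.base.trans ?_
      rw [g.naturality]
      refine (Category.assoc _ _ _).symm.trans ?_
      change (a ≫ g.app (op ⦋n⦌)) ≫ X.map (collapse n ℓ).op =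
        (a ≫ g.app (op ⦋n⦌)) ≫ X.map (𝟙 _ ≫ collapse n ℓ).op
      rw [Category.id_comp]

variable {B : SimplicialObject C} {π : ∀ ℓ : ℕ, Fin (ℓ + 1) → (B _⦋ℓ⦌ ⟶ E _⦋n⦌)}

/-- The nerve of the relation on `E_n` is the higher morphism space. -/
theorem IsNerve.exists_isHigherMorphismSpace (H : UniqueFillings n p f)
    (hc : IsCoverRel W (fun {_} a b => HigherRel n (p ≫ f) n a b))
    (h : IsNerve (fun {_} a b => HigherRel n (p ≫ f) n a b) B π) :
    ∃ ι : B ⟶ joinShift n E, IsHigherMorphismSpace n (p ≫ f) ι ∧ ι.app (op ⦋0⦌) = π 0 0 := by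
  -- The universal tuple of related n-simplices spans a higher morphism. It is unique by `IsHM.ext`,
  -- which makes the choices natural in ℓ.
  choose x hx hv using fun ℓ => IsHM.exists_of_pairwise H (π ℓ) fun i j => (h.rel ℓ i j).hmRel
  have hnat : ∀ {ℓ ℓ' : ℕ} (θ : (⦋ℓ⦌ : SimplexCategory) ⟶ ⦋ℓ'⦌),
      B.map θ.op ≫ x ℓ = x ℓ' ≫ E.map (joinHom n θ).op := fun {ℓ ℓ'} θ => by
    refine IsHM.ext H ((hx ℓ).pre _) ((hx ℓ').comp θ) fun j => ?_
    rw [Category.assoc, hv, h.map_π, Category.assoc, map_op_comp, vtx_comp_joinHom, hv]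
  refine ⟨{ app := fun m => x m.unop.len
            naturality := fun m m' θ => hnat θ.unop }, fun ℓ => ⟨fun a b hab => ?_, fun y => ?_⟩, ?_⟩
  · refine h.hom_ext hc fun j => ?_
    have hab' : a ≫ x ℓ = b ≫ x ℓ := hab
    rw [← hv, ← Category.assoc, hab', Category.assoc]
  · rw [isHigherMorphism_iff]
    constructor
    · rintro ⟨a, ha⟩
      have hrel : ∀ i j, HMRel n (p ≫ f) (y ≫ E.map (vtx n ℓ i).op) (y ≫ E.map (vtx n ℓ j).op) :=
        fun i j => (le_total i j).elim ha.hmRel fun h => (ha.hmRel h).symm H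
      obtain ⟨b, hb, -⟩ := h.existsUnique ℓ _ fun i j => (hrel i j).higherRel
      have hbx : b ≫ x ℓ = y := IsHM.ext H ((hx ℓ).pre b) ha fun j => by
        rw [Category.assoc, hv, hb]
      exact ⟨b, hbx⟩
    · rintro ⟨b, rfl⟩
      exact ⟨_, (hx ℓ).pre b⟩
  · have := hv 0 0
    have e : E.map (vtx n 0 0).op = 𝟙 _ := by
      rw [vtx_zero]
      exact E.map_id _
    exact ((Category.comp_id (x 0)).symm.trans (congrArg (x 0 ≫ ·) e.symm)).trans this

/-- The kernel pair of q is the relation r, whose object of pairs is B_1, and a cover is the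
coequalizer of its kernel pair. -/
lemma IsNerve.isOrbitSpace (hW : IsCategoryWithCovers W) {E : C}
    {r : ∀ {A : C}, (A ⟶ E) → (A ⟶ E) → Prop} {π : ∀ ℓ : ℕ, Fin (ℓ + 1) → (B _⦋ℓ⦌ ⟶ E)}
    (hc : IsCoverRel W r) (h : IsNerve r B π) {Q : C} {q : E ⟶ Q} (hq : W q)
    (hr : ∀ {A : C} (a b : A ⟶ E), a ≫ q = b ≫ q ↔ r a b) : IsOrbitSpace W B (π 0 0 ≫ q) := by
  have := hW.isMultiplicative
  have := h.isIso_π hc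
  have h₁ : B.δ (1 : Fin 2) ≫ π 0 0 = π 1 0 := h.map_π _ _
  have h₀ : B.δ (0 : Fin 2) ≫ π 0 0 = π 1 1 := h.map_π _ _
  have hq' : W (π 0 0 ≫ q) := W.comp_mem _ _ (isCover_of_isIso hW _) hq
  have hw : B.δ (0 : Fin 2) ≫ π 0 0 ≫ q = B.δ (1 : Fin 2) ≫ π 0 0 ≫ q := by
    rw [← Category.assoc, h₀, ← Category.assoc, h₁, hr]
    exact h.rel 1 1 0
  refine ⟨hq', hw, ⟨Cofork.IsColimit.mk' _ fun s => ?_⟩⟩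
  have hs : ∃ ψ : Q ⟶ s.pt, (π 0 0 ≫ q) ≫ ψ = s.π := by
    refine hW.exists_desc hq' s.π fun {A} a b hab => ?_
    rw [← Category.assoc, ← Category.assoc, hr] at hab
    obtain ⟨z, hz, -⟩ := h.existsUnique 1 ![b ≫ π 0 0, a ≫ π 0 0] (fun i j => by
      fin_cases i <;> fin_cases j
      exacts [hc.refl _, hc.symm hab, hab, hc.refl _])
    have e₁ : z ≫ B.δ (1 : Fin 2) = b := by
      rw [← cancel_mono (π 0 0), Category.assoc, h₁]
      exact hz 0
    have e₀ : z ≫ B.δ (0 : Fin 2) = a := by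
      rw [← cancel_mono (π 0 0), Category.assoc, h₀]
      exact hz 1
    rw [← e₁, ← e₀, Category.assoc, Category.assoc, s.condition]
  refine ⟨hs.choose, hs.choose_spec, fun {m} hm => hW.hom_ext hq' (hm.trans hs.choose_spec.symm)⟩

end HigherMorphismSpace


/-! ### The strictification -/

section Strictification

variable {W : MorphismProperty C} {E U X T : SimplicialObject C} {n k : ℕ} {A : C}
  {p : E ⟶ U} {f : U ⟶ X} {g : T ⟶ X} {q : E ⟶ T}

/-- `T` is the levelwise quotient of `E` by the relation `HigherRel`. -/
structure IsHigherQuotient (W : MorphismProperty C) (n : ℕ) (p : E ⟶ U) (f : U ⟶ X) (g : T ⟶ X)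
    (q : E ⟶ T) : Prop where
  cover : ∀ k : ℕ, W (q.app (op ⦋k⦌))
  rel : ∀ (k : ℕ) {A : C} (a b : A ⟶ E _⦋k⦌),
    a ≫ q.app (op ⦋k⦌) = b ≫ q.app (op ⦋k⦌) ↔ HigherRel n (p ≫ f) k a b
  fac : q ≫ g = p ≫ f

/-- The simplicial operators respect the relation and related simplices have the same image in X, so
the structure maps descend; identities between them hold because covers are epimorphisms. -/
lemma exists_isHigherQuotient (hW : IsCategoryWithCovers W)
    (h : ∀ k : ℕ, ∃ (Q : C) (q : E _⦋k⦌ ⟶ Q), W q ∧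
      ∀ {A : C} (a b : A ⟶ E _⦋k⦌), a ≫ q = b ≫ q ↔ HigherRel n (p ≫ f) k a b) :
    ∃ (T : SimplicialObject C) (g : T ⟶ X) (q : E ⟶ T), IsHigherQuotient W n p f g q := by
  choose Q q hq hr using h
  have hm : ∀ {k k' : ℕ} (θ : (⦋k⦌ : SimplexCategory) ⟶ ⦋k'⦌), ∃ ψ : Q k' ⟶ Q k,
      q k' ≫ ψ = E.map θ.op ≫ q k := fun {k k'} θ =>
    hW.exists_desc (hq k') _ fun a b hab => by
      rw [← Category.assoc, ← Category.assoc, hr]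
      exact ((hr _ _ _).1 hab).comp θ
  have hg : ∀ k, ∃ ψ : Q k ⟶ X _⦋k⦌, q k ≫ ψ = (p ≫ f).app (op ⦋k⦌) := fun k =>
    hW.exists_desc (hq k) _ fun a b hab => ((hr _ _ _).1 hab).base
  choose m hm using @hm
  choose g hg using hg
  let T : SimplicialObject C :=
    { obj := fun k => Q k.unop.len
      map := fun θ => m θ.unop
      map_id := fun k => hW.hom_ext (hq k.unop.len) (by
        rw [hm, Category.comp_id]
        exact (congrArg (· ≫ q k.unop.len) (E.map_id k)).trans (Category.id_comp _))
      map_comp := fun {k k' k''} θ η => hW.hom_ext (hq k.unop.len) (by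
        rw [hm, ← Category.assoc, hm, Category.assoc, hm, ← Category.assoc]
        exact congrArg (· ≫ q k''.unop.len) (E.map_comp θ η)) }
  exact ⟨T,
    { app := fun k => g k.unop.len
      naturality := fun {k k'} θ => hW.hom_ext (hq k.unop.len) (by
        change q k.unop.len ≫ m θ.unop ≫ g k'.unop.len = q k.unop.len ≫ g k.unop.len ≫ X.map θ
        rw [← Category.assoc, hm, Category.assoc, hg, ← Category.assoc, hg]
        exact (p ≫ f).naturality θ) },
    { app := fun k => q k.unop.len
      naturality := fun {k k'} θ => (hm θ.unop).symm },
    ⟨fun k => hq k, fun k => hr k, by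
      ext k
      exact hg k.unop.len⟩⟩

namespace IsHigherQuotient

lemma fac_app (h : IsHigherQuotient W n p f g q) (m : SimplexCategory) :
    q.app (op m) ≫ g.app (op m) = (p ≫ f).app (op m) := by
  rw [← h.fac, NatTrans.comp_app]

lemma exists_lift (h : IsHigherQuotient W n p f g q) (hW : IsCategoryWithCovers W)
    (t : A ⟶ T _⦋k⦌) : ∃ (D : C) (c : D ⟶ A) (e : D ⟶ E _⦋k⦌), W c ∧
      e ≫ q.app (op ⦋k⦌) = c ≫ t := by
  have := hW.hasPullback (q.app (op ⦋k⦌)) t (h.cover k)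
  have hp := IsPullback.of_hasPullback (q.app (op ⦋k⦌)) t
  exact ⟨_, _, _, hW.of_isPullback hp (h.cover k), hp.w⟩

lemma isIso_app (h : IsHigherQuotient W n p f g q) (hW : IsCategoryWithCovers W) (hk : k < n) :
    IsIso (q.app (op ⦋k⦌)) := by
  obtain ⟨i, hi⟩ := hW.exists_desc (h.cover k) (𝟙 _) fun a b hab => by
    rw [((h.rel k a b).1 hab).eq_of_lt hk]
  exact ⟨i, hi, hW.hom_ext (h.cover k) (by rw [← Category.assoc, hi]; simp)⟩

lemma hom_ext (h : IsHigherQuotient W n p f g q) (H : UniqueFillings n p f) {a b : A ⟶ E _⦋k⦌}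
    (h₁ : a ≫ q.app (op ⦋k⦌) = b ≫ q.app (op ⦋k⦌)) (h₂ : a ≫ p.app (op ⦋k⦌) = b ≫ p.app (op ⦋k⦌)) :
    a = b :=
  ((h.rel k a b).1 h₁).eq_of_map_eq H h₂

end IsHigherQuotient

/-- The simplices `t` of `T` and `u` of `U` have the same image in `X` and the same faces of
dimension less than `n`. -/
structure OverRel (n : ℕ) (p : E ⟶ U) (f : U ⟶ X) (g : T ⟶ X) (q : E ⟶ T) (k : ℕ)
    (t : A ⟶ T _⦋k⦌) (u : A ⟶ U _⦋k⦌) : Prop where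
  base : t ≫ g.app (op ⦋k⦌) = u ≫ f.app (op ⦋k⦌)
  low : ∀ j, j < n → ∀ θ : (⦋j⦌ : SimplexCategory) ⟶ ⦋k⦌, ∃ e : A ⟶ E _⦋j⦌,
    e ≫ q.app (op ⦋j⦌) = t ≫ T.map θ.op ∧ e ≫ p.app (op ⦋j⦌) = u ≫ U.map θ.op

namespace IsHigherQuotient

/-- After passage to a cover, t lifts to E, and transport moves the lift over u. A simplex of E is
determined by its images in T and U, so the result descends. -/
lemma exists_of_overRel (h : IsHigherQuotient W n p f g q) (hW : IsCategoryWithCovers W)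
    (H : UniqueFillings n p f) {t : A ⟶ T _⦋k⦌} {u : A ⟶ U _⦋k⦌} (htu : OverRel n p f g q k t u) :
    ∃ e : A ⟶ E _⦋k⦌, e ≫ q.app (op ⦋k⦌) = t ∧ e ≫ p.app (op ⦋k⦌) = u := by
  obtain ⟨D, c, e₀, hc, he₀⟩ := h.exists_lift hW t
  have hlow : LowRel n f k (e₀ ≫ p.app (op ⦋k⦌)) (c ≫ u) := by
    refine ⟨?_, fun j hj θ => ?_⟩
    · rw [Category.assoc, ← NatTrans.comp_app, ← h.fac_app, ← Category.assoc, he₀, Category.assoc,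
        htu.base, Category.assoc]
    · obtain ⟨e, he, he'⟩ := htu.low j hj θ
      have : c ≫ e = e₀ ≫ E.map θ.op := by
        refine ((h.rel j _ _).1 ?_).eq_of_lt hj
        rw [Category.assoc, he, Category.assoc, q.naturality, ← Category.assoc, ← Category.assoc,
          he₀]
      rw [Category.assoc, ← p.naturality, ← Category.assoc, ← this, Category.assoc, he',
        Category.assoc]
  obtain ⟨b, hb, hb'⟩ := exists_transport H e₀ (c ≫ u) hlow
  have hbq : b ≫ q.app (op ⦋k⦌) = c ≫ t := by rw [← (h.rel k _ _).2 hb, he₀]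
  obtain ⟨e, he⟩ := hW.exists_desc hc b fun x y hxy => h.hom_ext H
    (by rw [Category.assoc, hbq, Category.assoc, hbq, ← Category.assoc, hxy, Category.assoc])
    (by rw [Category.assoc, hb', Category.assoc, hb', ← Category.assoc, hxy, Category.assoc])
  exact ⟨e, hW.hom_ext hc (by rw [← Category.assoc, he, hbq]),
    hW.hom_ext hc (by rw [← Category.assoc, he, hb'])⟩

/-- Families of simplices of dimension less than `n` lift to `E`. -/
lemma exists_lift_skel (h : IsHigherQuotient W n p f g q) (hW : IsCategoryWithCovers W)
    (y : Fam (k := k) (SkelP n) T A) :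
    ∃ z : Fam (k := k) (SkelP n) E A, ∀ {m : SimplexCategory} (α : m ⟶ ⦋k⦌) (hα : SkelP n (verts α)),
      z.val α hα ≫ q.app (op m) = y.val α hα := by
  have hcard : ∀ {m : SimplexCategory} (α : m ⟶ ⦋k⦌), ∃ j, (verts α).card = j + 1 := fun α =>
    Nat.exists_eq_succ_of_ne_zero (Finset.card_pos.2 (verts_nonempty α)).ne'
  -- Each simplex factors through the face spanned by its vertices. That face has dimension `d α`,
  -- less than n on the skeleton, where q is invertible.
  choose d hd using @hcard
  choose β hβ using fun {m : SimplexCategory} (α : m ⟶ ⦋k⦌) =>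
    exists_comp_faceHom (verts α) (hd α) α subset_rfl
  have hdn : ∀ {m : SimplexCategory} (α : m ⟶ ⦋k⦌), SkelP n (verts α) → d α < n := fun α hα => by
    have := hd α
    change (verts α).card ≤ n at hα
    omega
  have hP : ∀ {m : SimplexCategory} (α : m ⟶ ⦋k⦌), SkelP n (verts α) →
      SkelP n (verts (faceHom _ (hd α))) := fun α hα => by
    rw [verts_faceHom]
    exact hα
  have hex : ∀ {m : SimplexCategory} (α : m ⟶ ⦋k⦌) (hα : SkelP n (verts α)),
      ∃ e : A ⟶ E _⦋d α⦌, e ≫ q.app (op ⦋d α⦌) = y.val (faceHom _ (hd α)) (hP α hα) := fun α hα => by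
    have := h.isIso_app hW (hdn α hα)
    exact ⟨_ ≫ inv (q.app (op ⦋d α⦌)), by rw [Category.assoc, IsIso.inv_hom_id, Category.comp_id]⟩
  choose e he using @hex
  refine ⟨{ val := fun α hα => e α hα ≫ E.map (β α).op
            nat := fun {m m'} γ α hα hα' => ?_ }, fun α hα => ?_⟩
  · obtain ⟨i, hi⟩ := exists_comp_faceHom (verts α) (hd α) (faceHom _ (hd (γ ≫ α))) (by
      rw [verts_faceHom]
      exact verts_comp_subset _ _)
    have h₁ : e (γ ≫ α) hα' = e α hα ≫ E.map i.op := by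
      refine ((h.rel _ _ _).1 ?_).eq_of_lt (hdn _ hα')
      have hi' : SkelP n (verts (i ≫ faceHom _ (hd α))) := by
        rw [hi]
        exact hP _ hα'
      rw [he, Category.assoc, q.naturality, ← Category.assoc, he, ← y.nat i _ (hP α hα) hi']
      exact y.val_congr hi.symm _ _
    rw [h₁, Category.assoc, Category.assoc, map_op_comp, map_op_comp]
    congr 3
    rw [← cancel_mono (faceHom _ (hd α)), Category.assoc, hi, hβ, Category.assoc, hβ]
  · have hα' : SkelP n (verts (β α ≫ faceHom _ (hd α))) := by
      rw [hβ]
      exact hα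
    change (e α hα ≫ E.map (β α).op) ≫ _ = _
    rw [Category.assoc, q.naturality, ← Category.assoc, he, ← y.nat _ _ (hP α hα) hα']
    exact y.val_congr (hβ α) _ _

variable {P : Finset (Fin (k + 1)) → Prop}

/-- On a cover, s and t are lifted to E over the same simplex of U. The lifts have the same faces in
P, since such faces are determined by their images in T and U, so uniqueness for p identifies them.
-/
lemma ofSimplex_injective (h : IsHigherQuotient W n p f g q) (hW : IsCategoryWithCovers W)
    (H : UniqueFillings n p f) (hSP : ∀ S, SkelP n S → P S)
    (hP : ∀ A, Function.Bijective (ofPoint (relFam P p) (tautFam P p) A)) {s t : A ⟶ T _⦋k⦌}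
    (hst : RelFam.ofSimplex P g s = RelFam.ofSimplex P g t) : s = t := by
  have hbase : s ≫ g.app (op ⦋k⦌) = t ≫ g.app (op ⦋k⦌) :=
    congrArg (fun y : RelFam P g A => y.right) hst
  have hface : ∀ {m : SimplexCategory} (α : m ⟶ ⦋k⦌), P (verts α) →
      s ≫ T.map α.op = t ≫ T.map α.op := fun α hα =>
    congrArg (fun y : RelFam P g A => y.left.val α hα) hst
  obtain ⟨D, c, e₀, hc, he₀⟩ := h.exists_lift hW s
  obtain ⟨e₁, he₁, he₁'⟩ := h.exists_of_overRel hW H (t := c ≫ t) (u := e₀ ≫ p.app (op ⦋k⦌))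
    ⟨by rw [Category.assoc, ← hbase, ← Category.assoc, ← he₀, Category.assoc, h.fac_app,
      Category.assoc, NatTrans.comp_app], fun j hj θ => ⟨e₀ ≫ E.map θ.op, by
        rw [Category.assoc, q.naturality, ← Category.assoc, he₀, Category.assoc,
          hface θ (hSP _ ((card_verts_le θ).trans hj)), Category.assoc], by
        rw [Category.assoc, p.naturality, Category.assoc]⟩⟩
  have he : e₀ = e₁ := by
    refine (hP D).1 ?_
    rw [ofPoint_tautFam, ofPoint_tautFam]
    refine RelFam.ext' (fun {m} α hα => ?_) he₁'.symm
    induction m using SimplexCategory.rec with | _ m =>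
    change e₀ ≫ E.map α.op = e₁ ≫ E.map α.op
    refine h.hom_ext H ?_ ?_
    · rw [Category.assoc, Category.assoc, q.naturality, ← Category.assoc, ← Category.assoc, he₀,
        he₁, Category.assoc, Category.assoc, hface α hα]
    · rw [Category.assoc, Category.assoc, p.naturality, ← Category.assoc, ← Category.assoc, he₁']
  exact hW.hom_ext hc (by rw [← he₀, he, he₁])

/-- The low-dimensional part of y lives in E, hence in U, and locally extends to a k-simplex u of U
because f is a hypercover. Over u the family y lifts uniquely to E, p supplies a filler, and its
image in T descends. -/
lemma ofSimplex_surjective (h : IsHigherQuotient W n p f g q) (hW : IsCategoryWithCovers W)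
    (H : UniqueFillings n p f) {m : ℕ∞} (hf : IsHypercover W m f) (hSP : ∀ S, SkelP n S → P S)
    (hP : ∀ A, Function.Bijective (ofPoint (relFam P p) (tautFam P p) A)) (y : RelFam P g A) :
    ∃ t : A ⟶ T _⦋k⦌, RelFam.ofSimplex P g t = y := by
  have := hW.isMultiplicative
  obtain ⟨z, hz⟩ := h.exists_lift_skel hW (y.left.restrict hSP)
  -- Over the cover `D`, u extends the image of the (n-1)-skeleton in U and lies over the given
  -- simplex of X.
  obtain ⟨D, c, u, hc, hu, -⟩ := isRelCover_tautFam (W := W) f (isLower_skelP n)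
    (fun j _ _ _ => hf.cell hW j) A (show RelFam (SkelP n) f A from
      { left := z.map p
        right := y.right
        w := fun α hα => by
          change (z.val α hα ≫ p.app _) ≫ f.app _ = _
          rw [Category.assoc, ← NatTrans.comp_app, ← h.fac_app, ← Category.assoc, hz]
          exact y.w α (hSP _ hα) })
  rw [ofPoint_tautFam] at hu
  have hub : u ≫ f.app (op ⦋k⦌) = c ≫ y.right :=
    congrArg (fun y : RelFam (SkelP n) f D => y.right) hu
  have hul : ∀ {m : SimplexCategory} (α : m ⟶ ⦋k⦌) (hα : SkelP n (verts α)),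
      u ≫ U.map α.op = c ≫ z.val α hα ≫ p.app (op m) := fun α hα =>
    congrArg (fun y : RelFam (SkelP n) f D => y.left.val α hα) hu
  have hex : ∀ {m : SimplexCategory} (α : m ⟶ ⦋k⦌) (hα : P (verts α)),
      ∃ e : D ⟶ E.obj (op m), e ≫ q.app (op m) = c ≫ y.left.val α hα ∧
        e ≫ p.app (op m) = u ≫ U.map α.op := by
    intro m α hα
    induction m using SimplexCategory.rec with | _ m =>
    refine h.exists_of_overRel hW H ⟨?_, fun j hj θ => ?_⟩
    · rw [Category.assoc, y.w, ← Category.assoc, ← hub, Category.assoc, Category.assoc,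
        f.naturality]
    · have hθ : SkelP n (verts (θ ≫ α)) :=
        (card_verts_le _).trans hj
      refine ⟨c ≫ z.val (θ ≫ α) hθ, ?_, ?_⟩
      · rw [Category.assoc, hz, Category.assoc, ← y.left.nat θ α hα (hSP _ hθ)]
        rfl
      · rw [Category.assoc, ← hul, Category.assoc, map_op_comp]
  choose e he he' using @hex
  obtain ⟨x, hx⟩ := (hP D).2 (show RelFam P p D from
    { left :=
        { val := fun α hα => e α hα
          nat := fun {m m'} γ α hα hα' => by
            induction m' using SimplexCategory.rec with | _ m' =>
            refine h.hom_ext H ?_ ?_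
            · rw [he, Category.assoc, q.naturality, ← Category.assoc, he, y.left.nat γ α hα hα',
                Category.assoc]
            · rw [he', Category.assoc, p.naturality, ← Category.assoc, he', Category.assoc,
                map_op_comp] }
      right := u
      w := fun α hα => he' α hα })
  rw [ofPoint_tautFam] at hx
  have hxb : x ≫ p.app (op ⦋k⦌) = u := congrArg (fun y : RelFam P p D => y.right) hx
  have hxl : ∀ {m : SimplexCategory} (α : m ⟶ ⦋k⦌) (hα : P (verts α)),
      x ≫ E.map α.op = e α hα := fun α hα =>
    congrArg (fun y : RelFam P p D => y.left.val α hα) hx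
  have hpre : RelFam.ofSimplex P g (x ≫ q.app (op ⦋k⦌)) = y.pre c := by
    refine RelFam.ext' (fun α hα => ?_) ?_
    · change (x ≫ q.app (op ⦋k⦌)) ≫ T.map α.op = c ≫ y.left.val α hα
      rw [Category.assoc, ← q.naturality, ← Category.assoc, hxl α hα, he]
    · change (x ≫ q.app (op ⦋k⦌)) ≫ g.app (op ⦋k⦌) = c ≫ y.right
      rw [Category.assoc, h.fac_app, NatTrans.comp_app, ← Category.assoc, hxb, hub]
  have hpc : ∀ {B : C} (b : B ⟶ D) (s : D ⟶ T _⦋k⦌),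
      RelFam.ofSimplex P g (b ≫ s) = (RelFam.ofSimplex P g s).pre b := fun b s =>
    RelFam.ext' (fun α hα => Category.assoc _ _ _) (Category.assoc _ _ _)
  -- Both pullbacks of the local filler fill the same family, so they agree by
  -- `ofSimplex_injective`.
  obtain ⟨t, ht⟩ := hW.exists_desc hc (x ≫ q.app (op ⦋k⦌)) fun a b hab => by
    refine h.ofSimplex_injective hW H hSP hP ?_
    rw [hpc, hpc, hpre]
    refine RelFam.ext' (fun α hα => ?_) ?_
    · change a ≫ c ≫ y.left.val α hα = b ≫ c ≫ y.left.val α hα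
      rw [← Category.assoc, hab, Category.assoc]
    · change a ≫ c ≫ y.right = b ≫ c ≫ y.right
      rw [← Category.assoc, hab, Category.assoc]
  refine ⟨t, RelFam.ext' (fun α hα => hW.hom_ext hc ?_) (hW.hom_ext hc ?_)⟩
  · refine Eq.trans ?_ (congrArg (fun y : RelFam P g D => y.left.val α hα) hpre)
    change c ≫ t ≫ T.map α.op = (x ≫ q.app (op ⦋k⦌)) ≫ T.map α.op
    rw [← Category.assoc, ht]
  · refine Eq.trans ?_ (congrArg (fun y : RelFam P g D => y.right) hpre)
    change c ≫ t ≫ g.app _ = (x ≫ q.app (op ⦋k⦌)) ≫ g.app _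
    rw [← Category.assoc, ht]

lemma relLimit (h : IsHigherQuotient W n p f g q) (hW : IsCategoryWithCovers W)
    (H : UniqueFillings n p f) {m : ℕ∞} (hf : IsHypercover W m f) (hSP : ∀ S, SkelP n S → P S)
    (hP : ∀ A, Function.Bijective (ofPoint (relFam P p) (tautFam P p) A))
    {S : (Δ[k] : SSet.{v}).Subcomplex} (hS : IsVertexSubcomplex S P) :
    RelLimit g S (fun l => IsIso l) := by
  rw [relLimit_iff hS]
  refine mapToLimit_of_bijective (inferInstanceAs (IsIso (𝟙 _))) fun A => ⟨fun s t hst => ?_, ?_⟩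
  · refine h.ofSimplex_injective hW H hSP hP ?_
    have := (ofPoint_tautFam (P := P) g s).symm.trans (Eq.trans hst (ofPoint_tautFam g t))
    exact this
  · intro (y : RelFam P g A)
    obtain ⟨t, ht⟩ := h.ofSimplex_surjective hW H hf hSP hP y
    exact ⟨t, (ofPoint_tautFam g t).trans ht⟩

end IsHigherQuotient

/-- Unique fillings of horns give unique fillings of boundaries. -/
lemma bijective_bdry_of_horn (hInj : ∀ j, k ≤ j → HornInj p j) (hFill : ∀ j, k ≤ j → HornFill p j)
    (A : C) :
    Function.Bijective (ofPoint (relFam BdryP p) (tautFam (k := k + 2) BdryP p) A) := by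
  have hδ : ∀ l : Fin (k + 3), BdryP (verts (SimplexCategory.δ l)) := fun l => ⟨l, by
    have := notMem_verts_comp_δ (𝟙 _) l
    rwa [Category.id_comp] at this⟩
  constructor
  · intro x x' hx
    rw [ofPoint_tautFam, ofPoint_tautFam] at hx
    exact hInj (k + 1) (by omega) 0 x x'
      (fun j _ => congrArg (fun y : RelFam BdryP p A => y.left.val _ (hδ j)) hx)
      (congrArg (fun y : RelFam BdryP p A => y.right) hx)
  · intro (y : RelFam BdryP p A)
    have hval : ∀ (l : Fin (k + 3)) {m : SimplexCategory} (β : m ⟶ ⦋k + 1⦌)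
        (hβ : BdryP (verts (β ≫ SimplexCategory.δ l))),
        y.left.val (SimplexCategory.δ l) (hδ l) ≫ E.map β.op = y.left.val _ hβ :=
      fun l m β hβ => (y.left.nat β _ _ _).symm
    have hb : ∀ (l : Fin (k + 3)) {m : SimplexCategory} (β : m ⟶ ⦋k + 1⦌),
        BdryP (verts (β ≫ SimplexCategory.δ l)) := fun l _ β => ⟨l, notMem_verts_comp_δ β l⟩
    obtain ⟨x, hx, hxp⟩ := hFill (k + 1) (by omega) 0
      (fun l => y.left.val (SimplexCategory.δ l) (hδ l)) y.right
      (fun j j' _ _ m β β' e => by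
        rw [hval j β (hb _ _), hval j' β' (hb _ _)]
        exact y.left.val_congr e _ _) (fun j _ => y.w _ _)
    -- The face missing from the horn has the prescribed boundary and image, so unique horn filling
    -- one dimension lower identifies it.
    have hx₀ : x ≫ E.δ 0 = y.left.val (SimplexCategory.δ 0) (hδ 0) := by
      refine hInj k le_rfl 0 _ _ (fun j _ => ?_) ?_
      · have hj : j.succ ∉ verts (SimplexCategory.δ j ≫ SimplexCategory.δ (0 : Fin (k + 3))) := by
          have e : SimplexCategory.δ j ≫ SimplexCategory.δ (0 : Fin (k + 3)) =
              SimplexCategory.δ 0 ≫ SimplexCategory.δ j.succ :=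
            (SimplexCategory.δ_comp_δ (Fin.zero_le j)).symm
          rw [e]
          exact notMem_verts_comp_δ _ _
        obtain ⟨γ, hγ⟩ := exists_comp_δ _ _ hj
        have h₁ : (x ≫ E.δ 0) ≫ E.δ j = (x ≫ E.δ j.succ) ≫ E.map γ.op := by
          simp only [SimplicialObject.δ, Category.assoc]
          rw [map_op_comp, map_op_comp, hγ]
        rw [h₁, hx j.succ (Fin.succ_ne_zero j), hval _ _ (hb _ _)]
        refine (y.left.val_congr hγ _ (hb _ _)).trans ?_
        exact (hval _ _ _).symm
      · rw [Category.assoc, SimplicialObject.δ_naturality, ← Category.assoc, hxp]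
        exact (y.w _ _).symm
    refine ⟨x, (ofPoint_tautFam p x).trans (RelFam.ext' (fun {m} α hα => ?_) hxp)⟩
    obtain ⟨l, hl⟩ := id hα
    obtain ⟨γ, rfl⟩ := exists_comp_δ α l hl
    have hxl : x ≫ E.δ l = y.left.val (SimplexCategory.δ l) (hδ l) := by
      by_cases h0 : l = 0
      · subst h0
        exact hx₀
      · exact hx l h0
    change x ≫ E.map (γ ≫ SimplexCategory.δ l).op = _
    rw [← map_op_comp, ← Category.assoc, ← hval l γ hα]
    exact congrArg (· ≫ E.map γ.op) hxl

/-- The cells outside sk_{n+1} have dimension at least n + 2. There unique fillers of horns, in that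
dimension and the one below, give unique fillers of boundaries. -/
lemma UniqueFillings.bijective_skel (H : UniqueFillings n p f) (k : ℕ) (A : C) :
    Function.Bijective (ofPoint (relFam (SkelP (n + 2)) p) (tautFam (k := k) (SkelP (n + 2)) p) A) := by
  refine IsRelCover.bijective (isRelCover_tautFam p (isLower_skelP _) fun j S hS hS' => ?_)
    (isNatural_ofPoint _) A
  obtain ⟨i, rfl, hi⟩ : ∃ i, j = i + 2 ∧ n ≤ i := by
    have : n + 2 < S.card := not_le.1 hS'
    exact ⟨j - 2, by omega, by omega⟩
  exact IsRelCover.of_bijective (isNatural_ofPoint _) (bijective_bdry_of_horn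
    (fun j hj => H.pInj j (hi.trans hj)) fun j hj => H.pFill j (hi.trans hj))

end Strictification

end HigherStack

/-! ### Descent for local n-bundles -/

theorem mainTheorem1 {C : Type u} [Category.{v} C] (W : MorphismProperty C)
    (hW : HigherStack.IsCategoryWithCovers W) (hG : HigherStack.GodemontHolds W)
    (n : ℕ) {E U X : SimplicialObject C} (p : E ⟶ U) (f : U ⟶ X)
    (hp : HigherStack.IsLocalBundle W n p)
    (hf : HigherStack.IsHypercover W ((n : ℕ∞) + 1) f) :
    HigherStack.IsStack W ((n : ℕ∞) + 1) (p ≫ f) ∧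
    (∃ (P : SimplicialObject C) (ι : P ⟶ HigherStack.joinShift n E),
      HigherStack.IsHigherMorphismSpace n (p ≫ f) ι ∧
      HigherStack.IsLieGroupoid W 1 P ∧
      HigherStack.IsRegular W P ∧
      ∃ (Q : C) (q : P.obj (Opposite.op (SimplexCategory.mk 0)) ⟶ Q), HigherStack.IsOrbitSpace W P q) ∧
    (HigherStack.EffectiveOrbitSpaces W →
      ∃ (T : SimplicialObject C) (g : T ⟶ X) (q : E ⟶ T),
        HigherStack.IsStrictification W n (p ≫ f) g q) := by
  have H := HigherStack.uniqueFillings hW hp.stack hf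
  obtain ⟨Y, ψ, hψ, -, -⟩ := hp.twisted
  have hψ' := fun k => HigherStack.isProd_of_isLimit (hψ k)
  -- Transport relations are needed for all k: level n gives the higher morphism space, and all
  -- levels together give the strictification.
  choose V v hv hvr using fun k => hf.exists_lowQuotient hW n k
  have ht := fun k => H.isTransportRel (hvr k)
  have hc := (ht n).isCoverRel hW (hv n)
  obtain ⟨P, π, hP⟩ := hc.exists_isNerve
  obtain ⟨ι, hι, hι₀⟩ := hP.exists_isHigherMorphismSpace H hc
  have hL := hP.isLieGroupoid hW hc
  have hR := hP.isRegular hW (ht n) (hv n) (hψ' n)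
  refine ⟨hp.stack.comp_isHypercover hW hf, ⟨P, ι, hι, hL, hR, hG 1 P hL hR⟩, fun hE => ?_⟩
  obtain ⟨T, g, q, h⟩ := HigherStack.exists_isHigherQuotient hW fun k =>
    (ht k).exists_quotient hW hG hE (hv k) (hψ' k)
  refine ⟨T, g, q, h.fac, fun k hk => h.isIso_app hW hk, ⟨P, ι, hι, ?_⟩, ?_, fun k => ?_⟩
  · rw [hι₀]
    exact hP.isOrbitSpace hW hc (h.cover n) (h.rel n)
  -- A set of vertices not in the horn Λ^{n+1}_1 has at least n + 1 elements, so the horn contains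
  -- the (n-1)-skeleton, and unique filling for p in dimension n + 1 carries over to T.
  · refine h.relLimit hW H hf (fun S hS => ?_) (hp.stack.horn_iso (by exact_mod_cast n.lt_succ_self) 1)
      (HigherStack.isVertexSubcomplex_horn 1)
    by_contra hS'
    have h₁ := HigherStack.le_card_of_not_hornP hS'
    have h₂ : S.card ≤ n := hS
    omega
  · exact h.relLimit hW H hf (fun S hS => le_trans hS (by omega)) (H.bijective_skel k)
      (HigherStack.isVertexSubcomplex_skeleton (n + 2))
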